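/- Let $n\ge 1$ and let $M$ be a compact smooth manifold of dimension $2n+1$ (Hausdorff, without boundary) with a contact form $\eta$. On $\mathbb{R}^{2n+1}$ put $\eta_0=dx^{2n+1}-\sum_{j=1}^n x^{n+j}dx^j$, $X_j=\partial_{x^j}+x^{n+j}\partial_{x^{2n+1}}$, $X_{n+j}=\partial_{x^{n+j}}$ ($1\le j\le n$), and $X_I=X_{i_1}\cdots X_{i_t}$, $|I|=t$, for $I=(i_1,\dots,i_t)$ with $1\le i_k\le 2n$. Fix an adapted atlas of $M$: finitely many smooth charts $\phi_\alpha:U_\alpha\to\mathbb{R}^{2n+1}$ with $\phi_\alpha^*\eta_0=\eta$, and open sets $D_\alpha$ with $\overline{D_\alpha}$ a compact subset of $\phi_\alpha(U_\alpha)$, such that the sets $\phi_\alpha^{-1}(D_\alpha)$ cover $M$. For a smooth real vector bundle $E\to M$ of finite rank with a smooth vector bundle injection $\iota:E\hookrightarrow M\times\mathbb{R}^r$, the Folland--Stein space $\Gamma^s(E)$ is the Hilbert space completion of the space of smooth sections of $E$ with respect to the inner product $$\langle\sigma,\tau\rangle_s=\sum_\alpha\sum_{|I|\le s}\int_{D_\alpha}\big\langle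 X_I(\iota\circ\sigma\circ\phi_\alpha^{-1}),\,X_I(\iota\circ\tau\circ\phi_\alpha^{-1})\big\rangle\,dx$$ (where $\iota\circ\sigma$ is regarded as an $\mathbb{R}^r$-valued function), with norm $\|\cdot\|_s$. Let $E_1,E_2\to M$ be smooth real vector bundles of finite rank with such injections, let $F:E_1\to E_2$ be a smooth (not necessarily linear) fibre-preserving map over the identity of $M$, and let $s\ge 2n+4$. Then, for $j=1,2$, each element of $\Gamma^s(E_j)$ is represented almost everywhere by a unique continuous section of $E_j$, and distinct elements by distinct sections, so that $\Gamma^s(E_j)$ is identified with a space of continuous sections of $E_j$. If $\sigma\in\Gamma^s(E_1)$, then $F\circ\sigma\in\Gamma^s(E_2)$, and the map $$\Gamma_F:\Gamma^s(E_1)\to\Gamma^s(E_2),\qquad \sigma\mapsto F\circ\sigma,$$ is $C^\infty$. Moreover, let $|\cdot|$ be a continuous norm on the fibres of $E_1$. Then for every $\sigma\in\Gamma^s(E_1)$ and every $c>0$ there is a real polynomial $Q$ in two variables, with non-negative coefficients and total degree at most $s$, such that $$\|F\circ\sigma-F\circ\sigma'\|_s\le\|\sigma-\sigma'\|_s\,Q(\|\sigma\|_s,\|\sigma'\|_s)$$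 for all $\sigma'\in\Gamma^s(E_1)$ with $|\sigma'(x)-\sigma(x)|<c$ for all $x\in M$. -/

import Mathlib

open scoped Manifold ContDiff Bundle
open MeasureTheory Bundle

noncomputable section

namespace FollandStein

/-- Euclidean space `ℝ^{2n+1}`, with coordinates `x^1, …, x^{2n+1}` indexed from `0` to `2n`. -/
abbrev Space (n : ℕ) : Type := EuclideanSpace ℝ (Fin (2 * n + 1))

/-- The index of the coordinate `x^{j}`, `1 ≤ j ≤ n`. -/
def idxX {n : ℕ} (j : Fin n) : Fin (2 * n + 1) := ⟨j.val, by omega⟩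

/-- The index of the coordinate `x^{n+j}`, `1 ≤ j ≤ n`. -/
def idxY {n : ℕ} (j : Fin n) : Fin (2 * n + 1) := ⟨n + j.val, by omega⟩

/-- The standard contact form `η₀ = dx^{2n+1} - ∑_j x^{n+j} dx^j` on `ℝ^{2n+1}`. -/
def stdForm (n : ℕ) (x : Space n) : Space n →L[ℝ] ℝ :=
  EuclideanSpace.proj (Fin.last (2 * n)) -
    ∑ j : Fin n, x (idxY j) • (EuclideanSpace.proj (idxX j) : Space n →L[ℝ] ℝ)

/-- The standard framing of `ker η₀`:
`X_j = ∂/∂x^j + x^{n+j} ∂/∂x^{2n+1}` and `X_{n+j} = ∂/∂x^{n+j}`, for `1 ≤ j ≤ n`. -/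
def frame (n : ℕ) (i : Fin (2 * n)) (x : Space n) : Space n :=
  if h : i.val < n then
    EuclideanSpace.single (idxX ⟨i.val, h⟩) (1 : ℝ) +
      x (idxY ⟨i.val, h⟩) • EuclideanSpace.single (Fin.last (2 * n)) (1 : ℝ)
  else EuclideanSpace.single i.castSucc (1 : ℝ)

/-- The iterated horizontal derivative `X_I f = X_{i₁} X_{i₂} ⋯ X_{i_t} f`, `I = (i₁, …, i_t)`. -/
def horDeriv {n r : ℕ} : List (Fin (2 * n)) → (Space n → EuclideanSpace ℝ (Fin r)) →
    Space n → EuclideanSpace ℝ (Fin r)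
  | [], f => f
  | i :: I, f => fun x => fderiv ℝ (horDeriv I f) x (frame n i x)

/-- Multi-indices `I = (i₁, …, i_t)` of order `t ≤ s` with entries in `{1, …, 2n}`. -/
abbrev MultiIndex (n s : ℕ) : Type := Σ t : Fin (s + 1), (Fin t.val → Fin (2 * n))

section Contact

variable {n : ℕ} {M : Type*} [TopologicalSpace M] [ChartedSpace (Space n) M]

/-- The expression of a one-form `η` on `M` in a chart `φ`, i.e. `(φ⁻¹)^* η`. -/
def localForm (η : ∀ x : M, TangentSpace (𝓡 (2 * n + 1)) x →L[ℝ] ℝ)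
    (φ : OpenPartialHomeomorph M (Space n)) (y : Space n) : Space n →L[ℝ] ℝ :=
  (η (φ.symm y)).comp (mfderiv (𝓡 (2 * n + 1)) (𝓡 (2 * n + 1)) φ.symm y)

/-- The exterior derivative `dα(v, w)` at `y` of a one-form `α` on `ℝ^{2n+1}`. -/
def extD (α : Space n → (Space n →L[ℝ] ℝ)) (y v w : Space n) : ℝ :=
  fderiv ℝ α y v w - fderiv ℝ α y w v

variable (n M) in
/-- A contact form on a `(2n+1)`-dimensional manifold: a smooth one-form `η` that vanishes nowhere
and for which `dη` is non-degenerate on `H = ker η`; equivalently, `η ∧ (dη)^n` vanishes nowhere. -/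
structure ContactForm where
  toFun : ∀ x : M, TangentSpace (𝓡 (2 * n + 1)) x →L[ℝ] ℝ
  smooth : ∀ φ ∈ IsManifold.maximalAtlas (𝓡 (2 * n + 1)) ∞ M,
    ContDiffOn ℝ ∞ (localForm toFun φ) φ.target
  ne_zero : ∀ x : M, toFun x ≠ 0
  nondegenerate : ∀ φ ∈ IsManifold.maximalAtlas (𝓡 (2 * n + 1)) ∞ M, ∀ y ∈ φ.target,
    ∀ v : Space n, localForm toFun φ y v = 0 → v ≠ 0 →
      ∃ w : Space n, localForm toFun φ y w = 0 ∧ extD (localForm toFun φ) y v w ≠ 0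

/-- An adapted atlas: finitely many smooth charts `φ_a : U_a → ℝ^{2n+1}` with `φ_a^* η₀ = η`, and
open sets `D_a ⋐ φ_a(U_a)` such that the sets `φ_a⁻¹(D_a)` cover `M`. -/
structure AdaptedAtlas (η : ContactForm n M) where
  card : ℕ
  chart : Fin card → OpenPartialHomeomorph M (Space n)
  mem_maximalAtlas : ∀ a, chart a ∈ IsManifold.maximalAtlas (𝓡 (2 * n + 1)) ∞ M
  adapted : ∀ a, ∀ x ∈ (chart a).source,
    η.toFun x = (stdForm n (chart a x)).comp
      (mfderiv (𝓡 (2 * n + 1)) (𝓡 (2 * n + 1)) (chart a) x)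
  dom : Fin card → Set (Space n)
  isOpen_dom : ∀ a, IsOpen (dom a)
  isCompact_closure_dom : ∀ a, IsCompact (closure (dom a))
  closure_dom_subset : ∀ a, closure (dom a) ⊆ (chart a).target
  cover : ∀ x : M, ∃ a, x ∈ (chart a).source ∧ chart a x ∈ dom a

end Contact

section Bundle

variable {n : ℕ} {M : Type*} [TopologicalSpace M] [ChartedSpace (Space n) M]
  (V : Type*) [NormedAddCommGroup V] [NormedSpace ℝ V]
  (E : M → Type*) [TopologicalSpace (TotalSpace V E)] [∀ x, AddCommGroup (E x)]
  [∀ x, Module ℝ (E x)] [∀ x, TopologicalSpace (E x)] [FiberBundle V E] [VectorBundle ℝ V E]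

variable (n) in
/-- A smooth vector bundle injection of `E` into the trivial bundle `M × ℝ^r`. -/
structure BundleInjection where
  r : ℕ
  toFun : ∀ x : M, E x →ₗ[ℝ] EuclideanSpace ℝ (Fin r)
  injective : ∀ x, Function.Injective (toFun x)
  smooth : ContMDiff ((𝓡 (2 * n + 1)).prod 𝓘(ℝ, V)) 𝓘(ℝ, EuclideanSpace ℝ (Fin r)) ∞
    (fun p : TotalSpace V E => toFun p.proj p.snd)

/-- A continuous norm on the fibres of `E`. -/
structure FibreNorm where
  toFun : ∀ x : M, Seminorm ℝ (E x)
  definite : ∀ (x : M) (v : E x), toFun x v = 0 → v = 0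
  continuous : Continuous (fun p : TotalSpace V E => toFun p.proj p.snd)

variable {V E} {η : ContactForm n M}

/-- The expression `ι ∘ σ ∘ φ_a⁻¹` of a section `σ` in the chart `φ_a`. -/
def localRep (A : AdaptedAtlas η) (ι : BundleInjection n V E) (σ : ∀ x, E x) (a : Fin A.card)
    (y : Space n) : EuclideanSpace ℝ (Fin ι.r) :=
  ι.toFun ((A.chart a).symm y) (σ ((A.chart a).symm y))

/-- The Hilbert sum `⨁_{a, |I| ≤ s} L²(D_a, ℝ^r)`, with inner product
`(u, v) = ∑_a ∑_{|I| ≤ s} ∫_{D_a} ⟨u_{a,I}, v_{a,I}⟩`. (The volume form `η₀ ∧ (dη₀)^n / n!` is,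
up to sign, the Lebesgue volume form.) -/
abbrev Ambient (A : AdaptedAtlas η) (r s : ℕ) : Type :=
  PiLp 2 (fun p : Fin A.card × MultiIndex n s =>
    Lp (EuclideanSpace ℝ (Fin r)) 2 ((volume : Measure (Space n)).restrict (A.dom p.1)))

/-- The tuples `(X_I (ι ∘ σ ∘ φ_a⁻¹))_{a, |I| ≤ s}`, for `σ` a smooth section of `E`. -/
def smoothJets (A : AdaptedAtlas η) (ι : BundleInjection n V E) (s : ℕ) :
    Set (Ambient A ι.r s) :=
  {u | ∃ σ : ∀ x, E x,
    ContMDiff (𝓡 (2 * n + 1)) ((𝓡 (2 * n + 1)).prod 𝓘(ℝ, V)) ∞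
      (fun x => (⟨x, σ x⟩ : TotalSpace V E)) ∧
    ∀ (a : Fin A.card) (I : MultiIndex n s),
      (u (a, I) : Space n → EuclideanSpace ℝ (Fin ι.r))
        =ᵐ[(volume : Measure (Space n)).restrict (A.dom a)]
          horDeriv (List.ofFn I.2) (localRep A ι σ a)}

/-- The Folland-Stein space `Γ^s(E)`: the Hilbert space completion of the space of smooth sections
of `E` for the inner product `∑_a ∑_{|I| ≤ s} ∫_{D_a} ⟨X_I (ι σ φ_a⁻¹), X_I (ι τ φ_a⁻¹)⟩`. The map
`σ ↦ (X_I (ι σ φ_a⁻¹))_{a, I}` is an isometric linear embedding for this inner product into a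
Hilbert space, so the completion is the closure of its image (the span only makes it evident that
the image is a linear subspace). -/
def FSSpace (A : AdaptedAtlas η) (ι : BundleInjection n V E) (s : ℕ) :
    Submodule ℝ (Ambient A ι.r s) :=
  (Submodule.span ℝ (smoothJets A ι s)).topologicalClosure

/-- The continuous section `σ` is the section given by the element `u` of `Γ^s(E)`: in each chart
it agrees almost everywhere with the component of `u` for the empty multi-index. -/
def IsSectionOf (A : AdaptedAtlas η) (ι : BundleInjection n V E) (s : ℕ) (u : FSSpace A ι s)
    (σ : ∀ x, E x) : Prop :=
  Continuous (fun x => (⟨x, σ x⟩ : TotalSpace V E)) ∧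
  ∀ a : Fin A.card,
    (u.val (a, ⟨0, Fin.elim0⟩) : Space n → EuclideanSpace ℝ (Fin ι.r))
      =ᵐ[(volume : Measure (Space n)).restrict (A.dom a)] localRep A ι σ a

end Bundle

end FollandStein

end

noncomputable section
namespace FollandStein

open scoped ENNReal NNReal Topology
open Set Filter

/-! ### Iterated horizontal derivatives and their pointwise sums of squares. -/

section HorizontalCalculus

variable {n : ℕ} {W W' : Type*} [NormedAddCommGroup W] [NormedSpace ℝ W]
  [NormedAddCommGroup W'] [NormedSpace ℝ W']

/-! The analysis takes place on `Space n`. The integral curves of X_i are straight lines, and along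
them the one-dimensional inequality g(a)^2 ≤ ∫ (g^2 + g'^2) applies. These lines are tilted in the
direction of x^{2n+1}, but after integration over x^{2n+1} the tilt is only a translation and
disappears. So a supremum over one of the first 2n coordinates costs one horizontal derivative
(`marg_last_le`), while a supremum over x^{2n+1} costs two, because ∂/∂x^{2n+1} is a commutator
(`fderiv_last_eq_commutator`). Altogether 2n + 2 derivatives control the supremum
(`enorm_sq_le_hE`). If the coordinates are shared out between two factors, one taken in the supremum
over those where the other is in L², the result is the product estimate `hE_mul_le`: orders a and b
multiply into order k when k ≤ a, b and a + b ≥ k + 2n + 3.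

For a smooth f(y, v) with compact support in y, the chain rule and the product estimate bound f(·,
u) in order s by a polynomial in the norms of u (`hE_nem_le`). A derivative of u has order only s -
1, whence the threshold s ≥ 2n + 4. Hadamard's formula turns this bound into a Lipschitz estimate
and, used once more, into a quadratic estimate of the Taylor remainder (`hE_nem_sub_le`,
`hE_nem_taylor_le`). By density u ↦ f(·, u) extends to the completion. Its derivative is
multiplication by the superposition with ∂f/∂v_j, an operator of the same kind, so induction gives
smoothness (`contDiff_superposition`).

On M, changes of adapted charts preserve η₀ and hence carry horizontal vectors to horizontal
vectors, so the integrals over the D_b control horizontal derivatives on every compact part of every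
chart (`exists_lintegral_hsq_chart_le`). The map F extends to a smooth f : M × ℝ^r → ℝ^{r'} between
the ambient trivial bundles (`exists_extension_fibre_map`). The operator `superM`, assembled from
bounded linear maps and local superpositions, is smooth on the whole Hilbert sum and takes the jet
of G to the jet of f(·, G) (`superM_jetM`). The Sobolev bound attaches a continuous function to each
limit of jets (`supExt`), and passing the derivatives to test functions shows that this function
determines the limit (`eq_of_supExt_eq`). Statements about Γ^s then follow from smooth sections by
continuity. The Lipschitz bound has the form C (1 + ‖σ‖ + ‖σ'‖)^s with C depending on σ and σ' only
through a bound for their suprema, and |σ' - σ| < c supplies such a bound. -/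

theorem _root_.ENNReal.add_sq_le_two_mul (a b : ℝ≥0∞) : (a + b) ^ 2 ≤ 2 * (a ^ 2 + b ^ 2) := by
  rcases eq_or_ne a ⊤ with rfl | ha
  · simp
  rcases eq_or_ne b ⊤ with rfl | hb
  · simp
  lift a to ℝ≥0 using ha
  lift b to ℝ≥0 using hb
  exact_mod_cast add_sq_le (a := a) (b := b)

/-- The horizontal derivative `X_i f`. -/
def horD (i : Fin (2 * n)) (f : Space n → W) : Space n → W :=
  fun x => fderiv ℝ f x (frame n i x)

/-- Iterated horizontal derivatives of functions with values in a normed space. -/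
def horDL : List (Fin (2 * n)) → (Space n → W) → Space n → W
  | [], f => f
  | i :: I, f => horD i (horDL I f)

theorem horDeriv_eq_horDL {r : ℕ} (I : List (Fin (2 * n)))
    (f : Space n → EuclideanSpace ℝ (Fin r)) : horDeriv I f = horDL I f := by
  induction I with
  | nil => rfl
  | cons i I ih => simp only [horDeriv, horDL, ih]; rfl

/-- `horDL` adds derivatives on the outside, whereas the recursion of `hsq` applies the innermost
derivative first; this identity reconciles the two. -/
theorem horDL_append_singleton (I : List (Fin (2 * n))) (i : Fin (2 * n)) (f : Space n → W) :
    horDL (I ++ [i]) f = horDL I (horD i f) := by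
  induction I with
  | nil => rfl
  | cons j I ih => simp only [List.cons_append, horDL, ih]

theorem contDiff_frame (i : Fin (2 * n)) : ContDiff ℝ ∞ (frame n i) := by
  unfold frame
  split_ifs with h
  · have h1 : ContDiff ℝ ∞ fun x : Space n => x (idxY ⟨i.val, h⟩) :=
      (EuclideanSpace.proj (𝕜 := ℝ) (idxY ⟨i.val, h⟩)).contDiff
    exact contDiff_const.add (h1.smul contDiff_const)
  · exact contDiff_const

theorem contDiffOn_horD {U : Set (Space n)} (hU : IsOpen U) {f : Space n → W}
    (hf : ContDiffOn ℝ ∞ f U) (i : Fin (2 * n)) : ContDiffOn ℝ ∞ (horD i f) U := by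
  have h1 : ContDiffOn ℝ ∞ (fderiv ℝ f) U := hf.fderiv_of_isOpen hU (by simp)
  exact h1.clm_apply (contDiff_frame i).contDiffOn

theorem contDiff_horD {f : Space n → W} (hf : ContDiff ℝ ∞ f) (i : Fin (2 * n)) :
    ContDiff ℝ ∞ (horD i f) :=
  contDiffOn_univ.1 (contDiffOn_horD isOpen_univ hf.contDiffOn i)

theorem contDiffOn_horDL {U : Set (Space n)} (hU : IsOpen U) {f : Space n → W}
    (hf : ContDiffOn ℝ ∞ f U) (I : List (Fin (2 * n))) : ContDiffOn ℝ ∞ (horDL I f) U := by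
  induction I with
  | nil => exact hf
  | cons i I ih => exact contDiffOn_horD hU ih i

theorem horD_congr {U : Set (Space n)} (hU : IsOpen U) {f g : Space n → W} (h : EqOn f g U)
    (i : Fin (2 * n)) : EqOn (horD i f) (horD i g) U := fun x hx => by
  have : f =ᶠ[𝓝 x] g := h.eventuallyEq_of_mem (hU.mem_nhds hx)
  simp only [horD, this.fderiv_eq]

theorem horDL_congr {U : Set (Space n)} (hU : IsOpen U) {f g : Space n → W} (h : EqOn f g U)
    (I : List (Fin (2 * n))) : EqOn (horDL I f) (horDL I g) U := by
  induction I with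
  | nil => exact h
  | cons i I ih => exact horD_congr hU ih i

theorem support_horD_subset (f : Space n → W) (i : Fin (2 * n)) :
    tsupport (horD i f) ⊆ tsupport f := by
  refine closure_minimal (fun x hx => ?_) (isClosed_tsupport f)
  refine support_fderiv_subset ℝ (f := f) (fun h => hx ?_)
  simp [horD, h]

theorem hasCompactSupport_horD {f : Space n → W} (hf : HasCompactSupport f) (i : Fin (2 * n)) :
    HasCompactSupport (horD i f) :=
  hf.of_isClosed_subset (isClosed_tsupport _) (support_horD_subset f i)

theorem horD_add_apply {f g : Space n → W} {x : Space n} (hf : DifferentiableAt ℝ f x)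
    (hg : DifferentiableAt ℝ g x) (i : Fin (2 * n)) :
    horD i (fun y => f y + g y) x = horD i f x + horD i g x := by
  simp only [horD, fderiv_fun_add hf hg, _root_.add_apply]

theorem horD_smul_apply {c : Space n → ℝ} {f : Space n → W} {x : Space n}
    (hc : DifferentiableAt ℝ c x) (hf : DifferentiableAt ℝ f x) (i : Fin (2 * n)) :
    horD i (fun y => c y • f y) x = horD i c x • f x + c x • horD i f x := by
  simp only [horD, fderiv_fun_smul hc hf, _root_.add_apply,
    _root_.smul_apply, ContinuousLinearMap.smulRight_apply]
  rw [add_comm]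

theorem horD_mul_apply {f g : Space n → ℝ} {x : Space n} (hf : DifferentiableAt ℝ f x)
    (hg : DifferentiableAt ℝ g x) (i : Fin (2 * n)) :
    horD i (fun y => f y * g y) x = horD i f x * g x + f x * horD i g x := by
  simpa using horD_smul_apply hf hg i

theorem horD_clm_apply (T : W →L[ℝ] W') {f : Space n → W} {x : Space n}
    (hf : DifferentiableAt ℝ f x) (i : Fin (2 * n)) :
    horD i (fun y => T (f y)) x = T (horD i f x) := by
  have h : HasFDerivAt (fun y => T (f y)) (T.comp (fderiv ℝ f x)) x :=
    T.hasFDerivAt.comp x hf.hasFDerivAt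
  simp only [horD, h.fderiv, ContinuousLinearMap.comp_apply]

theorem _root_.ContDiffOn.differentiableAt_of_isOpen {X : Type*} [NormedAddCommGroup X]
    [NormedSpace ℝ X] {U : Set X} (hU : IsOpen U) {f : X → W} (hf : ContDiffOn ℝ ∞ f U)
    {x : X} (hx : x ∈ U) : DifferentiableAt ℝ f x :=
  (hf.contDiffAt (hU.mem_nhds hx)).differentiableAt (by simp)

theorem horDL_clm {U : Set (Space n)} (hU : IsOpen U) (T : W →L[ℝ] W') {f : Space n → W}
    (hf : ContDiffOn ℝ ∞ f U) (I : List (Fin (2 * n))) :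
    EqOn (horDL I (fun y => T (f y))) (fun y => T (horDL I f y)) U := by
  induction I with
  | nil => exact fun _ _ => rfl
  | cons i I ih =>
    intro x hx
    simp only [horDL]
    rw [horD_congr hU ih i hx]
    exact horD_clm_apply T ((contDiffOn_horDL hU hf I).differentiableAt_of_isOpen hU hx) i

/-- The sum of `‖X_I f‖²` over all `|I| ≤ k`. -/
def hsq : ℕ → (Space n → W) → Space n → ℝ≥0∞
  | 0, f, x => ‖f x‖ₑ ^ 2
  | k + 1, f, x => ‖f x‖ₑ ^ 2 + ∑ i, hsq k (horD i f) x

theorem enorm_sq_le_hsq (k : ℕ) (f : Space n → W) (x : Space n) : ‖f x‖ₑ ^ 2 ≤ hsq k f x := by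
  cases k with
  | zero => exact le_rfl
  | succ k => exact le_self_add

theorem hsq_horD_le (k : ℕ) (f : Space n → W) (i : Fin (2 * n)) (x : Space n) :
    hsq k (horD i f) x ≤ hsq (k + 1) f x := by
  refine le_trans ?_ le_add_self
  exact Finset.single_le_sum (f := fun i => hsq k (horD i f) x) (fun _ _ => zero_le) (Finset.mem_univ i)

theorem hsq_mono {k l : ℕ} (h : k ≤ l) (f : Space n → W) (x : Space n) :
    hsq k f x ≤ hsq l f x := by
  induction l generalizing k f with
  | zero => obtain rfl : k = 0 := by omega
            exact le_rfl
  | succ l ih =>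
    cases k with
    | zero => exact enorm_sq_le_hsq _ f x
    | succ k =>
      simp only [hsq]
      gcongr with i _
      exact ih (by omega) _

theorem hsq_congr {U : Set (Space n)} (hU : IsOpen U) {f g : Space n → W} (h : EqOn f g U)
    (k : ℕ) : EqOn (hsq k f) (hsq k g) U := by
  induction k generalizing f g with
  | zero => intro x hx; simp only [hsq, h hx]
  | succ k ih =>
    intro x hx
    simp only [hsq, h hx]
    congr 1
    exact Finset.sum_congr rfl fun i _ => ih (horD_congr hU h i) hx

theorem hsq_add_le {U : Set (Space n)} (hU : IsOpen U) {f g : Space n → W}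
    (hf : ContDiffOn ℝ ∞ f U) (hg : ContDiffOn ℝ ∞ g U) (k : ℕ) {x : Space n} (hx : x ∈ U) :
    hsq k (fun y => f y + g y) x ≤ 2 * (hsq k f x + hsq k g x) := by
  have key : ∀ f g : Space n → W, ‖f x + g x‖ₑ ^ 2 ≤ 2 * (‖f x‖ₑ ^ 2 + ‖g x‖ₑ ^ 2) := fun f g =>
    (pow_le_pow_left' (enorm_add_le _ _) 2).trans (ENNReal.add_sq_le_two_mul _ _)
  induction k generalizing f g with
  | zero => exact key f g
  | succ k ih =>
    simp only [hsq]
    have h2 : ∀ i, hsq k (horD i fun y => f y + g y) x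
        ≤ 2 * (hsq k (horD i f) x + hsq k (horD i g) x) := by
      intro i
      rw [hsq_congr hU (g := fun y => horD i f y + horD i g y) (fun y hy =>
        horD_add_apply (hf.differentiableAt_of_isOpen hU hy) (hg.differentiableAt_of_isOpen hU hy) i) k hx]
      exact ih (contDiffOn_horD hU hf i) (contDiffOn_horD hU hg i)
    calc _ ≤ 2 * (‖f x‖ₑ ^ 2 + ‖g x‖ₑ ^ 2) + ∑ i, 2 * (hsq k (horD i f) x + hsq k (horD i g) x) :=
          add_le_add (key f g) (Finset.sum_le_sum fun i _ => h2 i)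
      _ = _ := by rw [← Finset.mul_sum, Finset.sum_add_distrib]; ring

theorem hsq_zero (k : ℕ) (x : Space n) : hsq k (fun _ : Space n => (0 : W)) x = 0 := by
  induction k with
  | zero => simp [hsq]
  | succ k ih =>
    have : ∀ i : Fin (2 * n), horD i (fun _ : Space n => (0 : W)) = fun _ => 0 := by
      intro i; ext x; simp [horD]
    simp [hsq, this, ih]

theorem hsq_sum_le {ι : Type*} (t : Finset ι) {U : Set (Space n)} (hU : IsOpen U)
    {f : ι → Space n → W} (hf : ∀ i ∈ t, ContDiffOn ℝ ∞ (f i) U) (k : ℕ) {x : Space n}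
    (hx : x ∈ U) :
    hsq k (fun y => ∑ i ∈ t, f i y) x ≤ 2 ^ t.card * ∑ i ∈ t, hsq k (f i) x := by
  classical
  induction t using Finset.induction_on with
  | empty => simp [hsq_zero]
  | insert a t ha ih =>
    have h1 : ContDiffOn ℝ ∞ (fun y => ∑ i ∈ t, f i y) U :=
      ContDiffOn.sum fun i hi => hf i (Finset.mem_insert_of_mem hi)
    simp only [Finset.sum_insert ha, Finset.card_insert_of_notMem ha]
    refine (hsq_add_le hU (hf a (Finset.mem_insert_self _ _)) h1 k hx).trans ?_
    have h2 : (1 : ℝ≥0∞) ≤ 2 ^ t.card := one_le_pow₀ (by norm_num)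
    calc _ ≤ 2 * (2 ^ t.card * hsq k (f a) x + 2 ^ t.card * ∑ i ∈ t, hsq k (f i) x) := by
          gcongr
          · exact le_mul_of_one_le_left zero_le h2
          · exact ih fun i hi => hf i (Finset.mem_insert_of_mem hi)
      _ = _ := by ring

theorem hsq_clm_le {U : Set (Space n)} (hU : IsOpen U) (T : W →L[ℝ] W') {f : Space n → W}
    (hf : ContDiffOn ℝ ∞ f U) (k : ℕ) {x : Space n} (hx : x ∈ U) :
    hsq k (fun y => T (f y)) x ≤ ‖T‖ₑ ^ 2 * hsq k f x := by
  have key : ∀ f : Space n → W, ‖T (f x)‖ₑ ^ 2 ≤ ‖T‖ₑ ^ 2 * ‖f x‖ₑ ^ 2 := fun f => by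
    rw [← mul_pow]; exact pow_le_pow_left' (T.le_opENorm _) 2
  induction k generalizing f with
  | zero => exact key f
  | succ k ih =>
    simp only [hsq, mul_add, Finset.mul_sum]
    refine add_le_add (key f) (Finset.sum_le_sum fun i _ => ?_)
    rw [hsq_congr hU (g := fun y => T (horD i f y)) (fun y hy =>
        horD_clm_apply T (hf.differentiableAt_of_isOpen hU hy) i) k hx]
    exact ih (contDiffOn_horD hU hf i)

theorem continuousOn_hsq {U : Set (Space n)} (hU : IsOpen U) {f : Space n → W}
    (hf : ContDiffOn ℝ ∞ f U) (k : ℕ) : ContinuousOn (hsq k f) U := by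
  have key : ∀ f : Space n → W, ContDiffOn ℝ ∞ f U → ContinuousOn (fun x => ‖f x‖ₑ ^ 2) U :=
    fun f hf => (ENNReal.continuous_pow 2).comp_continuousOn hf.continuousOn.enorm
  induction k generalizing f with
  | zero => exact key f hf
  | succ k ih =>
    simp only [hsq]
    exact (key f hf).add (continuousOn_finsetSum _ fun i _ => ih (contDiffOn_horD hU hf i))

theorem measurable_hsq {f : Space n → W} (hf : ContDiff ℝ ∞ f) (k : ℕ) : Measurable (hsq k f) :=
  (continuousOn_univ.1 (continuousOn_hsq isOpen_univ hf.contDiffOn k)).measurable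

theorem enorm_horDL_sq_le_hsq (k : ℕ) (f : Space n → W) (x : Space n) (I : List (Fin (2 * n)))
    (hI : I.length ≤ k) : ‖horDL I f x‖ₑ ^ 2 ≤ hsq k f x := by
  induction k generalizing I f with
  | zero =>
    obtain rfl : I = [] := List.length_eq_zero_iff.1 (by omega)
    exact le_rfl
  | succ k ih =>
    rcases List.eq_nil_or_concat I with rfl | ⟨J, i, rfl⟩
    · exact enorm_sq_le_hsq _ _ _
    · rw [List.concat_eq_append, horDL_append_singleton]
      refine (ih (horD i f) J ?_).trans (hsq_horD_le k f i x)
      simpa using hI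

/-- The factor (2n + 1)^k bounds the number of multi-indices of length at most k. -/
theorem hsq_le_of_forall_list (k : ℕ) (f : Space n → W) (x : Space n) (B : ℝ≥0∞)
    (h : ∀ I : List (Fin (2 * n)), I.length ≤ k → ‖horDL I f x‖ₑ ^ 2 ≤ B) :
    hsq k f x ≤ (2 * n + 1 : ℝ≥0∞) ^ k * B := by
  induction k generalizing f with
  | zero => simpa using! h [] le_rfl
  | succ k ih =>
    simp only [hsq]
    have h1 : ∀ i, hsq k (horD i f) x ≤ (2 * n + 1 : ℝ≥0∞) ^ k * B := fun i => ih _ fun I hI => by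
      rw [← horDL_append_singleton]
      exact h _ (by simpa using hI)
    have h2 : (1 : ℝ≥0∞) ≤ (2 * n + 1 : ℝ≥0∞) ^ k := one_le_pow₀ (by simp)
    calc _ ≤ (2 * n + 1 : ℝ≥0∞) ^ k * B + ∑ _i : Fin (2 * n), (2 * n + 1 : ℝ≥0∞) ^ k * B :=
          add_le_add ((h [] (by simp)).trans (le_mul_of_one_le_left zero_le h2))
            (Finset.sum_le_sum fun i _ => h1 i)
      _ = _ := by
        simp only [Finset.sum_const, Finset.card_univ, Fintype.card_fin, nsmul_eq_mul]
        push_cast; ring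

/-- The sum over multi-indices dominates the recursively defined sum. -/
theorem hsq_le_sum_multiIndex (k : ℕ) (f : Space n → W) (x : Space n) :
    hsq k f x ≤ (2 * n + 1 : ℝ≥0∞) ^ k *
      ∑ I : MultiIndex n k, ‖horDL (List.ofFn I.2) f x‖ₑ ^ 2 := by
  refine hsq_le_of_forall_list k f x _ fun I hI => ?_
  have := Finset.single_le_sum (f := fun I : MultiIndex n k => ‖horDL (List.ofFn I.2) f x‖ₑ ^ 2)
    (fun _ _ => zero_le)
    (Finset.mem_univ (⟨⟨I.length, by omega⟩, fun j => I.get j⟩ : MultiIndex n k))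
  simpa using this

end HorizontalCalculus

end FollandStein
end

noncomputable section
namespace FollandStein

open scoped ENNReal NNReal Topology
open Set Filter

/-! ### Suprema over horizontal coordinates at the cost of one derivative each. -/

section Marginals

/-- The fundamental theorem of calculus for g², together with |2 g g'| ≤ g² + g'². -/
theorem enorm_sq_le_lintegral_of_hasCompactSupport {g : ℝ → ℝ} (hg : ContDiff ℝ 1 g)
    (hc : HasCompactSupport g) (a : ℝ) :
    ‖g a‖ₑ ^ 2 ≤ ∫⁻ x, (‖g x‖ₑ ^ 2 + ‖deriv g x‖ₑ ^ 2) := by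
  have h1 : ContDiff ℝ 1 (fun x => g x * g x) := hg.mul hg
  have h2 : HasCompactSupport (fun x => g x * g x) := hc.mul_left
  have h3 := h2.enorm_le_lintegral_Ici_deriv h1 a
  have h4 : ‖g a‖ₑ ^ 2 = ‖g a * g a‖ₑ := by rw [enorm_mul, sq]
  rw [h4]
  refine h3.trans ((setLIntegral_le_lintegral _ _).trans (lintegral_mono fun x => ?_))
  have hd : HasDerivAt g (deriv g x) x := (hg.differentiable one_ne_zero x).hasDerivAt
  have h5 : deriv (fun x => g x * g x) x = 2 * (g x * deriv g x) := by
    rw [(hd.fun_mul hd).deriv]; ring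
  rw [h5, ← enorm_pow, ← enorm_pow, Real.enorm_eq_ofReal_abs, Real.enorm_eq_ofReal_abs,
    Real.enorm_eq_ofReal_abs, ← ENNReal.ofReal_add (abs_nonneg _) (abs_nonneg _)]
  apply ENNReal.ofReal_le_ofReal
  rw [abs_of_nonneg (sq_nonneg (g x)), abs_of_nonneg (sq_nonneg (deriv g x))]
  exact abs_le.2 ⟨by nlinarith [sq_nonneg (g x + deriv g x)],
    by nlinarith [sq_nonneg (g x - deriv g x)]⟩

variable {n : ℕ}

theorem enorm_sq_le_lintegral_line {w : Space n → ℝ} (hw : ContDiff ℝ ∞ w)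
    (hc : HasCompactSupport w) (p v : Space n) (hv : v ≠ 0) :
    ‖w p‖ₑ ^ 2 ≤ ∫⁻ a : ℝ, (‖w (p + a • v)‖ₑ ^ 2 + ‖fderiv ℝ w (p + a • v) v‖ₑ ^ 2) := by
  have hl : ContDiff ℝ ∞ (fun a : ℝ => p + a • v) :=
    contDiff_const.add (contDiff_id.smul contDiff_const)
  have hg : ContDiff ℝ 1 (fun a : ℝ => w (p + a • v)) := (hw.comp hl).of_le (by simp)
  have hcl : Topology.IsClosedEmbedding (fun a : ℝ => p + a • v) :=
    (Homeomorph.addLeft p).isClosedEmbedding.comp (isClosedEmbedding_smul_left hv)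
  have hgc : HasCompactSupport (fun a : ℝ => w (p + a • v)) := hc.comp_isClosedEmbedding hcl
  have := enorm_sq_le_lintegral_of_hasCompactSupport hg hgc 0
  simp only [zero_smul, add_zero] at this
  refine this.trans_eq (lintegral_congr fun a => ?_)
  have h1 : HasDerivAt (fun a : ℝ => p + a • v) v a := by
    simpa using ((hasDerivAt_id a).smul_const v).const_add p
  have h2 : HasDerivAt (fun a : ℝ => w (p + a • v)) (fderiv ℝ w (p + a • v) v) a :=
    ((hw.differentiable (by simp) (p + a • v)).hasFDerivAt).comp_hasDerivAt a h1
  rw [h2.deriv]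

/-- The coefficient of `∂/∂x^{2n+1}` in the horizontal vector field `X_i`. -/
def frameCoeff (i : Fin (2 * n)) (p : Fin (2 * n + 1) → ℝ) : ℝ :=
  if h : i.val < n then p (idxY ⟨i.val, h⟩) else 0

theorem frame_eq (i : Fin (2 * n)) (p : Fin (2 * n + 1) → ℝ) :
    frame n i (WithLp.toLp 2 p) = EuclideanSpace.single i.castSucc (1 : ℝ) +
      frameCoeff i p • EuclideanSpace.single (Fin.last (2 * n)) (1 : ℝ) := by
  unfold frame frameCoeff
  split_ifs with h
  · rfl
  · simp

theorem frame_castSucc (i : Fin (2 * n)) (x : Space n) : frame n i x i.castSucc = 1 := by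
  have := frame_eq i x.ofLp
  rw [WithLp.toLp_ofLp] at this
  rw [this]
  simp [Fin.castSucc_ne_last]

theorem frame_ne_zero (i : Fin (2 * n)) (x : Space n) : frame n i x ≠ 0 := fun h => by
  have := frame_castSucc i x
  simp [h] at this

/-- The coefficient of X_j is x^{n+j}, which is neither x^j nor x^{2n+1}. This is why X_i is
constant along its integral curves, which are therefore straight lines. -/
theorem frameCoeff_update (i : Fin (2 * n)) (p : Fin (2 * n + 1) → ℝ) (a b : ℝ) :
    frameCoeff i (Function.update (Function.update p i.castSucc a) (Fin.last (2 * n)) b) =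
      frameCoeff i p := by
  unfold frameCoeff
  split_ifs with h
  · have h1 : (idxY ⟨i.val, h⟩ : Fin (2 * n + 1)) ≠ Fin.last (2 * n) := by
      simp only [idxY, ne_eq, Fin.ext_iff, Fin.val_last]; omega
    have h2 : (idxY ⟨i.val, h⟩ : Fin (2 * n + 1)) ≠ i.castSucc := by
      simp only [idxY, ne_eq, Fin.ext_iff, Fin.val_castSucc]; omega
    rw [Function.update_of_ne h1, Function.update_of_ne h2]
  · rfl

theorem toLp_add_smul_frame (i : Fin (2 * n)) (p : Fin (2 * n + 1) → ℝ) (a τ : ℝ) :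
    WithLp.toLp 2 (Function.update p (Fin.last (2 * n)) τ) +
      a • frame n i (WithLp.toLp 2 (Function.update p (Fin.last (2 * n)) τ)) =
    WithLp.toLp 2 (Function.update (Function.update p i.castSucc (p i.castSucc + a))
      (Fin.last (2 * n)) (τ + a * frameCoeff i p)) := by
  have h0 : frameCoeff i (Function.update p (Fin.last (2 * n)) τ) = frameCoeff i p := by
    have := frameCoeff_update i p (p i.castSucc) τ
    rwa [Function.update_eq_self] at this
  rw [frame_eq, h0]
  ext l
  rcases eq_or_ne l (Fin.last (2 * n)) with rfl | hl
  · simp [(Fin.castSucc_ne_last i).symm]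
  · rcases eq_or_ne l i.castSucc with rfl | hl'
    · simp [hl]
    · simp [hl, hl']

/-- Integration of a function over the coordinates in `S`. -/
def marg (S : Finset (Fin (2 * n + 1))) (h : Space n → ℝ≥0∞) : (Fin (2 * n + 1) → ℝ) → ℝ≥0∞ :=
  lmarginal (fun _ => (volume : Measure ℝ)) S (fun q => h (WithLp.toLp 2 q))

theorem measurable_comp_toLp {h : Space n → ℝ≥0∞} (hh : Measurable h) :
    Measurable (fun q : Fin (2 * n + 1) → ℝ => h (WithLp.toLp 2 q)) :=
  hh.comp (PiLp.continuous_toLp 2 _).measurable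

theorem marg_mono {S : Finset (Fin (2 * n + 1))} {h h' : Space n → ℝ≥0∞} (H : ∀ x, h x ≤ h' x)
    (p : Fin (2 * n + 1) → ℝ) : marg S h p ≤ marg S h' p :=
  lmarginal_mono (f := fun q => h (WithLp.toLp 2 q)) (g := fun q => h' (WithLp.toLp 2 q))
    (fun _ => H _) p

theorem marg_add {S : Finset (Fin (2 * n + 1))} {h h' : Space n → ℝ≥0∞} (hh : Measurable h)
    (p : Fin (2 * n + 1) → ℝ) : marg S (fun x => h x + h' x) p = marg S h p + marg S h' p :=
  lintegral_add_left ((measurable_comp_toLp hh).comp measurable_updateFinset) _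

theorem marg_sum {ι : Type*} (t : Finset ι) {S : Finset (Fin (2 * n + 1))}
    {h : ι → Space n → ℝ≥0∞} (hh : ∀ i, Measurable (h i))
    (p : Fin (2 * n + 1) → ℝ) : marg S (fun x => ∑ i ∈ t, h i x) p = ∑ i ∈ t, marg S (h i) p :=
  lintegral_finsetSum _ fun i _ => (measurable_comp_toLp (hh i)).comp measurable_updateFinset

theorem marg_univ (h : Space n → ℝ≥0∞) (p : Fin (2 * n + 1) → ℝ) :
    marg Finset.univ h p = ∫⁻ x, h x := by
  unfold marg
  rw [lmarginal_univ]
  exact (PiLp.volume_preserving_toLp (Fin (2 * n + 1))).lintegral_comp_emb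
    (MeasurableEquiv.toLp 2 (Fin (2 * n + 1) → ℝ)).measurableEmbedding _

/-- The one-dimensional inequality is applied on the X_i-line through each point of a vertical line
and integrated over that vertical line. After exchanging the integrals, the vertical displacement at
time a is the same for all starting heights, so translation invariance removes it and leaves an
integral over the plane of the two coordinates. -/
theorem marg_last_le {w : Space n → ℝ} (hw : ContDiff ℝ ∞ w) (hc : HasCompactSupport w)
    (i : Fin (2 * n)) (p : Fin (2 * n + 1) → ℝ) :
    marg {Fin.last (2 * n)} (fun x => ‖w x‖ₑ ^ 2) p ≤
      marg {i.castSucc, Fin.last (2 * n)} (fun x => ‖w x‖ₑ ^ 2 + ‖horD i w x‖ₑ ^ 2) p := by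
  set h : Space n → ℝ≥0∞ := fun x => ‖w x‖ₑ ^ 2 + ‖horD i w x‖ₑ ^ 2 with hh
  have hm : Measurable h := by
    have h1 := (contDiff_horD hw i).continuous
    have h2 := hw.continuous
    exact (by fun_prop : Continuous h).measurable
  have hm' := measurable_comp_toLp hm
  have hne : i.castSucc ∉ ({Fin.last (2 * n)} : Finset (Fin (2 * n + 1))) := by
    simp [Fin.castSucc_ne_last]
  set F : ℝ → ℝ → ℝ≥0∞ := fun τ a => h (WithLp.toLp 2
    (Function.update (Function.update p i.castSucc (p i.castSucc + a))
      (Fin.last (2 * n)) (τ + a * frameCoeff i p))) with hF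
  have hcont : Measurable (Function.uncurry F) := by
    apply hm'.comp
    refine measurable_pi_lambda _ fun l => ?_
    rcases eq_or_ne l (Fin.last (2 * n)) with rfl | hl
    · simp only [Function.update_self]; fun_prop
    · simp only [Function.update_of_ne hl]
      rcases eq_or_ne l i.castSucc with rfl | hl'
      · simp only [Function.update_self]; fun_prop
      · simp only [Function.update_of_ne hl']; fun_prop
  calc marg {Fin.last (2 * n)} (fun x => ‖w x‖ₑ ^ 2) p
      = ∫⁻ τ, ‖w (WithLp.toLp 2 (Function.update p (Fin.last (2 * n)) τ))‖ₑ ^ 2 := by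
        unfold marg; rw [lmarginal_singleton]
    _ ≤ ∫⁻ τ, ∫⁻ a, F τ a := by
        refine lintegral_mono fun τ => ?_
        set q := WithLp.toLp 2 (Function.update p (Fin.last (2 * n)) τ) with hq
        refine (enorm_sq_le_lintegral_line hw hc q (frame n i q) (frame_ne_zero i q)).trans_eq
          (lintegral_congr fun a => ?_)
        have e1 := toLp_add_smul_frame i p a τ
        rw [← hq] at e1
        -- Since X_i is constant along the line, the derivative along the line is X_i w at the
        -- displaced point.
        have e2 : frame n i (q + a • frame n i q) = frame n i q := by
          rw [e1, hq, frame_eq, frame_eq, frameCoeff_update]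
          have := frameCoeff_update i p (p i.castSucc) τ
          rw [Function.update_eq_self] at this
          rw [this]
        simp only [hF, hh, ← e1, horD, e2]
    _ = ∫⁻ a, ∫⁻ τ, F τ a := lintegral_lintegral_swap hcont.aemeasurable
    _ = ∫⁻ a, ∫⁻ τ, h (WithLp.toLp 2
          (Function.update (Function.update p i.castSucc (p i.castSucc + a))
            (Fin.last (2 * n)) τ)) := by
        refine lintegral_congr fun a => ?_
        exact lintegral_add_right_eq_self (fun τ => h (WithLp.toLp 2
          (Function.update (Function.update p i.castSucc (p i.castSucc + a))
            (Fin.last (2 * n)) τ))) _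
    _ = ∫⁻ b, ∫⁻ τ, h (WithLp.toLp 2
          (Function.update (Function.update p i.castSucc b) (Fin.last (2 * n)) τ)) :=
        lintegral_add_left_eq_self (fun b => ∫⁻ τ, h (WithLp.toLp 2
          (Function.update (Function.update p i.castSucc b) (Fin.last (2 * n)) τ))) _
    _ = marg {i.castSucc, Fin.last (2 * n)} h p := by
        unfold marg
        rw [lmarginal_insert _ hm' hne, lmarginal_singleton]

theorem marg_enorm_sq_le_insert {w : Space n → ℝ} (hw : ContDiff ℝ ∞ w)
    (hc : HasCompactSupport w) (i : Fin (2 * n)) {S : Finset (Fin (2 * n + 1))}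
    (hS : Fin.last (2 * n) ∈ S) (hi : i.castSucc ∉ S) (p : Fin (2 * n + 1) → ℝ) :
    marg S (fun x => ‖w x‖ₑ ^ 2) p ≤
      marg (insert i.castSucc S) (fun x => ‖w x‖ₑ ^ 2 + ‖horD i w x‖ₑ ^ 2) p := by
  have h1 := (contDiff_horD hw i).continuous
  have h2 := hw.continuous
  have hm1 := measurable_comp_toLp (by fun_prop : Continuous fun x => ‖w x‖ₑ ^ 2).measurable
  have hm2 := measurable_comp_toLp
    (by fun_prop : Continuous fun x => ‖w x‖ₑ ^ 2 + ‖horD i w x‖ₑ ^ 2).measurable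
  have e1 : S = S.erase (Fin.last (2 * n)) ∪ {Fin.last (2 * n)} := by
    ext l; by_cases hl : l = Fin.last (2 * n) <;> simp [hl, hS]
  have e2 : insert i.castSucc S =
      S.erase (Fin.last (2 * n)) ∪ {i.castSucc, Fin.last (2 * n)} := by
    ext l; by_cases hl : l = Fin.last (2 * n) <;> simp [hl, hS, or_comm]
  have d1 : Disjoint (S.erase (Fin.last (2 * n))) {Fin.last (2 * n)} := by simp
  have d2 : Disjoint (S.erase (Fin.last (2 * n))) {i.castSucc, Fin.last (2 * n)} := by
    rw [Finset.disjoint_insert_right]; exact ⟨by simp [hi], d1⟩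
  unfold marg
  rw [e2, lmarginal_union _ _ hm2 d2]
  conv_lhs => rw [e1, lmarginal_union _ _ hm1 d1]
  exact lmarginal_mono (fun q => marg_last_le hw hc i q) p

/-- The integral of `∑_{|I| ≤ k} ‖X_I f‖²`. -/
def hE {W : Type*} [NormedAddCommGroup W] [NormedSpace ℝ W] (μ : Measure (Space n)) (k : ℕ)
    (f : Space n → W) : ℝ≥0∞ := ∫⁻ x, hsq k f x ∂μ

theorem hE_succ {W : Type*} [NormedAddCommGroup W] [NormedSpace ℝ W] {μ : Measure (Space n)}
    (k : ℕ) {f : Space n → W} (hf : ContDiff ℝ ∞ f) :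
    hE μ (k + 1) f = hE μ 0 f + ∑ i, hE μ k (horD i f) := by
  unfold hE
  rw [← lintegral_finsetSum _ fun i _ => measurable_hsq (contDiff_horD hf i) k,
    ← lintegral_add_left (measurable_hsq hf 0)]
  rfl

theorem hE_mono {W : Type*} [NormedAddCommGroup W] [NormedSpace ℝ W] {μ : Measure (Space n)}
    {k l : ℕ} (h : k ≤ l) (f : Space n → W) : hE μ k f ≤ hE μ l f :=
  lintegral_mono fun x => hsq_mono h f x

theorem hE_horD_le {W : Type*} [NormedAddCommGroup W] [NormedSpace ℝ W] {μ : Measure (Space n)}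
    (k : ℕ) (f : Space n → W) (i : Fin (2 * n)) : hE μ k (horD i f) ≤ hE μ (k + 1) f :=
  lintegral_mono fun x => hsq_horD_le k f i x

/-- The supremum over the coordinates outside `S` of the `L²` norm over the coordinates in `S`. -/
theorem marg_enorm_sq_le_hE (c : ℕ) {w : Space n → ℝ} (hw : ContDiff ℝ ∞ w)
    (hc : HasCompactSupport w) {S : Finset (Fin (2 * n + 1))}
    (hS : Fin.last (2 * n) ∈ S) (hcard : Sᶜ.card = c) (p : Fin (2 * n + 1) → ℝ) :
    marg S (fun x => ‖w x‖ₑ ^ 2) p ≤ 2 ^ c * hE volume c w := by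
  induction c generalizing w S with
  | zero =>
    obtain rfl : S = Finset.univ := by simpa using hcard
    rw [marg_univ]
    simp [hE, hsq]
  | succ c ih =>
    obtain ⟨j, hj⟩ : Sᶜ.Nonempty := Finset.card_pos.1 (by omega)
    have hjS : j ∉ S := Finset.mem_compl.1 hj
    have hjl : j ≠ Fin.last (2 * n) := fun h => hjS (h ▸ hS)
    obtain ⟨i, rfl⟩ := Fin.exists_castSucc_eq.2 hjl
    have hcard' : (insert i.castSucc S)ᶜ.card = c := by
      rw [Finset.compl_insert, Finset.card_erase_of_mem hj, hcard]; rfl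
    have hS' : Fin.last (2 * n) ∈ insert i.castSucc S := Finset.mem_insert_of_mem hS
    -- One more integrated coordinate replaces w by the pair w, X_i w; the induction hypothesis
    -- applies to both, which doubles the constant.
    refine (marg_enorm_sq_le_insert hw hc i hS hjS p).trans ?_
    have h2 := hw.continuous
    rw [marg_add (by fun_prop : Continuous fun x => ‖w x‖ₑ ^ 2).measurable]
    calc _ ≤ 2 ^ c * hE volume c w + 2 ^ c * hE volume c (horD i w) :=
          add_le_add (ih hw hc hS' hcard')
            (ih (contDiff_horD hw i) (hasCompactSupport_horD hc i) hS' hcard')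
      _ ≤ 2 ^ c * hE volume (c + 1) w + 2 ^ c * hE volume (c + 1) w := by
          gcongr
          · exact hE_mono (Nat.le_succ c) w
          · exact hE_horD_le c w i
      _ = _ := by ring

/-- `marg_enorm_sq_le_insert` applied to every X_I w with |I| ≤ k; the X_i that it adds raises the
order to k + 1. -/
theorem marg_hsq_le_insert (k : ℕ) {w : Space n → ℝ} (hw : ContDiff ℝ ∞ w)
    (hc : HasCompactSupport w) (i : Fin (2 * n)) {S : Finset (Fin (2 * n + 1))}
    (hS : Fin.last (2 * n) ∈ S) (hi : i.castSucc ∉ S) (p : Fin (2 * n + 1) → ℝ) :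
    marg S (hsq k w) p ≤ (2 * n + 1 : ℝ≥0∞) ^ k * 2 * marg (insert i.castSucc S) (hsq (k + 1) w) p := by
  have base : ∀ (m : ℕ) {w : Space n → ℝ}, ContDiff ℝ ∞ w → HasCompactSupport w →
      marg S (fun x => ‖w x‖ₑ ^ 2) p ≤ 2 * marg (insert i.castSucc S) (hsq (m + 1) w) p := by
    intro m w hw hc
    refine (marg_enorm_sq_le_insert hw hc i hS hi p).trans ?_
    have h2 := hw.continuous
    rw [marg_add (by fun_prop : Continuous fun x => ‖w x‖ₑ ^ 2).measurable]
    refine le_trans ?_ (two_mul _).ge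
    refine add_le_add (marg_mono (fun x => enorm_sq_le_hsq _ w x) p)
      (marg_mono (fun x => ?_) p)
    exact (enorm_sq_le_hsq m (horD i w) x).trans (hsq_horD_le m w i x)
  induction k generalizing w with
  | zero => simpa [hsq] using base 0 hw hc
  | succ k ih =>
    have h2 := hw.continuous
    change marg S (fun x => ‖w x‖ₑ ^ 2 + ∑ j, hsq k (horD j w) x) p ≤ _
    rw [marg_add (by fun_prop : Continuous fun x => ‖w x‖ₑ ^ 2).measurable,
      marg_sum _ fun j => measurable_hsq (contDiff_horD hw j) k]
    set B := marg (insert i.castSucc S) (hsq (k + 1 + 1) w) p with hB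
    have h3 : ∀ j, marg S (hsq k (horD j w)) p ≤ (2 * n + 1 : ℝ≥0∞) ^ k * 2 * B := fun j =>
      (ih (contDiff_horD hw j) (hasCompactSupport_horD hc j)).trans
        (mul_le_mul_right (marg_mono (fun x => hsq_horD_le (k + 1) w j x) p) _)
    have h1 : (1 : ℝ≥0∞) ≤ (2 * n + 1 : ℝ≥0∞) ^ k := one_le_pow₀ (by simp)
    calc _ ≤ (2 * n + 1 : ℝ≥0∞) ^ k * (2 * B) + ∑ _j : Fin (2 * n), (2 * n + 1 : ℝ≥0∞) ^ k * 2 * B :=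
          add_le_add ((base (k + 1) hw hc).trans (le_mul_of_one_le_left zero_le h1))
            (Finset.sum_le_sum fun j _ => h3 j)
      _ = _ := by
        simp only [Finset.sum_const, Finset.card_univ, Fintype.card_fin, nsmul_eq_mul]
        push_cast; ring

end Marginals

/-! ### The vertical derivative as a commutator, and pointwise bounds. -/

section Vertical

variable {n : ℕ}

/-- `∂/∂x^{2n+1}` is a commutator of horizontal vector fields. -/
theorem fderiv_last_eq_commutator (hn : 1 ≤ n) {w : Space n → ℝ} (hw : ContDiff ℝ ∞ w)
    (x : Space n) :
    ∃ i j : Fin (2 * n), fderiv ℝ w x (EuclideanSpace.single (Fin.last (2 * n)) (1 : ℝ)) =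
      horD i (horD j w) x - horD j (horD i w) x := by
  -- In the usual numbering these are X_{n+1} and X_1, with [X_{n+1}, X_1] = ∂/∂x^{2n+1}.
  refine ⟨⟨n, by omega⟩, ⟨0, by omega⟩, ?_⟩
  set i : Fin (2 * n) := ⟨n, by omega⟩
  set j : Fin (2 * n) := ⟨0, by omega⟩
  have hd : Differentiable ℝ (fderiv ℝ w) :=
    (hw.fderiv_right (m := ∞) (by simp)).differentiable (by simp)
  have key : ∀ k l : Fin (2 * n), horD k (horD l w) x =
      fderiv ℝ (fderiv ℝ w) x (frame n k x) (frame n l x) +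
        fderiv ℝ w x (fderiv ℝ (frame n l) x (frame n k x)) := by
    intro k l
    have h1 := (hd x).hasFDerivAt.clm_apply
      ((contDiff_frame l).differentiable (by simp) x).hasFDerivAt
    simp only [horD]
    unfold horD
    rw [h1.fderiv]
    simp [add_comm]
  -- The second-order terms of the commutator cancel; what is left is the derivative of w in the
  -- direction of the derivative of the coefficients.
  have hsymm : fderiv ℝ (fderiv ℝ w) x (frame n i x) (frame n j x) =
      fderiv ℝ (fderiv ℝ w) x (frame n j x) (frame n i x) :=
    (hw.contDiffAt.isSymmSndFDerivAt (by simpa using ENat.LEInfty.out)) _ _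
  have hi : frame n i = fun _ => EuclideanSpace.single i.castSucc (1 : ℝ) := by
    funext y; simp [frame, i]
  have hj : HasFDerivAt (frame n j) ((EuclideanSpace.proj (idxY ⟨0, by omega⟩) : Space n →L[ℝ] ℝ).smulRight
      (EuclideanSpace.single (Fin.last (2 * n)) (1 : ℝ) : Space n)) x := by
    have : frame n j = fun y : Space n => EuclideanSpace.single j.castSucc (1 : ℝ) +
        ((EuclideanSpace.proj (idxY ⟨0, by omega⟩) : Space n →L[ℝ] ℝ).smulRight
      (EuclideanSpace.single (Fin.last (2 * n)) (1 : ℝ) : Space n)) y := by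
      funext y
      have h0 : j.val < n := by simp only [j]; omega
      simp only [frame, h0, dif_pos]
      rfl
    rw [this]
    exact (ContinuousLinearMap.hasFDerivAt _).const_add _
  rw [key, key, hsymm, hj.fderiv, hi]
  simp [idxY, i]

theorem enorm_fderiv_last_sq_le (hn : 1 ≤ n) {w : Space n → ℝ} (hw : ContDiff ℝ ∞ w)
    (x : Space n) :
    ‖fderiv ℝ w x (EuclideanSpace.single (Fin.last (2 * n)) (1 : ℝ))‖ₑ ^ 2 ≤ 4 * hsq 2 w x := by
  obtain ⟨i, j, h⟩ := fderiv_last_eq_commutator hn hw x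
  have h1 : ∀ i j : Fin (2 * n), ‖horD i (horD j w) x‖ₑ ^ 2 ≤ hsq 2 w x := fun i j =>
    enorm_horDL_sq_le_hsq 2 w x [i, j] (by simp)
  rw [h]
  calc _ ≤ (‖horD i (horD j w) x‖ₑ + ‖horD j (horD i w) x‖ₑ) ^ 2 :=
        pow_le_pow_left' enorm_sub_le 2
    _ ≤ 2 * (‖horD i (horD j w) x‖ₑ ^ 2 + ‖horD j (horD i w) x‖ₑ ^ 2) :=
        ENNReal.add_sq_le_two_mul _ _
    _ ≤ 2 * (hsq 2 w x + hsq 2 w x) := by gcongr <;> exact h1 _ _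
    _ = _ := by ring

/-- The one-dimensional inequality on the vertical line. The vertical derivative costs two
horizontal ones, and 5 is 1 for w plus 4 for the commutator. -/
theorem enorm_sq_le_marg_last (hn : 1 ≤ n) {w : Space n → ℝ} (hw : ContDiff ℝ ∞ w)
    (hc : HasCompactSupport w) (p : Fin (2 * n + 1) → ℝ) :
    ‖w (WithLp.toLp 2 p)‖ₑ ^ 2 ≤ 5 * marg {Fin.last (2 * n)} (hsq 2 w) p := by
  have hv : (EuclideanSpace.single (Fin.last (2 * n)) (1 : ℝ) : Space n) ≠ 0 := by simp
  refine (enorm_sq_le_lintegral_line hw hc _ _ hv).trans ?_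
  have e : ∀ a : ℝ, WithLp.toLp 2 p + a • (EuclideanSpace.single (Fin.last (2 * n)) (1 : ℝ) : Space n)
      = WithLp.toLp 2 (Function.update p (Fin.last (2 * n)) (p (Fin.last (2 * n)) + a)) := by
    intro a
    ext l
    rcases eq_or_ne l (Fin.last (2 * n)) with rfl | hl
    · simp
    · simp [hl]
  unfold marg
  rw [lmarginal_singleton]
  beta_reduce
  rw [← lintegral_add_left_eq_self (fun τ => hsq 2 w (WithLp.toLp 2
      (Function.update p (Fin.last (2 * n)) τ))) (p (Fin.last (2 * n))),
    ← lintegral_const_mul' _ _ (by simp)]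
  refine lintegral_mono fun a => ?_
  rw [e]
  calc _ ≤ hsq 2 w _ + 4 * hsq 2 w _ :=
        add_le_add (enorm_sq_le_hsq 2 w _) (enorm_fderiv_last_sq_le hn hw _)
    _ = _ := by ring

/-- Pointwise bound by an integral over the coordinates in `S`. -/
theorem enorm_sq_le_marg (hn : 1 ≤ n) (m : ℕ) : ∃ C : ℝ≥0, ∀ {w : Space n → ℝ},
    ContDiff ℝ ∞ w → HasCompactSupport w → ∀ {S : Finset (Fin (2 * n + 1))},
    Fin.last (2 * n) ∈ S → S.card = m + 1 → ∀ p : Fin (2 * n + 1) → ℝ,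
    ‖w (WithLp.toLp 2 p)‖ₑ ^ 2 ≤ C * marg S (hsq (m + 2) w) p := by
  induction m with
  | zero =>
    refine ⟨5, fun {w} hw hc {S} hS hcard p => ?_⟩
    obtain ⟨l, rfl⟩ := Finset.card_eq_one.1 hcard
    obtain rfl := Finset.mem_singleton.1 hS
    exact_mod_cast enorm_sq_le_marg_last hn hw hc p
  | succ m ih =>
    obtain ⟨C, hC⟩ := ih
    refine ⟨C * ((2 * n + 1) ^ (m + 2) * 2), fun {w} hw hc {S} hS hcard p => ?_⟩
    -- A horizontal coordinate is taken out of S, the induction hypothesis is used on the rest, and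
    -- one further derivative pays for integrating over that coordinate again.
    obtain ⟨j, hj⟩ : (S.erase (Fin.last (2 * n))).Nonempty := Finset.card_pos.1 (by
      rw [Finset.card_erase_of_mem hS]; omega)
    obtain ⟨hjl, hjS⟩ := Finset.mem_erase.1 hj
    obtain ⟨i, rfl⟩ := Fin.exists_castSucc_eq.2 hjl
    have h1 := hC hw hc (S := S.erase i.castSucc) (Finset.mem_erase.2 ⟨hjl.symm, hS⟩)
      (by rw [Finset.card_erase_of_mem hjS]; omega) p
    have h2 := marg_hsq_le_insert (m + 2) hw hc i (S := S.erase i.castSucc)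
      (Finset.mem_erase.2 ⟨hjl.symm, hS⟩) (Finset.notMem_erase _ _) p
    rw [Finset.insert_erase hjS] at h2
    refine h1.trans ((mul_le_mul_right h2 _).trans_eq ?_)
    push_cast; ring

end Vertical

end FollandStein
end

noncomputable section
namespace FollandStein

open scoped ENNReal NNReal Topology
open Set Filter

/-! ### The product estimate. -/

section Products

variable {n : ℕ}

/-- Smooth compactly supported real functions. -/
structure IsTest (f : Space n → ℝ) : Prop where
  contDiff : ContDiff ℝ ∞ f
  hasCompactSupport : HasCompactSupport f

theorem IsTest.horD {f : Space n → ℝ} (hf : IsTest f) (i : Fin (2 * n)) :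
    IsTest (horD i f) :=
  ⟨contDiff_horD hf.1 i, hasCompactSupport_horD hf.2 i⟩

theorem IsTest.mul {f g : Space n → ℝ} (hf : IsTest f) (hg : IsTest g) :
    IsTest (fun x => f x * g x) :=
  ⟨hf.1.mul hg.1, hf.2.mul_right⟩

theorem IsTest.add {f g : Space n → ℝ} (hf : IsTest f) (hg : IsTest g) :
    IsTest (fun x => f x + g x) :=
  ⟨hf.1.add hg.1, hf.2.add hg.2⟩

theorem IsTest.sum {ι : Type*} (t : Finset ι) {f : ι → Space n → ℝ} (hf : ∀ i, IsTest (f i)) :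
    IsTest (fun x => ∑ i ∈ t, f i x) := by
  classical
  induction t using Finset.induction_on with
  | empty => exact ⟨by simpa using contDiff_const, by simpa using! HasCompactSupport.zero⟩
  | insert a t ha ih => simpa only [Finset.sum_insert ha] using (hf a).add ih

theorem IsTest.differentiableAt {f : Space n → ℝ} (hf : IsTest f) (x : Space n) :
    DifferentiableAt ℝ f x :=
  hf.1.differentiable (by simp) x

theorem hE_add_le {f g : Space n → ℝ} (hf : IsTest f) (hg : IsTest g) (k : ℕ) :
    hE volume k (fun x => f x + g x) ≤ 2 * (hE volume k f + hE volume k g) := by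
  unfold hE
  rw [← lintegral_add_left (measurable_hsq hf.1 k), ← lintegral_const_mul' _ _ (by simp)]
  exact lintegral_mono fun x =>
    hsq_add_le isOpen_univ hf.1.contDiffOn hg.1.contDiffOn k (mem_univ x)

theorem hE_sum_le {ι : Type*} (t : Finset ι) {f : ι → Space n → ℝ} (hf : ∀ i, IsTest (f i))
    (k : ℕ) :
    hE volume k (fun x => ∑ i ∈ t, f i x) ≤ 2 ^ t.card * ∑ i ∈ t, hE volume k (f i) := by
  unfold hE
  rw [← lintegral_finsetSum _ fun i _ => measurable_hsq (hf i).1 k,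
    ← lintegral_const_mul' _ _ (by simp)]
  exact lintegral_mono fun x =>
    hsq_sum_le t isOpen_univ (fun i _ => (hf i).1.contDiffOn) k (mem_univ x)

theorem enorm_sq_le_hE (hn : 1 ≤ n) : ∃ C : ℝ≥0, ∀ {w : Space n → ℝ}, IsTest w →
    ∀ x, ‖w x‖ₑ ^ 2 ≤ C * hE volume (2 * n + 2) w := by
  obtain ⟨C, hC⟩ := enorm_sq_le_marg hn (2 * n)
  refine ⟨C, fun {w} hw x => ?_⟩
  have := hC hw.1 hw.2 (S := Finset.univ) (Finset.mem_univ _) (by simp) x.ofLp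
  rwa [marg_univ] at this

/-- The coordinates are split into the first k and the remaining 2n + 1 - k, among them x^{2n+1}.
The factor f is taken in the supremum over the first group and L² over the second, at the cost of k
derivatives. The factor g is treated the other way round, which costs 2n - k derivatives for
horizontal coordinates and 2 for the vertical one. -/
theorem lintegral_enorm_mul_sq_le (hn : 1 ≤ n) (k : ℕ) (hk : k ≤ n) :
    ∃ C : ℝ≥0, ∀ {f g : Space n → ℝ}, IsTest f → IsTest g →
      ∫⁻ x, ‖f x * g x‖ₑ ^ 2 ≤ C * (hE volume k f * hE volume (2 * n + 2 - k) g) := by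
  set S : Finset (Fin (2 * n + 1)) := Finset.univ.filter fun l => k ≤ l.val with hSdef
  have hS : Fin.last (2 * n) ∈ S := by simp [hSdef]; omega
  have hSc : Sᶜ.card = k := by
    rw [hSdef, Finset.compl_filter]
    simp only [not_le]
    rw [Fin.card_filter_val_lt]
    omega
  have hScard : S.card = 2 * n - k + 1 := by
    have := Finset.card_add_card_compl S
    rw [Fintype.card_fin, hSc] at this
    omega
  obtain ⟨C, hC⟩ := enorm_sq_le_marg hn (2 * n - k)
  refine ⟨2 ^ k * C, fun {f g} hf hg => ?_⟩
  have hord : 2 * n - k + 2 = 2 * n + 2 - k := by omega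
  rw [hord] at hC
  set m := 2 * n + 2 - k
  set Γ := marg S (hsq m g) with hΓ
  have hmf := measurable_comp_toLp (by have := hf.1.continuous; fun_prop : Continuous fun x => ‖f x‖ₑ ^ 2).measurable
  have hmfg := measurable_comp_toLp (by
    have := hf.1.continuous
    have := hg.1.continuous
    fun_prop : Continuous fun x => ‖f x * g x‖ₑ ^ 2).measurable
  have hmg := measurable_comp_toLp (measurable_hsq hg.1 m)
  have h1 : ∀ p, marg S (fun x => ‖f x * g x‖ₑ ^ 2) p ≤ (2 ^ k * C * hE volume k f) * Γ p := by
    intro p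
    calc marg S (fun x => ‖f x * g x‖ₑ ^ 2) p
        ≤ ∫⁻ y, ‖f (WithLp.toLp 2 (Function.updateFinset p S y))‖ₑ ^ 2 * (C * Γ p)
            ∂Measure.pi fun _ : S => (volume : Measure ℝ) := by
          refine lintegral_mono fun y => ?_
          beta_reduce
          rw [enorm_mul, mul_pow]
          refine mul_le_mul_right ?_ _
          refine (hC hg.1 hg.2 hS hScard _).trans (mul_le_mul_right (le_of_eq ?_) _)
          -- A function integrated over the coordinates in S does not depend on them, so the bound
          -- for g leaves the integral over S.
          exact lmarginal_congr _ _ fun i hi => by simp [Function.updateFinset, hi]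
      _ = marg S (fun x => ‖f x‖ₑ ^ 2) p * (C * Γ p) :=
          lintegral_mul_const _ (hmf.comp measurable_updateFinset)
      _ ≤ (2 ^ k * hE volume k f) * (C * Γ p) := by
          gcongr
          exact marg_enorm_sq_le_hE k hf.1 hf.2 hS hSc p
      _ = _ := by ring
  have hdis : Disjoint Sᶜ S := disjoint_compl_left
  have hun : Sᶜ ∪ S = Finset.univ := by rw [Finset.union_comm]; exact Finset.union_compl S
  have e0 : ∀ {h : Space n → ℝ≥0∞}, Measurable (fun q : Fin (2 * n + 1) → ℝ => h (WithLp.toLp 2 q)) →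
      ∫⁻ x, h x = lmarginal (fun _ => (volume : Measure ℝ)) Sᶜ (marg S h) 0 := by
    intro h hh
    rw [← marg_univ h 0, ← hun]
    unfold marg
    rw [lmarginal_union _ _ hh hdis]
  rw [e0 hmfg]
  calc _ ≤ lmarginal (fun _ => (volume : Measure ℝ)) Sᶜ
        (fun p => (2 ^ k * C * hE volume k f) * Γ p) 0 := lmarginal_mono h1 0
    _ = (2 ^ k * C * hE volume k f) * lmarginal (fun _ => (volume : Measure ℝ)) Sᶜ Γ 0 :=
        lintegral_const_mul _ ((hmg.lmarginal _).comp measurable_updateFinset)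
    _ = (2 ^ k * C * hE volume k f) * hE volume m g := by
        rw [hΓ, ← e0 hmg]; rfl
    _ = _ := by push_cast; ring

theorem hE_zero_mul_le (hn : 1 ≤ n) (a b : ℕ) (hab : 2 * n + 3 ≤ a + b) :
    ∃ C : ℝ≥0, ∀ {f g : Space n → ℝ}, IsTest f → IsTest g →
      hE volume 0 (fun x => f x * g x) ≤ C * (hE volume a f * hE volume b g) := by
  wlog h : a ≤ b generalizing a b with H
  · obtain ⟨C, hC⟩ := H b a (by omega) (by omega)
    refine ⟨C, fun {f g} hf hg => ?_⟩
    simpa only [mul_comm] using hC hg hf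
  -- If a > n, the coordinates are split at n: then b ≥ n + 2, because a ≤ b and a + b ≥ 2n + 3.
  obtain ⟨C, hC⟩ := lintegral_enorm_mul_sq_le hn (min a n) (min_le_right _ _)
  refine ⟨C, fun {f g} hf hg => (hC hf hg).trans ?_⟩
  gcongr
  · exact hE_mono (min_le_left _ _) f
  · exact hE_mono (by omega) g

/-- The Folland-Stein spaces of high order multiply those of lower order. -/
theorem hE_mul_le (hn : 1 ≤ n) (k a b : ℕ) (hka : k ≤ a) (hkb : k ≤ b)
    (hab : k + (2 * n + 3) ≤ a + b) :
    ∃ C : ℝ≥0, ∀ {f g : Space n → ℝ}, IsTest f → IsTest g →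
      hE volume k (fun x => f x * g x) ≤ C * (hE volume a f * hE volume b g) := by
  induction k generalizing a b with
  | zero => exact hE_zero_mul_le hn a b (by omega)
  | succ k ih =>
    obtain ⟨C₀, hC₀⟩ := hE_zero_mul_le hn a b (by omega)
    obtain ⟨a, rfl⟩ : ∃ a', a = a' + 1 := ⟨a - 1, by omega⟩
    obtain ⟨b, rfl⟩ : ∃ b', b = b' + 1 := ⟨b - 1, by omega⟩
    -- In the Leibniz rule a derivative lands on one factor. This lowers k and one of the two orders
    -- by one, so the condition k + (2n + 3) ≤ a + b persists.
    obtain ⟨C₁, hC₁⟩ := ih a (b + 1) (by omega) (by omega) (by omega)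
    obtain ⟨C₂, hC₂⟩ := ih (a + 1) b (by omega) (by omega) (by omega)
    refine ⟨C₀ + (2 * n) * (2 * (C₁ + C₂)), fun {f g} hf hg => ?_⟩
    rw [hE_succ _ (hf.mul hg).1]
    set B := hE volume (a + 1) f * hE volume (b + 1) g with hB
    have h1 : ∀ i, hE volume k (horD i fun x => f x * g x) ≤ 2 * (C₁ + C₂) * B := by
      intro i
      have e : (horD i fun x => f x * g x) = fun x => horD i f x * g x + f x * horD i g x :=
        funext fun x => horD_mul_apply (hf.differentiableAt x) (hg.differentiableAt x) i
      rw [e]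
      refine (hE_add_le ((hf.horD i).mul hg) (hf.mul (hg.horD i)) k).trans ?_
      calc _ ≤ 2 * (C₁ * (hE volume a (horD i f) * hE volume (b + 1) g) +
            C₂ * (hE volume (a + 1) f * hE volume b (horD i g))) := by
            gcongr
            · exact hC₁ (hf.horD i) hg
            · exact hC₂ hf (hg.horD i)
        _ ≤ 2 * (C₁ * B + C₂ * B) := by
            rw [hB]
            gcongr
            · exact hE_horD_le a f i
            · exact hE_horD_le b g i
        _ = _ := by ring
    calc _ ≤ C₀ * B + ∑ _i : Fin (2 * n), 2 * (C₁ + C₂) * B :=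
          add_le_add (hC₀ hf hg) (Finset.sum_le_sum fun i _ => h1 i)
      _ = _ := by
        simp only [Finset.sum_const, Finset.card_univ, Fintype.card_fin, nsmul_eq_mul]
        push_cast; ring

end Products

/-! ### Superposition operators u ↦ f(·, u) on test functions. -/

section Superposition

variable {n : ℕ} {ι : Type*} [Fintype ι]

/-- Smooth functions `f(y, v)` which vanish for `y` outside a compact set. -/
structure IsSymbol (f : Space n × (ι → ℝ) → ℝ) : Prop where
  contDiff : ContDiff ℝ ∞ f
  exists_compact : ∃ K : Set (Space n), IsCompact K ∧ ∀ y ∉ K, ∀ v, f (y, v) = 0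

/-- The superposition `y ↦ f(y, u(y))`. -/
def nem (f : Space n × (ι → ℝ) → ℝ) (u : ι → Space n → ℝ) (y : Space n) : ℝ :=
  f (y, fun j => u j y)

theorem IsSymbol.fderiv_apply {f : Space n × (ι → ℝ) → ℝ} (hf : IsSymbol f)
    {X : Space n × (ι → ℝ) → Space n × (ι → ℝ)} (hX : ContDiff ℝ ∞ X) :
    IsSymbol (fun p => fderiv ℝ f p (X p)) := by
  obtain ⟨K, hK, h0⟩ := hf.2
  refine ⟨(hf.1.fderiv_right (m := ∞) (by simp)).clm_apply hX, K, hK, fun y hy v => ?_⟩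
  have ho : IsOpen (Kᶜ ×ˢ (univ : Set (ι → ℝ))) := hK.isClosed.isOpen_compl.prod isOpen_univ
  have h1 : f =ᶠ[𝓝 (y, v)] fun _ => 0 :=
    EqOn.eventuallyEq_of_mem (s := Kᶜ ×ˢ (univ : Set (ι → ℝ))) (fun p hp => h0 p.1 hp.1 p.2)
      (ho.mem_nhds ⟨hy, mem_univ v⟩)
  simp [h1.fderiv_eq]

theorem IsSymbol.horizontal {f : Space n × (ι → ℝ) → ℝ} (hf : IsSymbol f) (i : Fin (2 * n)) :
    IsSymbol (fun p => fderiv ℝ f p (frame n i p.1, 0)) :=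
  hf.fderiv_apply (X := fun p => (frame n i p.1, 0))
    (((contDiff_frame i).comp contDiff_fst).prodMk contDiff_const)

/-- The partial derivative of `f(y, v)` with respect to `v_j`. -/
def vert [DecidableEq ι] (j : ι) (f : Space n × (ι → ℝ) → ℝ) (p : Space n × (ι → ℝ)) : ℝ :=
  fderiv ℝ f p (0, Pi.single j 1)

theorem IsSymbol.vert [DecidableEq ι] {f : Space n × (ι → ℝ) → ℝ} (hf : IsSymbol f) (j : ι) :
    IsSymbol (vert j f) :=
  hf.fderiv_apply (X := fun _ => (0, Pi.single j 1)) contDiff_const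

theorem IsSymbol.isTest_nem {f : Space n × (ι → ℝ) → ℝ} (hf : IsSymbol f)
    {u : ι → Space n → ℝ} (hu : ∀ j, ContDiff ℝ ∞ (u j)) : IsTest (nem f u) := by
  obtain ⟨K, hK, h0⟩ := hf.2
  refine ⟨hf.1.comp (contDiff_id.prodMk (contDiff_pi.2 hu)), ?_⟩
  exact HasCompactSupport.intro hK fun y hy => h0 y hy _

theorem horD_nem [DecidableEq ι] {f : Space n × (ι → ℝ) → ℝ} (hf : IsSymbol f)
    {u : ι → Space n → ℝ} (hu : ∀ j, ContDiff ℝ ∞ (u j)) (i : Fin (2 * n)) (x : Space n) :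
    horD i (nem f u) x = nem (fun p => fderiv ℝ f p (frame n i p.1, 0)) u x +
      ∑ j, nem (vert j f) u x * horD i (u j) x := by
  have h1 : HasFDerivAt (fun y => (y, fun j => u j y))
      ((ContinuousLinearMap.id ℝ (Space n)).prod (ContinuousLinearMap.pi fun j => fderiv ℝ (u j) x)) x :=
    (hasFDerivAt_id x).prodMk (hasFDerivAt_pi.2 fun j =>
      ((hu j).differentiable (by simp) x).hasFDerivAt)
  have h2 := ((hf.1.differentiable (by simp) (x, fun j => u j x)).hasFDerivAt).comp x h1
  have h3 : fderiv ℝ (nem f u) x = _ := h2.fderiv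
  simp only [horD, h3, nem, vert]
  set L := fderiv ℝ f (x, fun j => u j x)
  have h4 : ((ContinuousLinearMap.id ℝ (Space n)).prod
      (ContinuousLinearMap.pi fun j => fderiv ℝ (u j) x)) (frame n i x) =
      (frame n i x, 0) + ∑ j, (fderiv ℝ (u j) x (frame n i x)) •
        ((0, Pi.single j 1) : Space n × (ι → ℝ)) := by
    ext l
    · simp [Prod.fst_sum]
    · simp [Prod.snd_sum, Finset.sum_apply, Pi.single_apply]
  rw [ContinuousLinearMap.comp_apply, h4, map_add, map_sum]
  simp only [map_smul, smul_eq_mul, mul_comm]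

/-- Induction on k through the chain rule `horD_nem`. The terms (∂f/∂v_j)(y, u) · X_i u_j are
products of a superposition, controlled in order k by induction, and of X_i u_j, which has order s -
1. The product estimate with orders k and s - 1 landing in k asks for s - 1 ≥ 2n + 3. Every
derivative brings one more factor 1 + ∑ ‖u_j‖², hence the exponent k. The bound R enters because f
is only controlled for v in a compact set. -/
theorem hE_nem_le (hn : 1 ≤ n) {s : ℕ} (hs : 2 * n + 4 ≤ s) (k : ℕ) (hk : k ≤ s)
    {f : Space n × (ι → ℝ) → ℝ} (hf : IsSymbol f) (R : ℝ) :
    ∃ C : ℝ≥0, ∀ {u : ι → Space n → ℝ}, (∀ j, IsTest (u j)) → (∀ j y, |u j y| ≤ R) →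
      hE volume k (nem f u) ≤ C * (1 + ∑ j, hE volume s (u j)) ^ k := by
  classical
  have base : ∀ {f : Space n × (ι → ℝ) → ℝ}, IsSymbol f → ∃ C : ℝ≥0,
      ∀ {u : ι → Space n → ℝ}, (∀ j y, |u j y| ≤ R) → hE volume 0 (nem f u) ≤ C := by
    intro f hf
    obtain ⟨K, hK, h0⟩ := hf.2
    have hB : IsCompact (K ×ˢ (univ.pi fun _ : ι => Icc (-R) R)) :=
      hK.prod (isCompact_univ_pi fun _ => isCompact_Icc)
    obtain ⟨B, hB⟩ := hB.exists_bound_of_continuousOn hf.1.continuous.continuousOn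
    refine ⟨(B.toNNReal ^ 2) * (volume K).toNNReal, fun {u} hu => ?_⟩
    have hle : ∀ x, hsq 0 (nem f u) x ≤ K.indicator (fun _ => (B.toNNReal : ℝ≥0∞) ^ 2) x := by
      intro x
      by_cases hx : x ∈ K
      · rw [indicator_of_mem hx]
        refine pow_le_pow_left' ?_ 2
        have : ‖nem f u x‖ ≤ B := hB (x, fun j => u j x)
          ⟨hx, fun j _ => abs_le.1 (hu j x)⟩
        rw [← ofReal_norm]
        exact ENNReal.ofReal_le_ofReal this
      · simp [hsq, nem, h0 x hx]
    calc hE volume 0 (nem f u) ≤ ∫⁻ x, K.indicator (fun _ => (B.toNNReal : ℝ≥0∞) ^ 2) x :=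
          lintegral_mono hle
      _ = (B.toNNReal : ℝ≥0∞) ^ 2 * volume K := by
          rw [lintegral_indicator_const hK.measurableSet]
      _ = _ := by
          push_cast
          rw [ENNReal.coe_toNNReal hK.measure_lt_top.ne]
  induction k generalizing f with
  | zero =>
    obtain ⟨C, hC⟩ := base hf
    exact ⟨C, fun {u} _ hR => by simpa using hC hR⟩
  | succ k ih =>
    obtain ⟨C₀, hC₀⟩ := base hf
    choose C₁ hC₁ using fun i : Fin (2 * n) => ih (by omega) (hf.horizontal i)
    choose C₂ hC₂ using fun j : ι => ih (by omega) (hf.vert j)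
    obtain ⟨s, rfl⟩ : ∃ s', s = s' + 1 := ⟨s - 1, by omega⟩
    obtain ⟨C₃, hC₃⟩ := hE_mul_le hn k k s le_rfl (by omega) (by omega)
    refine ⟨C₀ + ∑ i, 2 * (C₁ i + 2 ^ (Fintype.card ι) * ∑ j, C₃ * C₂ j), fun {u} hu hR => ?_⟩
    rw [hE_succ _ (hf.isTest_nem fun j => (hu j).1).1]
    set A := 1 + ∑ j, hE volume (s + 1) (u j) with hA
    have hA1 : 1 ≤ A := le_self_add
    have hAj : ∀ j, hE volume (s + 1) (u j) ≤ A := fun j =>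
      (Finset.single_le_sum (f := fun j => hE volume (s + 1) (u j)) (fun _ _ => zero_le)
        (Finset.mem_univ j)).trans le_add_self
    have h1 : ∀ i, hE volume k (horD i (nem f u)) ≤
        2 * (C₁ i + 2 ^ (Fintype.card ι) * ∑ j, C₃ * C₂ j) * A ^ (k + 1) := by
      intro i
      have e := funext fun x => horD_nem hf (fun j => (hu j).1) i x
      rw [e]
      have t1 : IsTest (nem (fun p => fderiv ℝ f p (frame n i p.1, 0)) u) :=
        (hf.horizontal i).isTest_nem fun j => (hu j).1
      have t2 : ∀ j, IsTest (fun x => nem (vert j f) u x * horD i (u j) x) := fun j =>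
        ((hf.vert j).isTest_nem fun j => (hu j).1).mul ((hu j).horD i)
      refine (hE_add_le t1 (IsTest.sum _ t2) k).trans ?_
      calc _ ≤ 2 * (C₁ i * A ^ k + 2 ^ (Fintype.card ι) *
            ∑ j, C₃ * (C₂ j * A ^ k * A)) := by
            gcongr
            · exact hC₁ i hu hR
            · refine (hE_sum_le _ t2 k).trans ?_
              rw [Finset.card_univ]
              gcongr with j
              refine (hC₃ ((hf.vert j).isTest_nem fun j => (hu j).1) ((hu j).horD i)).trans ?_
              gcongr
              · exact hC₂ j hu hR
              · exact (hE_horD_le s (u j) i).trans (hAj j)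
        _ ≤ 2 * (C₁ i * A ^ (k + 1) + 2 ^ (Fintype.card ι) *
            ∑ j, C₃ * (C₂ j * A ^ k * A)) := by
            gcongr
            exact Nat.le_succ k
        _ = 2 * (C₁ i + 2 ^ (Fintype.card ι) * ∑ j, C₃ * C₂ j) * A ^ (k + 1) := by
            have : ∑ j, (C₃ : ℝ≥0∞) * (C₂ j * A ^ k * A) = (∑ j, (C₃ : ℝ≥0∞) * C₂ j) * A ^ (k + 1) := by
              rw [Finset.sum_mul]
              exact Finset.sum_congr rfl fun j _ => by ring
            rw [this]; push_cast; ring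
    calc _ ≤ C₀ * A ^ (k + 1) + ∑ i, 2 * (C₁ i + 2 ^ (Fintype.card ι) * ∑ j, C₃ * C₂ j) * A ^ (k + 1) :=
          add_le_add ((hC₀ hR).trans (le_mul_of_one_le_right zero_le (one_le_pow₀ hA1)))
            (Finset.sum_le_sum fun i _ => h1 i)
      _ = _ := by
        rw [← Finset.sum_mul]
        push_cast; ring

end Superposition

end FollandStein
end

noncomputable section
namespace FollandStein

open scoped ENNReal NNReal Topology
open Set Filter

/-! ### Hadamard's formula, Lipschitz and Taylor estimates. -/

section Hadamard

/-- Smoothness of integrals depending on a parameter. -/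
theorem contDiff_integral_param {P : Type*} [NormedAddCommGroup P] [NormedSpace ℝ P]
    {h : P × ℝ → ℝ} (hh : ContDiff ℝ ∞ h) :
    ContDiff ℝ ∞ (fun p => ∫ θ in (0 : ℝ)..1, h (p, θ)) := by
  -- The bump is 1 on [-1, 1], so the integral is the value at 0 of the convolution of the indicator
  -- of [0, 1] with x ↦ ρ(x) h(p, -x). The latter has compact support in x uniformly in p, and such
  -- convolutions are smooth in the parameter.
  let ρ : ContDiffBump (0 : ℝ) := ⟨1, 2, by norm_num, by norm_num⟩
  have hf : LocallyIntegrable ((Icc (0 : ℝ) 1).indicator fun _ => (1 : ℝ)) volume :=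
    ((integrableOn_const (by simp)).integrable_indicator measurableSet_Icc).locallyIntegrable
  have hg : ContDiff ℝ ∞ (fun q : P × ℝ => ρ q.2 * h (q.1, -q.2)) :=
    (ρ.contDiff.comp contDiff_snd).mul (hh.comp (contDiff_fst.prodMk contDiff_snd.neg))
  have key := contDiffOn_convolution_right_with_param_comp (n := ⊤) (μ := (volume : Measure ℝ))
    (ContinuousLinearMap.mul ℝ ℝ) (s := univ) (v := fun _ : P => (0 : ℝ)) contDiffOn_const
    (g := fun p x => ρ x * h (p, -x)) (k := Metric.closedBall 0 2) isOpen_univ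
    (isCompact_closedBall _ _)
    (fun p x _ hx => by
      have : ρ x = 0 := ρ.zero_of_le_dist (by
        rw [Metric.mem_closedBall, not_le] at hx; exact hx.le)
      simp [this]) hf hg.contDiffOn
  rw [contDiffOn_univ] at key
  refine (congrArg (ContDiff ℝ ∞) (funext fun p => ?_)).mpr key
  rw [convolution, intervalIntegral.integral_of_le zero_le_one, ← integral_Icc_eq_integral_Ioc,
    ← integral_indicator measurableSet_Icc]
  refine integral_congr_ae (Eventually.of_forall fun t => ?_)
  by_cases ht : t ∈ Icc (0 : ℝ) 1
  · have : ρ (0 - t) = 1 := ρ.one_of_mem_closedBall (by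
      simp [abs_le, ρ]; constructor <;> linarith [ht.1, ht.2])
    simp only [indicator_of_mem ht, ContinuousLinearMap.mul_apply', this, one_mul]
    simp
  · simp [indicator_of_notMem ht]

set_option linter.unusedSectionVars false

variable {n : ℕ} {ι : Type*} [Fintype ι] [DecidableEq ι]

/-- The functions `H_j` with `f(y, v) - f(y, w) = ∑_j H_j(y, v, w) (v_j - w_j)`. -/
def hadamard (f : Space n × (ι → ℝ) → ℝ) (j : ι) (p : Space n × (ι ⊕ ι → ℝ)) : ℝ :=
  ∫ θ in (0 : ℝ)..1, vert j f
    (p.1, fun l => p.2 (Sum.inr l) + θ * (p.2 (Sum.inl l) - p.2 (Sum.inr l)))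

theorem IsSymbol.hadamard {f : Space n × (ι → ℝ) → ℝ} (hf : IsSymbol f) (j : ι) :
    IsSymbol (hadamard f j) := by
  obtain ⟨K, hK, h0⟩ := (hf.vert j).2
  refine ⟨contDiff_integral_param (h := fun q : (Space n × (ι ⊕ ι → ℝ)) × ℝ =>
    FollandStein.vert j f
    (q.1.1, fun l => q.1.2 (Sum.inr l) + q.2 * (q.1.2 (Sum.inl l) - q.1.2 (Sum.inr l)))) ?_,
    K, hK, fun y hy v => by simp [FollandStein.hadamard, h0 y hy]⟩
  refine (hf.vert j).1.comp (ContDiff.prodMk (by fun_prop) (contDiff_pi.2 fun l => by fun_prop))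

/-- The fundamental theorem of calculus along the segment from w to v. -/
theorem sub_eq_sum_hadamard {f : Space n × (ι → ℝ) → ℝ} (hf : IsSymbol f) (y : Space n)
    (v w : ι → ℝ) :
    f (y, v) - f (y, w) = ∑ j, hadamard f j (y, Sum.elim v w) * (v j - w j) := by
  set c : ℝ → Space n × (ι → ℝ) := fun θ => (y, fun l => w l + θ * (v l - w l)) with hc
  have hcd : ∀ θ, HasDerivAt c (0, fun l => v l - w l) θ := by
    intro θ
    refine (hasDerivAt_const θ y).prodMk (hasDerivAt_pi.2 fun l => ?_)
    simpa using ((hasDerivAt_id θ).mul_const (v l - w l)).const_add (w l)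
  have hcc : Continuous c := continuous_iff_continuousAt.2 fun θ => (hcd θ).continuousAt
  have hd : ∀ θ, HasDerivAt (fun θ => f (c θ)) (∑ j, vert j f (c θ) * (v j - w j)) θ := by
    intro θ
    have h1 := ((hf.1.differentiable (by simp) (c θ)).hasFDerivAt).comp_hasDerivAt θ (hcd θ)
    convert! h1 using 1
    have : ((0, fun l => v l - w l) : Space n × (ι → ℝ)) =
        ∑ j, (v j - w j) • ((0, Pi.single j 1) : Space n × (ι → ℝ)) := by
      ext l
      · simp [Prod.fst_sum]
      · simp [Prod.snd_sum, Finset.sum_apply, Pi.single_apply]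
    rw [this, map_sum]
    simp only [map_smul, smul_eq_mul, vert, mul_comm]
  have hvc : ∀ j, Continuous fun θ => vert j f (c θ) := fun j => (hf.vert j).1.continuous.comp hcc
  have h2 := intervalIntegral.integral_eq_sub_of_hasDerivAt (a := 0) (b := 1)
    (fun θ _ => hd θ)
    ((continuous_finsetSum _ fun j _ => (hvc j).mul continuous_const).intervalIntegrable _ _)
  have e1 : f (c 1) = f (y, v) := by simp [hc]
  have e0 : f (c 0) = f (y, w) := by simp [hc]
  rw [e1, e0] at h2
  have hi : ∀ j ∈ Finset.univ, IntervalIntegrable (fun θ => vert j f (c θ) * (v j - w j)) volume 0 1 :=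
    fun j _ => ((hvc j).mul continuous_const).intervalIntegrable _ _
  rw [← h2, intervalIntegral.integral_finsetSum hi]
  refine Finset.sum_congr rfl fun j _ => ?_
  rw [intervalIntegral.integral_mul_const]
  rfl

theorem hadamard_diag (f : Space n × (ι → ℝ) → ℝ) (j : ι) (y : Space n) (w : ι → ℝ) :
    hadamard f j (y, Sum.elim w w) = vert j f (y, w) := by
  simp [hadamard]

theorem IsTest.sub {f g : Space n → ℝ} (hf : IsTest f) (hg : IsTest g) :
    IsTest (fun x => f x - g x) :=
  ⟨hf.1.sub hg.1, hf.2.sub hg.2⟩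

theorem IsTest.sumElim {u w : ι → Space n → ℝ} (hu : ∀ j, IsTest (u j)) (hw : ∀ j, IsTest (w j))
    (j : ι ⊕ ι) : IsTest (Sum.elim u w j) := by
  cases j
  · exact hu _
  · exact hw _

theorem nem_sumElim (f : Space n × (ι ⊕ ι → ℝ) → ℝ) (u w : ι → Space n → ℝ) (x : Space n) :
    nem f (Sum.elim u w) x = f (x, Sum.elim (fun j => u j x) (fun j => w j x)) := by
  unfold nem
  congr 2
  ext j
  cases j <;> rfl

/-- The functions H_j of Hadamard's formula are symbols in the doubled variable (v, w), so
`hE_nem_le` bounds H_j(·, u, w); the product estimate with all orders equal to s adjoins the factor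
u_j - w_j. -/
theorem hE_nem_sub_le (hn : 1 ≤ n) {s : ℕ} (hs : 2 * n + 4 ≤ s)
    {f : Space n × (ι → ℝ) → ℝ} (hf : IsSymbol f) (R : ℝ) :
    ∃ C : ℝ≥0, ∀ {u w : ι → Space n → ℝ}, (∀ j, IsTest (u j)) → (∀ j, IsTest (w j)) →
      (∀ j y, |u j y| ≤ R) → (∀ j y, |w j y| ≤ R) →
      hE volume s (fun x => nem f u x - nem f w x) ≤
        C * (1 + ∑ j, hE volume s (u j) + ∑ j, hE volume s (w j)) ^ s *
          ∑ j, hE volume s (fun x => u j x - w j x) := by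
  choose C₁ hC₁ using fun j => hE_nem_le hn hs s le_rfl (hf.hadamard j) R
  obtain ⟨C₂, hC₂⟩ := hE_mul_le hn s s s le_rfl le_rfl (by omega)
  refine ⟨2 ^ Fintype.card ι * ∑ j, C₂ * C₁ j, fun {u w} hu hw huR hwR => ?_⟩
  set A := 1 + ∑ j, hE volume s (u j) + ∑ j, hE volume s (w j) with hA
  set D := ∑ j, hE volume s (fun x => u j x - w j x) with hD
  have e : (fun x => nem f u x - nem f w x) =
      fun x => ∑ j, nem (hadamard f j) (Sum.elim u w) x * (u j x - w j x) := by
    funext x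
    simp only [nem_sumElim]
    exact sub_eq_sum_hadamard hf x _ _
  have huw := IsTest.sumElim hu hw
  have t1 : ∀ j, IsTest (nem (hadamard f j) (Sum.elim u w)) := fun j =>
    (hf.hadamard j).isTest_nem fun l => (huw l).1
  have hR : ∀ (l : ι ⊕ ι) y, |Sum.elim u w l y| ≤ R := by
    rintro (l | l) y
    · exact huR l y
    · exact hwR l y
  have hAe : 1 + ∑ l, hE volume s (Sum.elim u w l) = A := by
    rw [Fintype.sum_sum_type, hA, add_assoc]; rfl
  rw [e]
  refine (hE_sum_le _ (fun j => (t1 j).mul ((hu j).sub (hw j))) s).trans ?_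
  rw [Finset.card_univ]
  have h3 : ∀ j, hE volume s (fun x => nem (hadamard f j) (Sum.elim u w) x * (u j x - w j x)) ≤
      (C₂ * C₁ j) * (A ^ s * D) := by
    intro j
    refine (hC₂ (t1 j) ((hu j).sub (hw j))).trans ?_
    calc _ ≤ C₂ * ((C₁ j * A ^ s) * D) := by
          gcongr
          · rw [← hAe]; exact hC₁ j huw hR
          · exact Finset.single_le_sum (f := fun j => hE volume s (fun x => u j x - w j x))
              (fun _ _ => zero_le) (Finset.mem_univ j)
      _ = _ := by ring
  calc _ ≤ (2 : ℝ≥0∞) ^ Fintype.card ι * ∑ j, (C₂ * C₁ j) * (A ^ s * D) := by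
        gcongr with j; exact h3 j
    _ = _ := by rw [← Finset.sum_mul]; push_cast; ring

/-- On the diagonal H_j equals ∂f/∂v_j, so the Taylor remainder is ∑_j (H_j(·, u, w) - H_j(·, w, w))
(u_j - w_j). The Lipschitz estimate for the symbol H_j supplies the second power of the difference.
-/
theorem hE_nem_taylor_le (hn : 1 ≤ n) {s : ℕ} (hs : 2 * n + 4 ≤ s)
    {f : Space n × (ι → ℝ) → ℝ} (hf : IsSymbol f) (R : ℝ) :
    ∃ C : ℝ≥0, ∀ {u w : ι → Space n → ℝ}, (∀ j, IsTest (u j)) → (∀ j, IsTest (w j)) →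
      (∀ j y, |u j y| ≤ R) → (∀ j y, |w j y| ≤ R) →
      hE volume s (fun x => nem f u x - nem f w x - ∑ j, nem (vert j f) w x * (u j x - w j x)) ≤
        C * (1 + ∑ j, hE volume s (u j) + ∑ j, hE volume s (w j)) ^ s *
          (∑ j, hE volume s (fun x => u j x - w j x)) ^ 2 := by
  choose C₁ hC₁ using fun j => hE_nem_sub_le hn hs (hf.hadamard j) R
  obtain ⟨C₂, hC₂⟩ := hE_mul_le hn s s s le_rfl le_rfl (by omega)
  refine ⟨2 ^ Fintype.card ι * ∑ j, C₂ * (C₁ j * 3 ^ s), fun {u w} hu hw huR hwR => ?_⟩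
  set A := 1 + ∑ j, hE volume s (u j) + ∑ j, hE volume s (w j) with hA
  set D := ∑ j, hE volume s (fun x => u j x - w j x) with hD
  have e : (fun x => nem f u x - nem f w x - ∑ j, nem (vert j f) w x * (u j x - w j x)) =
      fun x => ∑ j, (nem (hadamard f j) (Sum.elim u w) x - nem (hadamard f j) (Sum.elim w w) x)
        * (u j x - w j x) := by
    funext x
    simp only [nem_sumElim, sub_mul, Finset.sum_sub_distrib, hadamard_diag]
    rw [← sub_eq_sum_hadamard hf x]
    rfl
  have huw := IsTest.sumElim hu hw
  have hww := IsTest.sumElim hw hw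
  have t1 : ∀ j, IsTest (fun x => nem (hadamard f j) (Sum.elim u w) x -
      nem (hadamard f j) (Sum.elim w w) x) := fun j =>
    ((hf.hadamard j).isTest_nem fun l => (huw l).1).sub
      ((hf.hadamard j).isTest_nem fun l => (hww l).1)
  have hR : ∀ (l : ι ⊕ ι) y, |Sum.elim u w l y| ≤ R := by
    rintro (l | l) y
    · exact huR l y
    · exact hwR l y
  have hR' : ∀ (l : ι ⊕ ι) y, |Sum.elim w w l y| ≤ R := by
    rintro (l | l) y
    · exact hwR l y
    · exact hwR l y
  have hAe : 1 + ∑ l, hE volume s (Sum.elim u w l) + ∑ l, hE volume s (Sum.elim w w l) ≤ 3 * A := by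
    rw [Fintype.sum_sum_type, Fintype.sum_sum_type, hA]
    simp only [Sum.elim_inl, Sum.elim_inr]
    set a := ∑ j, hE volume s (u j)
    set b := ∑ j, hE volume s (w j)
    calc 1 + (a + b) + (b + b) ≤ 1 + (a + b) + (b + b) + (2 + 2 * a) := le_self_add
      _ = 3 * (1 + a + b) := by ring
  have hDe : ∑ l, hE volume s (fun x => Sum.elim u w l x - Sum.elim w w l x) = D := by
    rw [Fintype.sum_sum_type]
    simp only [Sum.elim_inl, Sum.elim_inr, sub_self]
    simp only [hE, hsq_zero]
    simp [hD, hE]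
  rw [e]
  refine (hE_sum_le _ (fun j => (t1 j).mul ((hu j).sub (hw j))) s).trans ?_
  rw [Finset.card_univ]
  have h3 : ∀ j, hE volume s (fun x => (nem (hadamard f j) (Sum.elim u w) x -
      nem (hadamard f j) (Sum.elim w w) x) * (u j x - w j x)) ≤
      (C₂ * (C₁ j * 3 ^ s)) * (A ^ s * D ^ 2) := by
    intro j
    refine (hC₂ (t1 j) ((hu j).sub (hw j))).trans ?_
    calc _ ≤ C₂ * ((C₁ j * (3 * A) ^ s * D) * D) := by
          gcongr
          · refine (hC₁ j huw hww hR hR').trans ?_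
            rw [hDe]
            gcongr
          · exact Finset.single_le_sum (f := fun j => hE volume s (fun x => u j x - w j x))
              (fun _ _ => zero_le) (Finset.mem_univ j)
      _ = _ := by rw [mul_pow]; ring
  calc _ ≤ (2 : ℝ≥0∞) ^ Fintype.card ι * ∑ j, (C₂ * (C₁ j * 3 ^ s)) * (A ^ s * D ^ 2) := by
        gcongr with j; exact h3 j
    _ = _ := by rw [← Finset.sum_mul]; push_cast; ring

end Hadamard

end FollandStein
end

noncomputable section
namespace FollandStein

open scoped ENNReal NNReal Topology
open Set Filter

/-! ### Continuous extension of nonlinear maps from a dense subset. -/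

section Extension

/-- A map which is Lipschitz on bounded sets extends continuously from a dense subset. -/
theorem exists_continuous_extension {X Y Z : Type*} [NormedAddCommGroup Y] [NormedAddCommGroup Z]
    [CompleteSpace Z] {e : X → Y} (he : DenseRange e) {φ : X → Z}
    (h : ∀ R : ℝ, ∃ C : ℝ, ∀ x x', ‖e x‖ ≤ R → ‖e x'‖ ≤ R → ‖φ x - φ x'‖ ≤ C * ‖e x - e x'‖) :
    ∃ ψ : Y → Z, Continuous ψ ∧ ∀ x, ψ (e x) = φ x := by
  let _ : TopologicalSpace X := TopologicalSpace.induced e inferInstance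
  have hd : IsDenseInducing e := ⟨⟨rfl⟩, he⟩
  have ht : ∀ b, ∃ c, Tendsto φ (comap e (𝓝 b)) (𝓝 c) := by
    intro b
    have hne : (comap e (𝓝 b)).NeBot := hd.comap_nhds_neBot b
    obtain ⟨C, hC⟩ := h (‖b‖ + 1)
    refine CompleteSpace.complete (Metric.cauchy_iff.2 ⟨inferInstance, fun ε hε => ?_⟩)
    -- Two points of the ball of radius δ are less than 2δ apart, so their images differ by less
    -- than (|C| + 1) · 2δ ≤ ε.
    set δ := min 1 (ε / (2 * (|C| + 1))) with hδ
    have hδ0 : 0 < δ := by positivity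
    refine ⟨φ '' (e ⁻¹' Metric.ball b δ),
      image_mem_map (preimage_mem_comap (Metric.ball_mem_nhds b hδ0)), ?_⟩
    have hb : ∀ x, e x ∈ Metric.ball b δ → ‖e x‖ ≤ ‖b‖ + 1 := by
      intro x hx
      have h1 : ‖e x - b‖ < 1 := by
        rw [← dist_eq_norm]; exact (Metric.mem_ball.1 hx).trans_le (min_le_left _ _)
      linarith [norm_le_norm_add_norm_sub' (e x) b]
    rintro _ ⟨x, hx, rfl⟩ _ ⟨x', hx', rfl⟩
    have h1 : ‖e x - e x'‖ < 2 * δ := by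
      rw [← dist_eq_norm]
      linarith [dist_triangle_right (e x) (e x') b, Metric.mem_ball.1 hx, Metric.mem_ball.1 hx']
    rw [dist_eq_norm]
    calc ‖φ x - φ x'‖ ≤ C * ‖e x - e x'‖ := hC x x' (hb x hx) (hb x' hx')
      _ ≤ (|C| + 1) * ‖e x - e x'‖ := by
          gcongr; linarith [le_abs_self C]
      _ < (|C| + 1) * (2 * δ) := by gcongr
      _ ≤ (|C| + 1) * (2 * (ε / (2 * (|C| + 1)))) := by gcongr; exact min_le_right _ _
      _ = ε := by field_simp
  refine ⟨hd.extend φ, hd.continuous_extend ht, fun x => ?_⟩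
  obtain ⟨c, hc⟩ := ht (e x)
  rw [← hd.nhds_eq_comap] at hc
  exact hd.extend_eq_at' c hc

end Extension

/-! ### The completion on `Space n` and the smoothness of superposition. -/

section SobolevSpace

set_option linter.unusedSectionVars false

theorem eLpNorm_two_sq {α W : Type*} [MeasurableSpace α] [NormedAddCommGroup W] (f : α → W)
    (μ : Measure α) : eLpNorm f 2 μ ^ 2 = ∫⁻ x, ‖f x‖ₑ ^ 2 ∂μ := by
  have := eLpNorm_nnreal_pow_eq_lintegral (f := f) (μ := μ) (p := 2) two_ne_zero
  simpa using this

variable {n : ℕ}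

theorem IsTest.memLp {f : Space n → ℝ} (hf : IsTest f) : MemLp f 2 volume :=
  hf.1.continuous.memLp_of_hasCompactSupport hf.2

theorem IsTest.horDL {f : Space n → ℝ} (hf : IsTest f) (I : List (Fin (2 * n))) :
    IsTest (horDL I f) := by
  induction I with
  | nil => exact hf
  | cons i I ih => exact ih.horD i

theorem IsTest.const_mul {f : Space n → ℝ} (hf : IsTest f) (c : ℝ) :
    IsTest (fun x => c * f x) :=
  ⟨contDiff_const.mul hf.1, hf.2.mul_left⟩

variable (n) in
/-- The space of smooth compactly supported functions. -/
def testFn : Submodule ℝ (Space n → ℝ) where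
  carrier := {f | IsTest f}
  add_mem' hf hg := IsTest.add hf hg
  zero_mem' := ⟨contDiff_const, HasCompactSupport.zero⟩
  smul_mem' c _ hf := IsTest.const_mul hf c

theorem horDL_add {f g : Space n → ℝ} (hf : IsTest f) (hg : IsTest g) (I : List (Fin (2 * n))) :
    horDL I (f + g) = horDL I f + horDL I g := by
  induction I with
  | nil => rfl
  | cons i I ih =>
    simp only [horDL, ih]
    exact funext fun x => horD_add_apply ((hf.horDL I).differentiableAt x)
      ((hg.horDL I).differentiableAt x) i

theorem horDL_smul {f : Space n → ℝ} (hf : IsTest f) (c : ℝ) (I : List (Fin (2 * n))) :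
    horDL I (c • f) = c • horDL I f :=
  funext fun x => horDL_clm isOpen_univ (c • ContinuousLinearMap.id ℝ ℝ) hf.1.contDiffOn I
    (mem_univ x)

/-- The tuple of all horizontal derivatives of order at most `s`. -/
def jet (s : ℕ) : testFn n →ₗ[ℝ] (MultiIndex n s → Lp ℝ 2 (volume : Measure (Space n))) where
  toFun f I := (f.2.horDL (List.ofFn I.2)).memLp.toLp _
  map_add' f g := by
    funext I
    rw [Pi.add_apply, ← MemLp.toLp_add]
    congr 1
    exact horDL_add f.2 g.2 _
  map_smul' c f := by
    funext I
    rw [Pi.smul_apply, RingHom.id_apply, ← MemLp.toLp_const_smul]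
    congr 1
    exact horDL_smul f.2 c _

theorem enorm_jet_sq (s : ℕ) (f : testFn n) (I : MultiIndex n s) :
    ‖jet s f I‖ₑ ^ 2 = ∫⁻ x, ‖horDL (List.ofFn I.2) (f : Space n → ℝ) x‖ₑ ^ 2 := by
  rw [← eLpNorm_two_sq, jet]
  simp only [LinearMap.coe_mk, AddHom.coe_mk, Lp.enorm_toLp]

theorem norm_jet_sq_le (s : ℕ) (f : testFn n) :
    ‖jet s f‖ₑ ^ 2 ≤ hE volume s (f : Space n → ℝ) := by
  have h1 : ∀ I, ‖jet s f I‖ₑ ^ 2 ≤ hE volume s (f : Space n → ℝ) := fun I => by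
    rw [enorm_jet_sq]
    exact lintegral_mono fun x => enorm_horDL_sq_le_hsq s _ x _ (by
      rw [List.length_ofFn]; omega)
  rcases eq_or_ne (hE volume s (f : Space n → ℝ)) ⊤ with h | h
  · simp [h]
  have h2 : ‖jet s f‖ ≤ Real.sqrt (hE volume s (f : Space n → ℝ)).toReal := by
    refine (pi_norm_le_iff_of_nonneg (Real.sqrt_nonneg _)).2 fun I => ?_
    apply Real.le_sqrt_of_sq_le
    rw [← ENNReal.ofReal_le_iff_le_toReal h, ENNReal.ofReal_pow (norm_nonneg _), ofReal_norm]
    exact h1 I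
  rw [← ofReal_norm, ← ENNReal.ofReal_pow (norm_nonneg _), ENNReal.ofReal_le_iff_le_toReal h]
  calc ‖jet s f‖ ^ 2 ≤ Real.sqrt (hE volume s (f : Space n → ℝ)).toReal ^ 2 := by gcongr
    _ = _ := Real.sq_sqrt ENNReal.toReal_nonneg

theorem hE_le_norm_jet_sq (n s : ℕ) : ∃ C : ℝ≥0, ∀ f : testFn n,
    hE volume s (f : Space n → ℝ) ≤ C * ENNReal.ofReal (‖jet s f‖ ^ 2) := by
  refine ⟨(2 * n + 1) ^ s * Fintype.card (MultiIndex n s), fun f => ?_⟩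
  rw [ENNReal.ofReal_pow (norm_nonneg _), ofReal_norm]
  calc hE volume s (f : Space n → ℝ)
      ≤ ∫⁻ x, (2 * n + 1 : ℝ≥0∞) ^ s *
          ∑ I : MultiIndex n s, ‖horDL (List.ofFn I.2) (f : Space n → ℝ) x‖ₑ ^ 2 :=
        lintegral_mono fun x => hsq_le_sum_multiIndex s _ x
    _ = (2 * n + 1 : ℝ≥0∞) ^ s * ∑ I : MultiIndex n s, ‖jet s f I‖ₑ ^ 2 := by
        rw [lintegral_const_mul' _ _ (by finiteness), lintegral_finsetSum]
        · simp only [enorm_jet_sq]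
        · intro I _
          have := (f.2.horDL (List.ofFn I.2)).1.continuous
          exact (by fun_prop : Continuous fun x =>
            ‖horDL (List.ofFn I.2) (f : Space n → ℝ) x‖ₑ ^ 2).measurable
    _ ≤ (2 * n + 1 : ℝ≥0∞) ^ s * ∑ _I : MultiIndex n s, ‖jet s f‖ₑ ^ 2 := by
        gcongr with I
        rw [enorm_le_iff_norm_le]
        exact norm_le_pi_norm (jet s f) I
    _ = _ := by
        rw [Finset.sum_const, Finset.card_univ, nsmul_eq_mul]
        push_cast; ring

/-- `e` exhibits `H` as the completion of the space of smooth compactly supported functions on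
`ℝ^{2n+1}` for the Folland-Stein norm of order `s`, up to equivalence of norms. -/
structure IsSobolev {H : Type*} [NormedAddCommGroup H] [NormedSpace ℝ H] (s : ℕ)
    (e : testFn n →ₗ[ℝ] H) : Prop where
  dense : DenseRange e
  enorm_sq_le : ∀ f : testFn n, ‖e f‖ₑ ^ 2 ≤ hE volume s (f : Space n → ℝ)
  hE_le : ∃ C : ℝ≥0, ∀ f : testFn n, hE volume s (f : Space n → ℝ) ≤ C * ENNReal.ofReal (‖e f‖ ^ 2)

variable (n) in
-- The closure of the jets in a finite product of L² spaces. The product has the supremum norm,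
-- which is equivalent to the Folland-Stein norm; the later arguments use only the properties
-- collected in `IsSobolev`.
theorem exists_isSobolev (s : ℕ) : ∃ (H : Type) (_ : NormedAddCommGroup H) (_ : NormedSpace ℝ H)
    (_ : CompleteSpace H) (e : testFn n →ₗ[ℝ] H), IsSobolev s e := by
  let S := (LinearMap.range (jet (n := n) s)).topologicalClosure
  refine ⟨S, inferInstance, inferInstance,
    (Submodule.isClosed_topologicalClosure _).completeSpace_coe,
    (jet s).codRestrict S fun f =>
      (LinearMap.range (jet s)).le_topologicalClosure (LinearMap.mem_range_self _ f),
    ?_, norm_jet_sq_le s, hE_le_norm_jet_sq n s⟩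
  rw [DenseRange, Subtype.dense_iff]
  intro x hx
  rw [← range_comp]
  exact hx

variable {H : Type*} [NormedAddCommGroup H] [NormedSpace ℝ H] [CompleteSpace H] {s : ℕ}
  {e : testFn n →ₗ[ℝ] H}

/-- Product of test functions. -/
def mulTest (e : testFn n →ₗ[ℝ] H) (f : testFn n) : testFn n →ₗ[ℝ] H :=
  e ∘ₗ ({ toFun := fun g => ⟨fun x => f.1 x * g.1 x, f.2.mul g.2⟩
          map_add' := fun g g' => Subtype.ext (funext fun x => mul_add _ _ _)
          map_smul' := fun c g => Subtype.ext (funext fun x => by simp [mul_left_comm]) } :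
    testFn n →ₗ[ℝ] testFn n)

theorem mulTest_apply (e : testFn n →ₗ[ℝ] H) (f g : testFn n) :
    mulTest e f g = e ⟨fun x => f.1 x * g.1 x, f.2.mul g.2⟩ := rfl

theorem norm_mulTest_le (he : IsSobolev s e) (hn : 1 ≤ n) (hs : 2 * n + 3 ≤ s) :
    ∃ C : ℝ, 0 ≤ C ∧ ∀ f g : testFn n, ‖mulTest e f g‖ ≤ C * ‖e f‖ * ‖e g‖ := by
  obtain ⟨C₁, hC₁⟩ := hE_mul_le hn s s s le_rfl le_rfl (by omega)
  obtain ⟨C₂, hC₂⟩ := he.hE_le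
  refine ⟨Real.sqrt (C₁ * C₂ * C₂), Real.sqrt_nonneg _, fun f g => ?_⟩
  have h1 : ENNReal.ofReal (‖mulTest e f g‖ ^ 2) ≤
      ENNReal.ofReal (C₁ * C₂ * C₂ * (‖e f‖ ^ 2 * ‖e g‖ ^ 2)) := by
    rw [ENNReal.ofReal_pow (norm_nonneg _), ofReal_norm]
    refine (he.enorm_sq_le _).trans ((hC₁ f.2 g.2).trans ?_)
    calc _ ≤ (C₁ : ℝ≥0∞) * ((C₂ * ENNReal.ofReal (‖e f‖ ^ 2)) *
          (C₂ * ENNReal.ofReal (‖e g‖ ^ 2))) := by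
          gcongr
          · exact hC₂ f
          · exact hC₂ g
      _ = _ := by
          rw [ENNReal.ofReal_mul (by positivity), ENNReal.ofReal_mul (by positivity),
            ENNReal.ofReal_mul (by positivity), ENNReal.ofReal_mul (by positivity),
            ENNReal.ofReal_coe_nnreal, ENNReal.ofReal_coe_nnreal]
          ring
  have h2 := (ENNReal.ofReal_le_ofReal_iff (by positivity)).1 h1
  rw [← pow_le_pow_iff_left₀ (norm_nonneg _) (by positivity) two_ne_zero]
  refine h2.trans_eq ?_
  rw [mul_pow, mul_pow, Real.sq_sqrt (by positivity)]
  ring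

/-- Multiplication of test functions extends to the completion. -/
theorem exists_mulSob (he : IsSobolev s e) (hn : 1 ≤ n) (hs : 2 * n + 3 ≤ s) :
    ∃ m : H →L[ℝ] H →L[ℝ] H, ∀ f g : testFn n,
      m (e f) (e g) = mulTest e f g := by
  obtain ⟨C, hC0, hC⟩ := norm_mulTest_le he hn hs
  have hd := he.dense
  have e1 : ∀ f g, (mulTest e f).extendOfNorm (e) (e g) = mulTest e f g := fun f g =>
    LinearMap.extendOfNorm_eq hd ⟨_, hC f⟩ g
  have ext : ∀ {T T' : H →L[ℝ] H}, (∀ g, T (e g) = T' (e g)) → T = T' :=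
    fun {T T'} h => ContinuousLinearMap.coeFn_injective
      (hd.equalizer T.continuous T'.continuous (funext h))
  let A : testFn n →ₗ[ℝ] (H →L[ℝ] H) :=
    { toFun := fun f => (mulTest e f).extendOfNorm (e)
      map_add' := fun f f' => ext fun g => by
        rw [_root_.add_apply, e1, e1, e1]
        simp only [mulTest, LinearMap.comp_apply, ← map_add]
        congr 1
        exact Subtype.ext (funext fun x => add_mul _ _ _)
      map_smul' := fun c f => ext fun g => by
        rw [RingHom.id_apply, _root_.smul_apply, e1, e1]
        rw [mulTest_apply, mulTest_apply, ← map_smul]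
        congr 1
        exact Subtype.ext (funext fun x => mul_assoc _ _ _) }
  have hA : ∀ f, ‖A f‖ ≤ C * ‖e f‖ := fun f =>
    LinearMap.opNorm_extendOfNorm_le hd (by positivity) (hC f)
  refine ⟨A.extendOfNorm (e), fun f g => ?_⟩
  rw [LinearMap.extendOfNorm_eq hd ⟨C, hA⟩ f]
  exact e1 f g

variable {ι : Type*} [Fintype ι]

/-- Superposition acting on test functions. -/
def nemTest {f : Space n × (ι → ℝ) → ℝ} (hf : IsSymbol f) (u : ι → testFn n) : testFn n :=
  ⟨nem f fun j => u j, hf.isTest_nem fun j => (u j).2.1⟩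

theorem sum_hE_le (he : IsSobolev s e) (ι : Type*) [Fintype ι] : ∃ C : ℝ≥0, ∀ u : ι → testFn n,
    ∑ j, hE volume s (u j : Space n → ℝ) ≤
      ENNReal.ofReal (C * ‖fun j => e (u j)‖ ^ 2) := by
  obtain ⟨C, hC⟩ := he.hE_le
  refine ⟨Fintype.card ι * C, fun u => ?_⟩
  calc ∑ j, hE volume s (u j : Space n → ℝ)
      ≤ ∑ _j : ι, C * ENNReal.ofReal (‖fun j => e (u j)‖ ^ 2) := by
        refine Finset.sum_le_sum fun j _ => (hC (u j)).trans ?_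
        gcongr
        exact norm_le_pi_norm (fun j => e (u j)) j
    _ = _ := by
        rw [Finset.sum_const, Finset.card_univ, nsmul_eq_mul, ENNReal.ofReal_mul (by positivity),
          ENNReal.ofReal_coe_nnreal]
        push_cast; ring

theorem abs_le_norm_toSob (he : IsSobolev s e) (hn : 1 ≤ n) (hs : 2 * n + 2 ≤ s) : ∃ C : ℝ, 0 ≤ C ∧
    ∀ (f : testFn n) (x : Space n), |f.1 x| ≤ C * ‖e f‖ := by
  obtain ⟨C₁, hC₁⟩ := enorm_sq_le_hE hn
  obtain ⟨C₂, hC₂⟩ := he.hE_le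
  refine ⟨Real.sqrt (C₁ * C₂), Real.sqrt_nonneg _, fun f x => ?_⟩
  have h1 : ENNReal.ofReal (‖f.1 x‖ ^ 2) ≤ ENNReal.ofReal (C₁ * C₂ * ‖e f‖ ^ 2) := by
    rw [ENNReal.ofReal_pow (norm_nonneg _), ofReal_norm, ENNReal.ofReal_mul (by positivity),
      ENNReal.ofReal_mul (by positivity), ENNReal.ofReal_coe_nnreal, ENNReal.ofReal_coe_nnreal,
      mul_assoc]
    refine (hC₁ f.2 x).trans ?_
    gcongr
    exact (hE_mono hs _).trans (hC₂ f)
  have h2 := (ENNReal.ofReal_le_ofReal_iff (by positivity)).1 h1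
  rw [← Real.norm_eq_abs, ← pow_le_pow_iff_left₀ (norm_nonneg _) (by positivity) two_ne_zero,
    mul_pow, Real.sq_sqrt (by positivity)]
  exact h2

theorem norm_nemTest_sub_le (he : IsSobolev s e) (hn : 1 ≤ n) (hs : 2 * n + 4 ≤ s)
    {f : Space n × (ι → ℝ) → ℝ} (hf : IsSymbol f) (R : ℝ) :
    ∃ C : ℝ, 0 ≤ C ∧ ∀ u w : ι → testFn n, (∀ j x, |(u j).1 x| ≤ R) → (∀ j x, |(w j).1 x| ≤ R) →
      ‖e (nemTest hf u) - e (nemTest hf w)‖ ≤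
        C * (1 + ‖fun j => e (u j)‖ + ‖fun j => e (w j)‖) ^ s *
          ‖(fun j => e (u j)) - fun j => e (w j)‖ := by
  classical
  obtain ⟨C₁, hC₁⟩ := hE_nem_sub_le hn hs hf R
  obtain ⟨C₂, hC₂⟩ := sum_hE_le he ι
  refine ⟨Real.sqrt (C₁ * (C₂ + 1) ^ s * C₂), Real.sqrt_nonneg _, fun u w hu hw => ?_⟩
  set a := ‖fun j => e (u j)‖ with ha
  set b := ‖fun j => e (w j)‖ with hb
  set d := ‖(fun j => e (u j)) - fun j => e (w j)‖ with hd
  have ha0 : 0 ≤ a := norm_nonneg _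
  have hb0 : 0 ≤ b := norm_nonneg _
  have hd' : ∑ j, hE volume s (fun x => (u j).1 x - (w j).1 x) ≤ ENNReal.ofReal (C₂ * d ^ 2) := by
    have := hC₂ (fun j => u j - w j)
    simp only [map_sub] at this
    exact this
  have h1 : ENNReal.ofReal (‖e (nemTest hf u) - e (nemTest hf w)‖ ^ 2) ≤
      ENNReal.ofReal (C₁ * (1 + C₂ * a ^ 2 + C₂ * b ^ 2) ^ s * (C₂ * d ^ 2)) := by
    rw [ENNReal.ofReal_pow (norm_nonneg _), ofReal_norm, ← map_sub]
    refine (he.enorm_sq_le _).trans ((hC₁ (fun j => (u j).2) (fun j => (w j).2) hu hw).trans ?_)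
    rw [ENNReal.ofReal_mul (by positivity), ENNReal.ofReal_mul (by positivity),
      ENNReal.ofReal_pow (by positivity), ENNReal.ofReal_add (by positivity) (by positivity),
      ENNReal.ofReal_add (by positivity) (by positivity), ENNReal.ofReal_coe_nnreal,
      ENNReal.ofReal_one]
    gcongr
    · exact hC₂ u
    · exact hC₂ w
  have h2 := (ENNReal.ofReal_le_ofReal_iff (by positivity)).1 h1
  rw [← pow_le_pow_iff_left₀ (norm_nonneg _) (by positivity) two_ne_zero]
  refine h2.trans ?_
  rw [mul_pow, mul_pow, Real.sq_sqrt (by positivity), ← pow_mul, mul_comm s 2, pow_mul]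
  -- The estimates so far concern squares of norms. This comparison makes the square root a multiple
  -- of (1 + a + b)^s, which fixes the degree of the final polynomial.
  have h3 : 1 + C₂ * a ^ 2 + C₂ * b ^ 2 ≤ (C₂ + 1) * (1 + a + b) ^ 2 := by
    have hC : (0 : ℝ) ≤ C₂ := C₂.2
    nlinarith [mul_nonneg ha0 hb0, mul_nonneg hC ha0, mul_nonneg hC hb0,
      mul_nonneg hC (mul_nonneg ha0 hb0), sq_nonneg a, sq_nonneg b]
  calc C₁ * (1 + C₂ * a ^ 2 + C₂ * b ^ 2) ^ s * (C₂ * d ^ 2)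
      ≤ C₁ * ((C₂ + 1) * (1 + a + b) ^ 2) ^ s * (C₂ * d ^ 2) := by gcongr
    _ = _ := by rw [mul_pow]; ring

theorem norm_nemTest_taylor_le [DecidableEq ι] (he : IsSobolev s e) (hn : 1 ≤ n) (hs : 2 * n + 4 ≤ s)
    {f : Space n × (ι → ℝ) → ℝ} (hf : IsSymbol f) (R : ℝ) :
    ∃ C : ℝ, 0 ≤ C ∧ ∀ u w : ι → testFn n, ‖fun j => e (u j)‖ ≤ R →
      ‖fun j => e (w j)‖ ≤ R →
      ‖e (nemTest hf u) - e (nemTest hf w) -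
        ∑ j, mulTest e (nemTest (hf.vert j) w) (u j - w j)‖ ≤
        C * ‖(fun j => e (u j)) - fun j => e (w j)‖ ^ 2 := by
  obtain ⟨C₀, hC₀, h₀⟩ := abs_le_norm_toSob he hn (by omega)
  -- Norm at most R forces supremum at most C₀ R by the Sobolev bound, so no separate pointwise
  -- assumption is needed.
  obtain ⟨C₁, hC₁⟩ := hE_nem_taylor_le hn hs hf (C₀ * R)
  obtain ⟨C₂, hC₂⟩ := sum_hE_le he ι
  refine ⟨Real.sqrt (C₁ * (1 + C₂ * R ^ 2 + C₂ * R ^ 2) ^ s * C₂ ^ 2), Real.sqrt_nonneg _,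
    fun u w hu hw => ?_⟩
  have hb : ∀ u : ι → testFn n, ‖fun j => e (u j)‖ ≤ R → ∀ j x, |(u j).1 x| ≤ C₀ * R :=
    fun u hu j x => (h₀ (u j) x).trans (mul_le_mul_of_nonneg_left
      ((norm_le_pi_norm (fun j => e (u j)) j).trans hu) hC₀)
  have hs' : ∀ u : ι → testFn n, ‖fun j => e (u j)‖ ≤ R →
      ∑ j, hE volume s (u j : Space n → ℝ) ≤ ENNReal.ofReal (C₂ * R ^ 2) := fun u hu =>
    (hC₂ u).trans (ENNReal.ofReal_le_ofReal (by gcongr))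
  set d := ‖(fun j => e (u j)) - fun j => e (w j)‖ with hd
  have hd' : ∑ j, hE volume s (fun x => (u j).1 x - (w j).1 x) ≤ ENNReal.ofReal (C₂ * d ^ 2) := by
    have := hC₂ (fun j => u j - w j)
    simp only [map_sub] at this
    exact this
  have heq : e (nemTest hf u) - e (nemTest hf w) -
        ∑ j, mulTest e (nemTest (hf.vert j) w) (u j - w j) =
      e ⟨fun x => nem f (fun j => u j) x - nem f (fun j => w j) x -
        ∑ j, nem (vert j f) (fun j => w j) x * ((u j).1 x - (w j).1 x),
        ((nemTest hf u).2.sub (nemTest hf w).2).sub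
          (IsTest.sum _ fun j => (nemTest (hf.vert j) w).2.mul ((u j).2.sub (w j).2))⟩ := by
    simp only [mulTest, LinearMap.comp_apply, ← map_sub, ← map_sum]
    congr 1
    refine Subtype.ext (funext fun x => ?_)
    simp [nemTest, Finset.sum_apply]
  have h1 : ENNReal.ofReal (‖e (nemTest hf u) - e (nemTest hf w) -
        ∑ j, mulTest e (nemTest (hf.vert j) w) (u j - w j)‖ ^ 2) ≤
      ENNReal.ofReal (C₁ * (1 + C₂ * R ^ 2 + C₂ * R ^ 2) ^ s * (C₂ * d ^ 2) ^ 2) := by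
    rw [ENNReal.ofReal_pow (norm_nonneg _), ofReal_norm, heq]
    refine (he.enorm_sq_le _).trans ((hC₁ (fun j => (u j).2) (fun j => (w j).2) (hb u hu)
      (hb w hw)).trans ?_)
    rw [ENNReal.ofReal_mul (by positivity), ENNReal.ofReal_mul (by positivity),
      ENNReal.ofReal_pow (by positivity), ENNReal.ofReal_pow (by positivity),
      ENNReal.ofReal_add (by positivity) (by positivity),
      ENNReal.ofReal_add (by positivity) (by positivity), ENNReal.ofReal_coe_nnreal,
      ENNReal.ofReal_one]
    gcongr
    · exact hs' u hu
    · exact hs' w hw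
  have h2 := (ENNReal.ofReal_le_ofReal_iff (by positivity)).1 h1
  rw [← pow_le_pow_iff_left₀ (norm_nonneg _) (by positivity) two_ne_zero]
  refine h2.trans_eq ?_
  rw [mul_pow (Real.sqrt _), Real.sq_sqrt (by positivity)]
  ring

theorem denseRange_toSob_pi (he : IsSobolev s e) (ι : Type*) [Fintype ι] :
    DenseRange (fun (u : ι → testFn n) j => e (u j)) :=
  DenseRange.piMap fun _ => he.dense

/-- Superposition extends continuously to the completion. -/
theorem exists_superposition (he : IsSobolev s e) (hn : 1 ≤ n) (hs : 2 * n + 4 ≤ s)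
    {f : Space n × (ι → ℝ) → ℝ} (hf : IsSymbol f) :
    ∃ Ψ : (ι → H) → H, Continuous Ψ ∧
      ∀ u : ι → testFn n, Ψ (fun j => e (u j)) = e (nemTest hf u) := by
  refine exists_continuous_extension (denseRange_toSob_pi he ι) fun R => ?_
  obtain ⟨C₀, hC₀, h₀⟩ := abs_le_norm_toSob he hn (by omega)
  obtain ⟨C₁, hC₁, h₁⟩ := norm_nemTest_sub_le he hn hs hf (C₀ * R)
  refine ⟨C₁ * (1 + R + R) ^ s, fun u w hu hw => ?_⟩
  have hb : ∀ u : ι → testFn n, ‖fun j => e (u j)‖ ≤ R → ∀ j x, |(u j).1 x| ≤ C₀ * R :=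
    fun u hu j x => (h₀ (u j) x).trans (mul_le_mul_of_nonneg_left
      ((norm_le_pi_norm (fun j => e (u j)) j).trans hu) hC₀)
  refine (h₁ u w (hb u hu) (hb w hw)).trans ?_
  gcongr

/-- The superposition operator on Folland-Stein spaces. -/
def superposition (he : IsSobolev s e) (hn : 1 ≤ n) (hs : 2 * n + 4 ≤ s)
    {f : Space n × (ι → ℝ) → ℝ} (hf : IsSymbol f) : (ι → H) → H :=
  (exists_superposition he hn hs hf).choose

theorem continuous_superposition (he : IsSobolev s e) (hn : 1 ≤ n) (hs : 2 * n + 4 ≤ s)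
    {f : Space n × (ι → ℝ) → ℝ} (hf : IsSymbol f) : Continuous (superposition he hn hs hf) :=
  (exists_superposition he hn hs hf).choose_spec.1

theorem superposition_toSob (he : IsSobolev s e) (hn : 1 ≤ n) (hs : 2 * n + 4 ≤ s)
    {f : Space n × (ι → ℝ) → ℝ} (hf : IsSymbol f) (u : ι → testFn n) :
    superposition he hn hs hf (fun j => e (u j)) = e (nemTest hf u) :=
  (exists_superposition he hn hs hf).choose_spec.2 u

/-- The quadratic Taylor estimate, known for test functions, extends to the completion because both
sides are continuous. A remainder of size O(‖v - w‖²) identifies the derivative: superposition with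
∂f/∂v_j followed by multiplication. -/
theorem hasFDerivAt_superposition [DecidableEq ι] (he : IsSobolev s e) (hn : 1 ≤ n) (hs : 2 * n + 4 ≤ s)
    {f : Space n × (ι → ℝ) → ℝ} (hf : IsSymbol f) {m : H →L[ℝ] H →L[ℝ] H}
    (hm : ∀ f g : testFn n, m (e f) (e g) = mulTest e f g) (w : ι → H) :
    HasFDerivAt (superposition he hn hs hf)
      (∑ j, (m (superposition he hn hs (hf.vert j) w)).comp (ContinuousLinearMap.proj j)) w := by
  set T : (ι → H) → (ι → H) →L[ℝ] H := fun w =>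
    ∑ j, (m (superposition he hn hs (hf.vert j) w)).comp (ContinuousLinearMap.proj j) with hT
  have hTc : Continuous T := by
    refine continuous_finsetSum _ fun j _ => ?_
    exact (m.continuous.comp (continuous_superposition he hn hs (hf.vert j))).clm_comp continuous_const
  obtain ⟨C, hC0, hC⟩ := norm_nemTest_taylor_le he hn hs hf (‖w‖ + 1)
  have key : ∀ v v' : ι → H, ‖v‖ < ‖w‖ + 1 → ‖v'‖ < ‖w‖ + 1 →
      ‖superposition he hn hs hf v - superposition he hn hs hf v' - T v' (v - v')‖ ≤ C * ‖v - v'‖ ^ 2 := by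
    -- The estimate holds only on a ball. Adding the closed alternatives outside the open ball gives
    -- a closed condition satisfied on a dense set, hence everywhere.
    have hcl : IsClosed {p : (ι → H) × (ι → H) |
        ‖superposition he hn hs hf p.1 - superposition he hn hs hf p.2 - T p.2 (p.1 - p.2)‖
          ≤ C * ‖p.1 - p.2‖ ^ 2 ∨ ‖w‖ + 1 ≤ ‖p.1‖ ∨ ‖w‖ + 1 ≤ ‖p.2‖} := by
      have hsc := continuous_superposition he hn hs hf
      refine IsClosed.union
        (isClosed_le ?_ (((continuous_fst.sub continuous_snd).norm.pow 2).const_mul C))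
        (IsClosed.union (isClosed_le continuous_const continuous_fst.norm)
          (isClosed_le continuous_const continuous_snd.norm))
      exact (((hsc.comp continuous_fst).sub (hsc.comp continuous_snd)).sub
        ((hTc.comp continuous_snd).clm_apply (continuous_fst.sub continuous_snd))).norm
    have hall := isClosed_property (DenseRange.prodMap (denseRange_toSob_pi he ι)
      (denseRange_toSob_pi he ι)) hcl (fun q => by
        rcases le_or_gt (‖w‖ + 1) ‖fun j => e (q.1 j)‖ with h1 | h1
        · exact Or.inr (Or.inl h1)
        rcases le_or_gt (‖w‖ + 1) ‖fun j => e (q.2 j)‖ with h2 | h2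
        · exact Or.inr (Or.inr h2)
        refine Or.inl ?_
        have := hC q.1 q.2 h1.le h2.le
        simp only [Prod.map_fst, Prod.map_snd]
        rw [superposition_toSob, superposition_toSob]
        convert! this using 3
        simp only [hT, _root_.sum_apply, ContinuousLinearMap.comp_apply,
          ContinuousLinearMap.proj_apply, Pi.sub_apply, superposition_toSob, ← map_sub, hm])
    intro v v' hv hv'
    rcases hall (v, v') with h | h | h
    · exact h
    · exact absurd h (not_le.2 hv)
    · exact absurd h (not_le.2 hv')
  have hO : (fun v => superposition he hn hs hf v - superposition he hn hs hf w - T w (v - w))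
      =O[𝓝 w] fun v => ‖v - w‖ ^ 2 := by
    refine Asymptotics.IsBigO.of_bound C ?_
    have : ∀ᶠ v in 𝓝 w, ‖v‖ < ‖w‖ + 1 :=
      (continuous_norm.tendsto w).eventually (gt_mem_nhds (by linarith))
    filter_upwards [this] with v hv
    rw [norm_pow, norm_norm]
    exact key v w hv (by linarith)
  have h0 := (hO.hasFDerivAt (𝕜 := ℝ) one_lt_two)
  have h1 := (h0.add (((T w).hasFDerivAt (x := w)))).add_const
    (superposition he hn hs hf w - T w w)
  rw [zero_add] at h1
  refine h1.congr_of_eventuallyEq (Eventually.of_forall fun v => ?_)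
  simp only [Pi.add_apply, map_sub]
  abel

/-- Superposition operators on Folland-Stein spaces are smooth. -/
theorem contDiff_superposition (he : IsSobolev s e) (hn : 1 ≤ n) (hs : 2 * n + 4 ≤ s)
    {f : Space n × (ι → ℝ) → ℝ} (hf : IsSymbol f) : ContDiff ℝ ∞ (superposition he hn hs hf) := by
  classical
  obtain ⟨m, hm⟩ := exists_mulSob he hn (by omega)
  refine contDiff_infty.2 fun k => ?_
  induction k generalizing f with
  | zero => exact contDiff_zero.2 (continuous_superposition he hn hs hf)
  | succ k ih =>
    -- The derivative is linear in superpositions with the symbols `vert j f`, and these are C^k by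
    -- the induction hypothesis.
    refine contDiff_succ_iff_hasFDerivAt.2 ⟨_, ?_, fun w => hasFDerivAt_superposition he hn hs hf hm w⟩
    refine ContDiff.sum fun j _ => ?_
    exact (m.contDiff.comp (ih (hf.vert j))).clm_comp contDiff_const

end SobolevSpace

end FollandStein
end

noncomputable section
namespace FollandStein

open scoped ENNReal NNReal Topology
open Set Filter

/-! ### Integration by parts for horizontal vector fields. -/

section IntegrationByParts

variable {n : ℕ}

theorem integral_mul_fderiv_eq_zero {c g : Space n → ℝ} (hc : ContDiff ℝ ∞ c) (hg : IsTest g)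
    (v : Space n) (hv : ∀ x, fderiv ℝ c x v = 0) : ∫ x, c x * fderiv ℝ g x v = 0 := by
  have hg' : Continuous fun x => fderiv ℝ g x v :=
    (hg.1.continuous_fderiv (by simp)).clm_apply continuous_const
  have hs' : HasCompactSupport fun x => fderiv ℝ g x v := hg.2.fderiv_apply ℝ v
  have h := integral_mul_fderiv_eq_neg_fderiv_mul_of_integrable (μ := (volume : Measure (Space n)))
    (f := c) (g := g) (v := v) (by simp [hv])
    ((hc.continuous.mul hg').integrable_of_hasCompactSupport hs'.mul_left)
    ((hc.continuous.mul hg.1.continuous).integrable_of_hasCompactSupport hg.2.mul_left)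
    (fun x _ => hc.differentiable (by simp) x) (fun x _ => hg.1.differentiable (by simp) x)
  rw [h]
  simp [hv]

/-- X_i is divergence free: its coefficient of ∂/∂x^{2n+1} does not depend on x^{2n+1}. -/
theorem integral_horD_eq_zero {g : Space n → ℝ} (hg : IsTest g) (i : Fin (2 * n)) :
    ∫ x, horD i g x = 0 := by
  have h1 : ∀ x, horD i g x = 1 * fderiv ℝ g x (EuclideanSpace.single i.castSucc (1 : ℝ)) +
      frameCoeff i x.ofLp * fderiv ℝ g x (EuclideanSpace.single (Fin.last (2 * n)) (1 : ℝ)) := by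
    intro x
    have := frame_eq i x.ofLp
    rw [WithLp.toLp_ofLp] at this
    rw [horD, this, map_add, map_smul, smul_eq_mul, one_mul]
  have hg' : ∀ v, Continuous fun x => fderiv ℝ g x v := fun v =>
    (hg.1.continuous_fderiv (by simp)).clm_apply continuous_const
  have hs' : ∀ v, HasCompactSupport fun x => fderiv ℝ g x v := fun v => hg.2.fderiv_apply ℝ v
  have hc : ContDiff ℝ ∞ (fun x : Space n => frameCoeff i x.ofLp) ∧ ∀ x : Space n,
      fderiv ℝ (fun x : Space n => frameCoeff i x.ofLp) x
        (EuclideanSpace.single (Fin.last (2 * n)) (1 : ℝ)) = 0 := by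
    unfold frameCoeff
    split_ifs with h
    · set L := (EuclideanSpace.proj (𝕜 := ℝ) (idxY ⟨i.val, h⟩) : Space n →L[ℝ] ℝ)
      refine ⟨L.contDiff, fun x => ?_⟩
      rw [show (fun x : Space n => x.ofLp (idxY ⟨i.val, h⟩)) = L from rfl, L.fderiv]
      have h1 : (idxY ⟨i.val, h⟩ : Fin (2 * n + 1)) ≠ Fin.last (2 * n) := by
        simp only [idxY, ne_eq, Fin.ext_iff, Fin.val_last]; omega
      simp [L, h1]
    · exact ⟨contDiff_const, fun x => by simp⟩
  simp only [h1]
  rw [integral_add, integral_mul_fderiv_eq_zero contDiff_const hg _ (by simp),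
    integral_mul_fderiv_eq_zero hc.1 hg _ hc.2, add_zero]
  · exact (continuous_const.mul (hg' _)).integrable_of_hasCompactSupport (hs' _).mul_left
  · exact (hc.1.continuous.mul (hg' _)).integrable_of_hasCompactSupport (hs' _).mul_left

theorem IsTest.mul_of_contDiffOn {U : Set (Space n)} (hU : IsOpen U) {f : Space n → ℝ}
    (hf : ContDiffOn ℝ ∞ f U) {ψ : Space n → ℝ} (hψ : IsTest ψ) (hψU : tsupport ψ ⊆ U) :
    IsTest (fun x => ψ x * f x) := by
  refine ⟨contDiff_iff_contDiffAt.2 fun x => ?_, hψ.2.mul_right⟩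
  by_cases hx : x ∈ tsupport ψ
  · exact hψ.1.contDiffAt.mul (hf.contDiffAt (hU.mem_nhds (hψU hx)))
  · have : (fun x => ψ x * f x) =ᶠ[𝓝 x] fun _ => 0 := by
      filter_upwards [(isClosed_tsupport ψ).isOpen_compl.mem_nhds hx] with y hy
      rw [image_eq_zero_of_notMem_tsupport hy, zero_mul]
    exact contDiffAt_const.congr_of_eventuallyEq this

/-- The formal adjoint of X_i is -X_i. Nothing is assumed of f outside U, since ψ f is a test
function anyway. -/
theorem integral_horD_mul {U : Set (Space n)} (hU : IsOpen U) {f : Space n → ℝ}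
    (hf : ContDiffOn ℝ ∞ f U) {ψ : Space n → ℝ} (hψ : IsTest ψ) (hψU : tsupport ψ ⊆ U)
    (i : Fin (2 * n)) :
    ∫ x, ψ x * horD i f x = ∫ x, (-1) * horD i ψ x * f x := by
  have h0 := integral_horD_eq_zero (hψ.mul_of_contDiffOn hU hf hψU) i
  have h1 : ∀ x, horD i (fun x => ψ x * f x) x = ψ x * horD i f x - (-1) * horD i ψ x * f x := by
    intro x
    by_cases hx : x ∈ tsupport ψ
    · rw [horD_mul_apply (hψ.differentiableAt x) (hf.differentiableAt_of_isOpen hU (hψU hx))]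
      ring
    · have h2 : horD i ψ x = 0 :=
        image_eq_zero_of_notMem_tsupport fun h => hx (support_horD_subset ψ i h)
      have h3 : horD i (fun x => ψ x * f x) x = 0 := by
        refine image_eq_zero_of_notMem_tsupport fun h => hx ?_
        exact tsupport_mul_subset_left (support_horD_subset _ i h)
      rw [h2, h3, image_eq_zero_of_notMem_tsupport hx]; ring
  simp only [h1] at h0
  rw [integral_sub] at h0
  · linarith
  · have := (hψ.mul_of_contDiffOn hU (contDiffOn_horD hU hf i) hψU)
    exact this.1.continuous.integrable_of_hasCompactSupport this.2
  · have := (((hψ.horD i).const_mul (-1)).mul_of_contDiffOn hU hf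
      ((tsupport_mul_subset_right).trans ((support_horD_subset ψ i).trans hψU)))
    exact this.1.continuous.integrable_of_hasCompactSupport this.2

/-- Iterated horizontal derivatives can be moved to the test function. -/
theorem exists_integral_horDL_mul {U : Set (Space n)} (hU : IsOpen U) (I : List (Fin (2 * n)))
    {ψ : Space n → ℝ} (hψ : IsTest ψ) (hψU : tsupport ψ ⊆ U) :
    ∃ ψ' : Space n → ℝ, IsTest ψ' ∧ tsupport ψ' ⊆ U ∧ ∀ f : Space n → ℝ, ContDiffOn ℝ ∞ f U →
      ∫ x, ψ x * horDL I f x = ∫ x, ψ' x * f x := by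
  induction I generalizing ψ with
  | nil => exact ⟨ψ, hψ, hψU, fun f _ => rfl⟩
  | cons i I ih =>
    obtain ⟨ψ', h1, h2, h3⟩ := ih ((hψ.horD i).const_mul (-1))
      ((tsupport_mul_subset_right).trans ((support_horD_subset ψ i).trans hψU))
    refine ⟨ψ', h1, h2, fun f hf => ?_⟩
    rw [← h3 f hf, ← integral_horD_mul hU (contDiffOn_horDL hU hf I) hψ hψU i]
    rfl

end IntegrationByParts

/-! ### Horizontal derivatives under maps preserving the contact form. -/

section CoordinateChange

variable {n : ℕ} {W : Type*} [NormedAddCommGroup W] [NormedSpace ℝ W]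

theorem stdForm_apply (x v : Space n) :
    stdForm n x v = v (Fin.last (2 * n)) - ∑ j : Fin n, x (idxY j) * v (idxX j) := by
  simp [stdForm, _root_.sum_apply]

theorem frame_last (i : Fin (2 * n)) (x : Space n) :
    frame n i x (Fin.last (2 * n)) = frameCoeff i x.ofLp := by
  have := frame_eq i x.ofLp
  rw [WithLp.toLp_ofLp] at this
  rw [this]
  simp [(Fin.castSucc_ne_last i).symm]

theorem frame_castSucc_apply (i k : Fin (2 * n)) (x : Space n) :
    frame n i x k.castSucc = if k = i then 1 else 0 := by
  have := frame_eq i x.ofLp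
  rw [WithLp.toLp_ofLp] at this
  rw [this]
  simp [Fin.castSucc_ne_last, Fin.castSucc_inj]

/-- Splitting off the first half of the horizontal indices. -/
theorem sum_frameCoeff_mul (x : Space n) (v : Fin (2 * n) → ℝ) :
    ∑ i, frameCoeff i x.ofLp * v i = ∑ j : Fin n, x (idxY j) * v ⟨j.val, by omega⟩ := by
  have h1 : ∀ i : Fin (2 * n), frameCoeff i x.ofLp * v i =
      if i.val < n then frameCoeff i x.ofLp * v i else 0 := by
    intro i
    unfold frameCoeff
    split_ifs <;> simp
  rw [Finset.sum_congr rfl fun i _ => h1 i, ← Finset.sum_filter]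
  symm
  refine Finset.sum_bij (fun (j : Fin n) _ => (⟨j.val, by omega⟩ : Fin (2 * n))) ?_ ?_ ?_ ?_
  · intro j _; simp
  · intro j _ j' _ h; simpa [Fin.ext_iff] using h
  · intro i hi
    exact ⟨⟨i.val, (Finset.mem_filter.1 hi).2⟩, Finset.mem_univ _, rfl⟩
  · intro j _
    simp [frameCoeff]

theorem stdForm_frame (i : Fin (2 * n)) (x : Space n) : stdForm n x (frame n i x) = 0 := by
  have h := sum_frameCoeff_mul x (fun k => frame n i x k.castSucc)
  rw [stdForm_apply, frame_last, sub_eq_zero]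
  refine Eq.trans ?_ h
  simp [frame_castSucc_apply]

theorem eq_sum_frame {x v : Space n} (hv : stdForm n x v = 0) :
    v = ∑ i, v i.castSucc • frame n i x := by
  have h := sum_frameCoeff_mul x (fun k => v k.castSucc)
  rw [stdForm_apply, sub_eq_zero] at hv
  ext l
  have e : (∑ i, v i.castSucc • frame n i x) l = ∑ i : Fin (2 * n), v i.castSucc * frame n i x l := by
    simp [Finset.sum_apply]
  rw [e]
  refine Fin.lastCases ?_ (fun k => ?_) l
  · rw [hv]
    refine h.symm.trans (Finset.sum_congr rfl fun i _ => ?_)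
    rw [frame_last, mul_comm]
  · simp [frame_castSucc_apply]

/-- The differential of ψ maps the kernel of η₀ into the kernel of η₀, which the X_j span
(`eq_sum_frame`). So no vertical derivative of u appears and the horizontal order is not increased.
-/
theorem horD_comp {U V : Set (Space n)} (hU : IsOpen U) (hV : IsOpen V) {ψ : Space n → Space n}
    (hψ : ContDiffOn ℝ ∞ ψ U) (hUV : MapsTo ψ U V)
    (hc : ∀ y ∈ U, (stdForm n (ψ y)).comp (fderiv ℝ ψ y) = stdForm n y) {u : Space n → W}
    (hu : ContDiffOn ℝ ∞ u V) (i : Fin (2 * n)) {y : Space n} (hy : y ∈ U) :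
    horD i (fun y => u (ψ y)) y =
      ∑ j, (fderiv ℝ ψ y (frame n i y)) (Fin.castSucc j) • horD j u (ψ y) := by
  have h1 : HasFDerivAt (fun y => u (ψ y)) ((fderiv ℝ u (ψ y)).comp (fderiv ℝ ψ y)) y :=
    (hu.differentiableAt_of_isOpen hV (hUV hy)).hasFDerivAt.comp y
      (hψ.differentiableAt_of_isOpen hU hy).hasFDerivAt
  have h2 : stdForm n (ψ y) (fderiv ℝ ψ y (frame n i y)) = 0 := by
    rw [← ContinuousLinearMap.comp_apply, hc y hy, stdForm_frame]
  simp only [horD, h1.fderiv, ContinuousLinearMap.comp_apply]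
  conv_lhs => rw [eq_sum_frame h2]
  rw [map_sum]
  simp only [map_smul]

/-- Horizontal derivatives of a composition with a contact map. -/
theorem exists_hsq_smul_comp_le {U V : Set (Space n)} (hU : IsOpen U) (hV : IsOpen V)
    {ψ : Space n → Space n} (hψ : ContDiffOn ℝ ∞ ψ U) (hUV : MapsTo ψ U V)
    (hc : ∀ y ∈ U, (stdForm n (ψ y)).comp (fderiv ℝ ψ y) = stdForm n y)
    {K : Set (Space n)} (hK : IsCompact K) (hKU : K ⊆ U) (k : ℕ) {c : Space n → ℝ}
    (hcs : ContDiffOn ℝ ∞ c U) :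
    ∃ C : ℝ≥0, ∀ u : Space n → W, ContDiffOn ℝ ∞ u V → ∀ y ∈ K,
      hsq k (fun y => c y • u (ψ y)) y ≤ C * hsq k u (ψ y) := by
  have base : ∀ {c : Space n → ℝ}, ContDiffOn ℝ ∞ c U → ∃ C : ℝ≥0, ∀ u : Space n → W, ∀ y ∈ K,
      ‖c y • u (ψ y)‖ₑ ^ 2 ≤ C * ‖u (ψ y)‖ₑ ^ 2 := by
    intro c hcs
    obtain ⟨B, hB⟩ := hK.exists_bound_of_continuousOn (hcs.continuousOn.mono hKU)
    refine ⟨B.toNNReal ^ 2, fun u y hy => ?_⟩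
    rw [enorm_smul, mul_pow]
    push_cast
    gcongr
    rw [← ofReal_norm]
    exact ENNReal.ofReal_le_ofReal (hB y hy)
  -- Each differentiation produces new coefficients: X_i c and c times an entry of the differential
  -- of ψ. Hence the induction must run over all smooth c.
  induction k generalizing c with
  | zero =>
    obtain ⟨C, hC⟩ := base hcs
    exact ⟨C, fun u _ y hy => hC u y hy⟩
  | succ k ih =>
    obtain ⟨C₀, hC₀⟩ := base hcs
    choose C₁ hC₁ using fun i : Fin (2 * n) => ih (contDiffOn_horD hU hcs i)
    set m : Fin (2 * n) → Fin (2 * n) → Space n → ℝ := fun i j y =>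
      (fderiv ℝ ψ y (frame n i y)) (Fin.castSucc j) with hm
    have hms : ∀ i j, ContDiffOn ℝ ∞ (m i j) U := by
      intro i j
      have h1 : ContDiffOn ℝ ∞ (fun y => fderiv ℝ ψ y (frame n i y)) U :=
        (hψ.fderiv_of_isOpen hU (m := ∞) (by simp)).clm_apply (contDiff_frame i).contDiffOn
      exact (EuclideanSpace.proj (𝕜 := ℝ) (Fin.castSucc j) : Space n →L[ℝ] ℝ).contDiff.comp_contDiffOn h1
    choose C₂ hC₂ using fun i j : Fin (2 * n) => ih (hcs.mul (hms i j))
    refine ⟨C₀ + ∑ i, 2 * (C₁ i + 2 ^ (2 * n) * ∑ j, C₂ i j), fun u hu y hy => ?_⟩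
    have hcomp : ∀ {u : Space n → W}, ContDiffOn ℝ ∞ u V → ContDiffOn ℝ ∞ (fun y => u (ψ y)) U :=
      fun hu => hu.comp hψ hUV
    set A := hsq (k + 1) u (ψ y) with hA
    have h1 : ∀ i, hsq k (horD i fun y => c y • u (ψ y)) y ≤
        2 * (C₁ i + 2 ^ (2 * n) * ∑ j, C₂ i j) * A := by
      intro i
      have e : EqOn (horD i fun y => c y • u (ψ y)) (fun y => horD i c y • u (ψ y) +
          ∑ j, (c y * m i j y) • horD j u (ψ y)) U := by
        intro z hz
        rw [horD_smul_apply (hcs.differentiableAt_of_isOpen hU hz)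
          ((hcomp hu).differentiableAt_of_isOpen hU hz),
          horD_comp hU hV hψ hUV hc hu i hz, Finset.smul_sum]
        simp only [smul_smul, hm]
      rw [hsq_congr hU e k (hKU hy)]
      have t1 : ContDiffOn ℝ ∞ (fun y => horD i c y • u (ψ y)) U :=
        (contDiffOn_horD hU hcs i).smul (hcomp hu)
      have t2 : ∀ j ∈ Finset.univ, ContDiffOn ℝ ∞ (fun y => (c y * m i j y) • horD j u (ψ y)) U :=
        fun j _ => (hcs.mul (hms i j)).smul (hcomp (contDiffOn_horD hV hu j))
      refine (hsq_add_le hU t1 (ContDiffOn.sum t2) k (hKU hy)).trans ?_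
      calc _ ≤ 2 * (C₁ i * A + 2 ^ (2 * n) * ∑ j, C₂ i j * A) := by
            gcongr
            · refine (hC₁ i u hu y hy).trans ?_
              gcongr
              exact hsq_mono (Nat.le_succ k) u _
            · refine (hsq_sum_le _ hU t2 k (hKU hy)).trans ?_
              rw [Finset.card_univ, Fintype.card_fin]
              gcongr with j
              refine (hC₂ i j (horD j u) (contDiffOn_horD hV hu j) y hy).trans ?_
              gcongr
              exact hsq_horD_le k u j _
        _ = _ := by rw [← Finset.sum_mul]; push_cast; ring
    calc hsq (k + 1) (fun y => c y • u (ψ y)) y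
        ≤ C₀ * A + ∑ i, 2 * (C₁ i + 2 ^ (2 * n) * ∑ j, C₂ i j) * A := by
          refine add_le_add ((hC₀ u y hy).trans ?_) (Finset.sum_le_sum fun i _ => ?_)
          · gcongr; exact enorm_sq_le_hsq _ u _
          · exact_mod_cast h1 i
      _ = _ := by
          rw [← Finset.sum_mul]
          push_cast; ring

/-- Multiplication by a smooth function is bounded on compact sets. -/
theorem exists_hsq_smul_le {U : Set (Space n)} (hU : IsOpen U) {K : Set (Space n)}
    (hK : IsCompact K) (hKU : K ⊆ U) (k : ℕ) {c : Space n → ℝ} (hcs : ContDiffOn ℝ ∞ c U) :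
    ∃ C : ℝ≥0, ∀ u : Space n → W, ContDiffOn ℝ ∞ u U → ∀ y ∈ K,
      hsq k (fun y => c y • u y) y ≤ C * hsq k u y :=
  exists_hsq_smul_comp_le hU hU (ψ := fun y => y) contDiffOn_id (mapsTo_id U)
    (fun y _ => by rw [fderiv_fun_id]; exact ContinuousLinearMap.comp_id _) hK hKU k hcs

/-- The pointwise bound combined with a change of variables; the inverse of the Jacobian determinant
is bounded on the compact set K. -/
theorem exists_lintegral_hsq_comp_le {U V : Set (Space n)} (hU : IsOpen U) (hV : IsOpen V)
    {ψ : Space n → Space n} (hψ : ContDiffOn ℝ ∞ ψ U) (hUV : MapsTo ψ U V)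
    (hc : ∀ y ∈ U, (stdForm n (ψ y)).comp (fderiv ℝ ψ y) = stdForm n y)
    (hinj : InjOn ψ U) (hdet : ∀ y ∈ U, (fderiv ℝ ψ y).det ≠ 0)
    {K : Set (Space n)} (hK : IsCompact K) (hKU : K ⊆ U) (k : ℕ) :
    ∃ C : ℝ≥0, ∀ u : Space n → W, ContDiffOn ℝ ∞ u V →
      ∫⁻ y in K, hsq k (fun y => u (ψ y)) y ≤ C * ∫⁻ z in ψ '' K, hsq k u z := by
  obtain ⟨C₁, hC₁⟩ := exists_hsq_smul_comp_le (W := W) hU hV hψ hUV hc hK hKU k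
    (c := fun _ => 1) contDiffOn_const
  have hdc : ContinuousOn (fun y => ((fderiv ℝ ψ y).det)⁻¹) K := by
    refine ContinuousOn.inv₀ ?_ fun y hy => hdet y (hKU hy)
    exact ContinuousLinearMap.continuous_det.comp_continuousOn
      ((hψ.continuousOn_fderiv_of_isOpen hU (by simp)).mono hKU)
  obtain ⟨B, hB⟩ := hK.exists_bound_of_continuousOn hdc
  refine ⟨C₁ * B.toNNReal, fun u hu => ?_⟩
  have hcv := lintegral_image_eq_lintegral_abs_det_fderiv_mul volume hK.measurableSet
    (fun y hy => (hψ.differentiableAt_of_isOpen hU (hKU hy)).hasFDerivAt.hasFDerivWithinAt)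
    (hinj.mono hKU) (hsq k u)
  rw [hcv, ENNReal.coe_mul, mul_assoc, ← lintegral_const_mul' _ _ (by simp),
    ← lintegral_const_mul' _ _ (by simp)]
  refine setLIntegral_mono' hK.measurableSet fun y hy => ?_
  have h1 := hC₁ u hu y hy
  simp only [one_smul] at h1
  refine h1.trans (mul_le_mul_right ?_ _)
  rw [← mul_assoc]
  refine le_mul_of_one_le_left zero_le ?_
  have h2 : |((fderiv ℝ ψ y).det)⁻¹| ≤ B := hB y hy
  have h3 : 0 < |(fderiv ℝ ψ y).det| := abs_pos.2 (hdet y (hKU hy))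
  change (1 : ℝ≥0∞) ≤ ENNReal.ofReal B * _
  rw [← ENNReal.ofReal_mul ((abs_nonneg _).trans h2), ← ENNReal.ofReal_one]
  apply ENNReal.ofReal_le_ofReal
  rw [abs_inv] at h2
  calc (1 : ℝ) = |(fderiv ℝ ψ y).det|⁻¹ * |(fderiv ℝ ψ y).det| := (inv_mul_cancel₀ h3.ne').symm
    _ ≤ _ := by gcongr

end CoordinateChange

end FollandStein
end

noncomputable section
namespace FollandStein

open scoped ENNReal NNReal Topology
open Set Filter

/-! ### Comparison of adapted charts. -/

section Charts

variable {n : ℕ} {M : Type*} [TopologicalSpace M] [ChartedSpace (Space n) M]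
  {η : ContactForm n M} (A : AdaptedAtlas η)
  {W : Type*} [NormedAddCommGroup W] [NormedSpace ℝ W]

/-- The coordinate change from the chart `a` to the chart `b`. -/
def AdaptedAtlas.trans (a b : Fin A.card) (y : Space n) : Space n :=
  A.chart b ((A.chart a).symm y)

/-- The domain of the coordinate change. -/
def AdaptedAtlas.transDom (a b : Fin A.card) : Set (Space n) :=
  (A.chart a).target ∩ (A.chart a).symm ⁻¹' (A.chart b).source

theorem AdaptedAtlas.isOpen_transDom (a b : Fin A.card) : IsOpen (A.transDom a b) :=
  (A.chart a).isOpen_inter_preimage_symm (A.chart b).open_source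

theorem AdaptedAtlas.mapsTo_trans (a b : Fin A.card) :
    MapsTo (A.trans a b) (A.transDom a b) (A.chart b).target :=
  fun _ hy => (A.chart b).map_source hy.2

theorem AdaptedAtlas.mapsTo_trans' (a b : Fin A.card) :
    MapsTo (A.trans a b) (A.transDom a b) (A.transDom b a) := fun y hy => by
  refine ⟨(A.chart b).map_source hy.2, ?_⟩
  change (A.chart b).symm (A.chart b ((A.chart a).symm y)) ∈ (A.chart a).source
  rw [(A.chart b).left_inv hy.2]
  exact (A.chart a).map_target hy.1

theorem AdaptedAtlas.trans_trans (a b : Fin A.card) {y : Space n} (hy : y ∈ A.transDom a b) :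
    A.trans b a (A.trans a b y) = y := by
  unfold AdaptedAtlas.trans
  rw [(A.chart b).left_inv hy.2, (A.chart a).right_inv hy.1]

theorem AdaptedAtlas.injOn_trans (a b : Fin A.card) : InjOn (A.trans a b) (A.transDom a b) := by
  intro y hy y' hy' h
  rw [← A.trans_trans a b hy, ← A.trans_trans a b hy', h]

theorem AdaptedAtlas.chart_symm_trans (a b : Fin A.card) {y : Space n}
    (hy : y ∈ A.transDom a b) : (A.chart b).symm (A.trans a b y) = (A.chart a).symm y :=
  (A.chart b).left_inv hy.2

theorem contMDiffOn_chart [IsManifold (𝓡 (2 * n + 1)) ∞ M] (a : Fin A.card) :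
    ContMDiffOn (𝓡 (2 * n + 1)) (𝓡 (2 * n + 1)) ∞ (A.chart a) (A.chart a).source :=
  contMDiffOn_of_mem_maximalAtlas (A.mem_maximalAtlas a)

theorem contMDiffOn_chart_symm [IsManifold (𝓡 (2 * n + 1)) ∞ M] (a : Fin A.card) :
    ContMDiffOn (𝓡 (2 * n + 1)) (𝓡 (2 * n + 1)) ∞ (A.chart a).symm (A.chart a).target :=
  contMDiffOn_symm_of_mem_maximalAtlas (A.mem_maximalAtlas a)

theorem contDiffOn_trans [IsManifold (𝓡 (2 * n + 1)) ∞ M] (a b : Fin A.card) :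
    ContDiffOn ℝ ∞ (A.trans a b) (A.transDom a b) := by
  rw [← contMDiffOn_iff_contDiffOn]
  exact (contMDiffOn_chart A b).comp ((contMDiffOn_chart_symm A a).mono inter_subset_left)
    fun y hy => hy.2

theorem contDiffOn_comp_chart_symm [IsManifold (𝓡 (2 * n + 1)) ∞ M] {G : M → W}
    (hG : ContMDiff (𝓡 (2 * n + 1)) 𝓘(ℝ, W) ∞ G) (a : Fin A.card) :
    ContDiffOn ℝ ∞ (fun y => G ((A.chart a).symm y)) (A.chart a).target := by
  rw [← contMDiffOn_iff_contDiffOn]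
  exact hG.comp_contMDiffOn (contMDiffOn_chart_symm A a)

/-- Both charts pull η₀ back to the same form η on M. -/
theorem trans_contact [IsManifold (𝓡 (2 * n + 1)) ∞ M] (a b : Fin A.card) {y : Space n}
    (hy : y ∈ A.transDom a b) :
    (stdForm n (A.trans a b y)).comp (fderiv ℝ (A.trans a b) y) = stdForm n y := by
  set x := (A.chart a).symm y with hx
  have hxa : x ∈ (A.chart a).source := (A.chart a).map_target hy.1
  have hxb : x ∈ (A.chart b).source := hy.2
  have da : MDifferentiableAt (𝓡 (2 * n + 1)) (𝓡 (2 * n + 1)) (A.chart a) x :=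
    ((contMDiffOn_chart A a).contMDiffAt ((A.chart a).open_source.mem_nhds hxa)).mdifferentiableAt
      (by simp)
  have db : MDifferentiableAt (𝓡 (2 * n + 1)) (𝓡 (2 * n + 1)) (A.chart b) x :=
    ((contMDiffOn_chart A b).contMDiffAt ((A.chart b).open_source.mem_nhds hxb)).mdifferentiableAt
      (by simp)
  have ds : MDifferentiableAt (𝓡 (2 * n + 1)) (𝓡 (2 * n + 1)) (A.chart a).symm y :=
    ((contMDiffOn_chart_symm A a).contMDiffAt
      ((A.chart a).open_target.mem_nhds hy.1)).mdifferentiableAt (by simp)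
  have e1 : mfderiv (𝓡 (2 * n + 1)) (𝓡 (2 * n + 1)) (A.trans a b) y =
      (mfderiv (𝓡 (2 * n + 1)) (𝓡 (2 * n + 1)) (A.chart b) x).comp
        (mfderiv (𝓡 (2 * n + 1)) (𝓡 (2 * n + 1)) (A.chart a).symm y) := mfderiv_comp y db ds
  have e2 : (mfderiv (𝓡 (2 * n + 1)) (𝓡 (2 * n + 1)) (A.chart a) x).comp
      (mfderiv (𝓡 (2 * n + 1)) (𝓡 (2 * n + 1)) (A.chart a).symm y) =
        ContinuousLinearMap.id ℝ (Space n) := by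
    have h1 : mfderiv (𝓡 (2 * n + 1)) (𝓡 (2 * n + 1)) (A.chart a ∘ (A.chart a).symm) y = _ :=
      mfderiv_comp y da ds
    rw [← h1]
    have h2 : (A.chart a ∘ (A.chart a).symm) =ᶠ[𝓝 y] id := by
      filter_upwards [(A.chart a).open_target.mem_nhds hy.1] with z hz
      exact (A.chart a).right_inv hz
    rw [h2.mfderiv_eq]
    exact mfderiv_id
  have e3 : fderiv ℝ (A.trans a b) y = mfderiv (𝓡 (2 * n + 1)) (𝓡 (2 * n + 1)) (A.trans a b) y :=
    mfderiv_eq_fderiv.symm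
  have ha := A.adapted a x hxa
  have hb := A.adapted b x hxb
  have hax : A.chart a x = y := (A.chart a).right_inv hy.1
  ext v
  have f1 : fderiv ℝ (A.trans a b) y v =
      mfderiv (𝓡 (2 * n + 1)) (𝓡 (2 * n + 1)) (A.chart b) x
        (mfderiv (𝓡 (2 * n + 1)) (𝓡 (2 * n + 1)) (A.chart a).symm y v) := by
    rw [e3, e1]; rfl
  have f2 : mfderiv (𝓡 (2 * n + 1)) (𝓡 (2 * n + 1)) (A.chart a) x
        (mfderiv (𝓡 (2 * n + 1)) (𝓡 (2 * n + 1)) (A.chart a).symm y v) = v :=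
    DFunLike.congr_fun e2 v
  set v' := mfderiv (𝓡 (2 * n + 1)) (𝓡 (2 * n + 1)) (A.chart a).symm y v
  have g1 : η.toFun x v' = stdForm n (A.chart a x)
      (mfderiv (𝓡 (2 * n + 1)) (𝓡 (2 * n + 1)) (A.chart a) x v') := DFunLike.congr_fun ha v'
  have g2 : η.toFun x v' = stdForm n (A.chart b x)
      (mfderiv (𝓡 (2 * n + 1)) (𝓡 (2 * n + 1)) (A.chart b) x v') := DFunLike.congr_fun hb v'
  rw [f2, hax] at g1
  rw [ContinuousLinearMap.comp_apply, f1]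
  exact g2.symm.trans g1

theorem trans_det_ne_zero [IsManifold (𝓡 (2 * n + 1)) ∞ M] (a b : Fin A.card) {y : Space n}
    (hy : y ∈ A.transDom a b) : (fderiv ℝ (A.trans a b) y).det ≠ 0 := by
  have h1 := (contDiffOn_trans A a b).differentiableAt_of_isOpen (A.isOpen_transDom a b) hy
  have h2 := (contDiffOn_trans A b a).differentiableAt_of_isOpen (A.isOpen_transDom b a)
    (A.mapsTo_trans' a b hy)
  have h3 : (A.trans b a ∘ A.trans a b) =ᶠ[𝓝 y] id := by
    filter_upwards [(A.isOpen_transDom a b).mem_nhds hy] with z hz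
    exact A.trans_trans a b hz
  have h4 : (fderiv ℝ (A.trans b a) (A.trans a b y)).comp (fderiv ℝ (A.trans a b) y) =
      ContinuousLinearMap.id ℝ (Space n) := by
    rw [← fderiv_comp y h2 h1, h3.fderiv_eq, fderiv_id]
  intro h0
  have h5 : ((fderiv ℝ (A.trans b a) (A.trans a b y)).comp (fderiv ℝ (A.trans a b) y)).det = 1 := by
    rw [h4]; exact LinearMap.det_id
  have h6 : ((fderiv ℝ (A.trans b a) (A.trans a b y)).comp (fderiv ℝ (A.trans a b) y)).det =
      (fderiv ℝ (A.trans b a) (A.trans a b y)).det * (fderiv ℝ (A.trans a b) y).det :=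
    LinearMap.det_comp _ _
  rw [h6, h0, mul_zero] at h5
  exact zero_ne_one h5

variable (W) in
/-- The Folland-Stein norm over all `D_b` controls the derivatives over every compact subset of
every chart. -/
theorem exists_lintegral_hsq_chart_le [IsManifold (𝓡 (2 * n + 1)) ∞ M] (s : ℕ) (a : Fin A.card)
    {K : Set (Space n)} (hK : IsCompact K) (hKa : K ⊆ (A.chart a).target) :
    ∃ C : ℝ≥0, ∀ G : M → W, ContMDiff (𝓡 (2 * n + 1)) 𝓘(ℝ, W) ∞ G →
      ∫⁻ y in K, hsq s (fun y => G ((A.chart a).symm y)) y ≤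
        C * ∑ b, ∫⁻ z in A.dom b, hsq s (fun z => G ((A.chart b).symm z)) z := by
  refine hK.induction_on (p := fun K => ∃ C : ℝ≥0, ∀ G : M → W,
      ContMDiff (𝓡 (2 * n + 1)) 𝓘(ℝ, W) ∞ G →
      ∫⁻ y in K, hsq s (fun y => G ((A.chart a).symm y)) y ≤
        C * ∑ b, ∫⁻ z in A.dom b, hsq s (fun z => G ((A.chart b).symm z)) z) ?_ ?_ ?_ ?_
  · exact ⟨0, fun G _ => by simp⟩
  · rintro S T hST ⟨C, hC⟩
    exact ⟨C, fun G hG => (lintegral_mono_set hST).trans (hC G hG)⟩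
  · rintro S T ⟨C, hC⟩ ⟨C', hC'⟩
    refine ⟨C + C', fun G hG => (lintegral_union_le _ _ _).trans ?_⟩
    push_cast
    rw [add_mul]
    exact add_le_add (hC G hG) (hC' G hG)
  -- Near y the coordinate change to some chart b with φ_b in D_b carries a compact neighbourhood
  -- into D_b; compactness of K then leaves finitely many neighbourhoods.
  · intro y hyK
    obtain ⟨b, hb1, hb2⟩ := A.cover ((A.chart a).symm y)
    have hyU : y ∈ A.transDom a b := ⟨hKa hyK, hb1⟩
    have hU := A.isOpen_transDom a b
    have hU' : IsOpen (A.transDom a b ∩ A.trans a b ⁻¹' A.dom b) :=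
      (contDiffOn_trans A a b).continuousOn.isOpen_inter_preimage hU (A.isOpen_dom b)
    obtain ⟨K', hK', hyK', hK'U⟩ := exists_compact_subset hU' (x := y) ⟨hyU, hb2⟩
    obtain ⟨C, hC⟩ := exists_lintegral_hsq_comp_le (W := W) hU (A.chart b).open_target
      (contDiffOn_trans A a b) (A.mapsTo_trans a b) (fun y hy => trans_contact A a b hy)
      (A.injOn_trans a b) (fun y hy => trans_det_ne_zero A a b hy) hK'
      (hK'U.trans inter_subset_left) s
    refine ⟨K', mem_nhdsWithin_of_mem_nhds (mem_interior_iff_mem_nhds.1 hyK'), C, fun G hG => ?_⟩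
    calc ∫⁻ y in K', hsq s (fun y => G ((A.chart a).symm y)) y
        = ∫⁻ y in K', hsq s (fun y => G ((A.chart b).symm (A.trans a b y))) y := by
          refine setLIntegral_congr_fun hK'.measurableSet fun z hz => ?_
          refine hsq_congr hU (fun w hw => ?_) s (hK'U hz).1
          simp only [A.chart_symm_trans a b hw]
      _ ≤ C * ∫⁻ z in A.trans a b '' K', hsq s (fun z => G ((A.chart b).symm z)) z :=
          hC _ (contDiffOn_comp_chart_symm A hG b)
      _ ≤ C * ∑ b, ∫⁻ z in A.dom b, hsq s (fun z => G ((A.chart b).symm z)) z := by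
          gcongr
          refine le_trans (lintegral_mono_set ?_) (Finset.single_le_sum
            (f := fun b => ∫⁻ z in A.dom b, hsq s (fun z => G ((A.chart b).symm z)) z)
            (fun _ _ => zero_le) (Finset.mem_univ b))
          rintro _ ⟨z, hz, rfl⟩
          exact (hK'U hz).2

end Charts

end FollandStein
end

/-! ### Hilbert space extensions and functions on the chart domains. -/

noncomputable section
namespace FollandStein

open scoped ENNReal NNReal Topology
open Set Filter

/-- The map extends to the closure of the range of j by its bound, and then to all of K through the
orthogonal projection. In this way the later operators live on the whole Hilbert sum `Ambient` and
not on a subspace. -/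
theorem exists_extension_of_range {P K Y : Type*} [AddCommGroup P] [Module ℝ P]
    [NormedAddCommGroup K] [InnerProductSpace ℝ K] [CompleteSpace K]
    [NormedAddCommGroup Y] [NormedSpace ℝ Y] [CompleteSpace Y]
    (j : P →ₗ[ℝ] K) (T : P →ₗ[ℝ] Y) {C : ℝ} (h : ∀ p, ‖T p‖ ≤ C * ‖j p‖) :
    ∃ T' : K →L[ℝ] Y, ∀ p, T' (j p) = T p := by
  set R := (LinearMap.range j).topologicalClosure with hR
  have : CompleteSpace R := (LinearMap.range j).isClosed_topologicalClosure.completeSpace_coe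
  have hj : ∀ p, j p ∈ R := fun p => (LinearMap.range j).le_topologicalClosure ⟨p, rfl⟩
  set j' : P →ₗ[ℝ] R := j.codRestrict R hj with hj'
  have hd : DenseRange j' := by
    rw [DenseRange, dense_iff_closure_eq, Topology.IsInducing.subtypeVal.closure_eq_preimage_closure_image]
    refine eq_univ_of_forall fun x => ?_
    have h1 : (Subtype.val '' range j' : Set K) = (LinearMap.range j : Set K) := by
      ext y; constructor
      · rintro ⟨_, ⟨p, rfl⟩, rfl⟩; exact ⟨p, rfl⟩
      · rintro ⟨p, rfl⟩; exact ⟨j' p, ⟨p, rfl⟩, rfl⟩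
    change (x : K) ∈ closure (Subtype.val '' range j' : Set K)
    exact (congrArg closure h1).symm ▸ x.2
  refine ⟨(T.extendOfNorm j').comp R.orthogonalProjectionOnto, fun p => ?_⟩
  have h2 : R.orthogonalProjectionOnto (j p) = j' p :=
    R.orthogonalProjectionOnto_mem_subspace_eq_self (j' p)
  rw [ContinuousLinearMap.comp_apply, h2]
  exact LinearMap.extendOfNorm_eq hd ⟨C, fun p => h p⟩ p

theorem norm_le_of_enorm_sq_le {X Y : Type*} [NormedAddCommGroup X] [NormedAddCommGroup Y]
    {x : X} {y : Y} {C : ℝ≥0} (h : ‖x‖ₑ ^ 2 ≤ C * ENNReal.ofReal (‖y‖ ^ 2)) :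
    ‖x‖ ≤ Real.sqrt C * ‖y‖ := by
  have h1 : ‖x‖ ^ 2 ≤ C * ‖y‖ ^ 2 := by
    rw [← ofReal_norm, ← ENNReal.ofReal_pow (norm_nonneg _), ← ENNReal.ofReal_coe_nnreal,
      ← ENNReal.ofReal_mul C.coe_nonneg] at h
    exact (ENNReal.ofReal_le_ofReal_iff (by positivity)).1 h
  have := Real.sqrt_le_sqrt h1
  rwa [Real.sqrt_sq (norm_nonneg _), Real.sqrt_mul C.coe_nonneg, Real.sqrt_sq (norm_nonneg _)] at this

section Domain

variable {n : ℕ} {W : Type*} [NormedAddCommGroup W]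

theorem memLp_two_of_continuousOn {D : Set (Space n)} (hD : IsCompact (closure D))
    {f : Space n → W} (hf : ContinuousOn f (closure D)) :
    MemLp f 2 ((volume : Measure (Space n)).restrict D) := by
  refine MemLp.mono_measure (Measure.restrict_mono subset_closure le_rfl) ?_
  have : IsFiniteMeasure ((volume : Measure (Space n)).restrict (closure D)) :=
    ⟨by rw [Measure.restrict_apply_univ]; exact hD.measure_lt_top⟩
  obtain ⟨C, hC⟩ := hD.exists_bound_of_continuousOn hf
  exact MemLp.of_bound (hf.aestronglyMeasurable_of_isCompact hD isClosed_closure.measurableSet) C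
    ((ae_restrict_iff' isClosed_closure.measurableSet).2 (Eventually.of_forall hC))

variable [NormedSpace ℝ W]

theorem horDL_add_eqOn {U : Set (Space n)} (hU : IsOpen U) {f g : Space n → W}
    (hf : ContDiffOn ℝ ∞ f U) (hg : ContDiffOn ℝ ∞ g U) (I : List (Fin (2 * n))) :
    EqOn (horDL I (fun y => f y + g y)) (fun y => horDL I f y + horDL I g y) U := by
  induction I with
  | nil => exact fun _ _ => rfl
  | cons i I ih =>
    intro x hx
    refine (horD_congr hU ih i hx).trans ?_
    exact horD_add_apply ((contDiffOn_horDL hU hf I).differentiableAt_of_isOpen hU hx)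
      ((contDiffOn_horDL hU hg I).differentiableAt_of_isOpen hU hx) i

theorem exists_cutoff {K U : Set (Space n)} (hK : IsCompact K) (hU : IsOpen U) (hKU : K ⊆ U) :
    ∃ χ : Space n → ℝ, IsTest χ ∧ tsupport χ ⊆ U ∧ (∀ x, 0 ≤ χ x) ∧ (∀ x, χ x ≤ 1) ∧
      ∀ x ∈ K, χ x = 1 := by
  obtain ⟨L, hL, hKL, hLU⟩ := exists_compact_between hK hU hKU
  obtain ⟨f, hf, hf01, hfs, hf1⟩ := exists_contMDiff_support_eq_eq_one_iff (n := (⊤ : ℕ∞)) 𝓘(ℝ, Space n)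
    isOpen_interior hK.isClosed hKL
  have hts : tsupport f ⊆ L := by
    rw [tsupport, hfs]
    exact closure_minimal interior_subset hL.isClosed
  refine ⟨f, ⟨hf.contDiff, hL.of_isClosed_subset (isClosed_tsupport _) hts⟩, hts.trans hLU,
    fun x => (hf01 ⟨x, rfl⟩).1, fun x => (hf01 ⟨x, rfl⟩).2, fun x hx => (hf1 x).1 hx⟩

end Domain

/-! ### Jets of smooth functions on M and their localisation by cutoffs. -/

section SmoothFunctions

variable (n : ℕ) (M : Type*) [TopologicalSpace M] [ChartedSpace (Space n) M]

/-- The space of smooth `ℝ^r`-valued functions on `M`. -/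
def smoothFn (r : ℕ) : Submodule ℝ (M → EuclideanSpace ℝ (Fin r)) where
  carrier := {G | ContMDiff (𝓡 (2 * n + 1)) 𝓘(ℝ, EuclideanSpace ℝ (Fin r)) ∞ G}
  add_mem' hf hg := ContMDiff.add hf hg
  zero_mem' := contMDiff_const
  smul_mem' c _ hf := (contDiff_const_smul (n := ∞) c).contMDiff.comp hf

variable {n M} {η : ContactForm n M} (A : AdaptedAtlas η)

theorem AdaptedAtlas.dom_subset (a : Fin A.card) : A.dom a ⊆ (A.chart a).target :=
  subset_closure.trans (A.closure_dom_subset a)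

theorem AdaptedAtlas.ae_dom {a : Fin A.card} {p : Space n → Prop} (h : ∀ y ∈ A.dom a, p y) :
    ∀ᵐ y ∂(volume : Measure (Space n)).restrict (A.dom a), p y :=
  (ae_restrict_iff' (A.isOpen_dom a).measurableSet).2 (Eventually.of_forall h)

theorem AdaptedAtlas.exists_cutoff (a : Fin A.card) : ∃ χ : Space n → ℝ, IsTest χ ∧
    tsupport χ ⊆ (A.chart a).target ∧ (∀ x, 0 ≤ χ x) ∧ (∀ x, χ x ≤ 1) ∧ ∀ x ∈ A.dom a, χ x = 1 := by
  obtain ⟨χ, h1, h2, h3, h4, h5⟩ := FollandStein.exists_cutoff (A.isCompact_closure_dom a)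
    (A.chart a).open_target (A.closure_dom_subset a)
  exact ⟨χ, h1, h2, h3, h4, fun x hx => h5 x (subset_closure hx)⟩

/-- A cutoff function for `D_a` supported in the range of the chart `φ_a`. -/
def AdaptedAtlas.cutoff (a : Fin A.card) : Space n → ℝ := (A.exists_cutoff a).choose

theorem AdaptedAtlas.isTest_cutoff (a : Fin A.card) : IsTest (A.cutoff a) :=
  (A.exists_cutoff a).choose_spec.1

theorem AdaptedAtlas.tsupport_cutoff (a : Fin A.card) :
    tsupport (A.cutoff a) ⊆ (A.chart a).target :=
  (A.exists_cutoff a).choose_spec.2.1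

theorem AdaptedAtlas.cutoff_nonneg (a : Fin A.card) (x : Space n) : 0 ≤ A.cutoff a x :=
  (A.exists_cutoff a).choose_spec.2.2.1 x

theorem AdaptedAtlas.cutoff_le_one (a : Fin A.card) (x : Space n) : A.cutoff a x ≤ 1 :=
  (A.exists_cutoff a).choose_spec.2.2.2.1 x

theorem AdaptedAtlas.cutoff_eq_one (a : Fin A.card) {x : Space n} (hx : x ∈ A.dom a) :
    A.cutoff a x = 1 :=
  (A.exists_cutoff a).choose_spec.2.2.2.2 x hx

variable [IsManifold (𝓡 (2 * n + 1)) ∞ M]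

theorem contDiffOn_smoothFn {r : ℕ} (G : smoothFn n M r) (a : Fin A.card) :
    ContDiffOn ℝ ∞ (fun y => G.1 ((A.chart a).symm y)) (A.chart a).target :=
  contDiffOn_comp_chart_symm A G.2 a

theorem memLp_horDL_smoothFn {r : ℕ} (G : smoothFn n M r) (a : Fin A.card)
    (I : List (Fin (2 * n))) :
    MemLp (horDL I fun y => G.1 ((A.chart a).symm y)) 2
      ((volume : Measure (Space n)).restrict (A.dom a)) :=
  memLp_two_of_continuousOn (A.isCompact_closure_dom a)
    ((contDiffOn_horDL (A.chart a).open_target (contDiffOn_smoothFn A G a) I).continuousOn.mono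
      (A.closure_dom_subset a))

/-- The tuple `(X_I (G ∘ φ_a⁻¹))_{a, |I| ≤ s}` of a smooth function `G`. -/
def jetM (r s : ℕ) : smoothFn n M r →ₗ[ℝ] Ambient A r s where
  toFun G := WithLp.toLp 2 fun p => (memLp_horDL_smoothFn A G p.1 (List.ofFn p.2.2)).toLp _
  map_add' G G' := by
    ext1 p
    refine Eq.trans ?_ (MemLp.toLp_add (memLp_horDL_smoothFn A G p.1 (List.ofFn p.2.2))
      (memLp_horDL_smoothFn A G' p.1 (List.ofFn p.2.2)))
    refine MemLp.toLp_congr (memLp_horDL_smoothFn A (G + G') p.1 (List.ofFn p.2.2))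
      ((memLp_horDL_smoothFn A G p.1 (List.ofFn p.2.2)).add
        (memLp_horDL_smoothFn A G' p.1 (List.ofFn p.2.2))) (A.ae_dom fun y hy => ?_)
    exact horDL_add_eqOn (A.chart p.1).open_target (contDiffOn_smoothFn A G p.1)
      (contDiffOn_smoothFn A G' p.1) _ (A.dom_subset p.1 hy)
  map_smul' c G := by
    ext1 p
    refine Eq.trans ?_ (MemLp.toLp_const_smul c (memLp_horDL_smoothFn A G p.1 (List.ofFn p.2.2)))
    refine MemLp.toLp_congr (memLp_horDL_smoothFn A (c • G) p.1 (List.ofFn p.2.2))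
      ((memLp_horDL_smoothFn A G p.1 (List.ofFn p.2.2)).const_smul c) (A.ae_dom fun y hy => ?_)
    exact horDL_clm (A.chart p.1).open_target
      (c • ContinuousLinearMap.id ℝ (EuclideanSpace ℝ (Fin r)))
      (contDiffOn_smoothFn A G p.1) _ (A.dom_subset p.1 hy)

theorem jetM_apply {r : ℕ} (s : ℕ) (G : smoothFn n M r) (p : Fin A.card × MultiIndex n s) :
    jetM A r s G p = (memLp_horDL_smoothFn A G p.1 (List.ofFn p.2.2)).toLp _ := rfl

theorem coeFn_jetM {r : ℕ} (s : ℕ) (G : smoothFn n M r) (a : Fin A.card) (I : MultiIndex n s) :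
    (jetM A r s G (a, I) : Space n → EuclideanSpace ℝ (Fin r))
      =ᵐ[(volume : Measure (Space n)).restrict (A.dom a)]
        horDL (List.ofFn I.2) fun y => G.1 ((A.chart a).symm y) :=
  MemLp.coeFn_toLp (memLp_horDL_smoothFn A G a (List.ofFn I.2))

theorem exists_sum_lintegral_hsq_le (r s : ℕ) : ∃ C : ℝ≥0, ∀ G : smoothFn n M r,
    ∑ b, ∫⁻ z in A.dom b, hsq s (fun z => G.1 ((A.chart b).symm z)) z ≤
      C * ENNReal.ofReal (‖jetM A r s G‖ ^ 2) := by
  refine ⟨A.card * ((2 * n + 1) ^ s * Fintype.card (MultiIndex n s)), fun G => ?_⟩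
  rw [ENNReal.ofReal_pow (norm_nonneg _), ofReal_norm]
  have key : ∀ b, ∫⁻ z in A.dom b, hsq s (fun z => G.1 ((A.chart b).symm z)) z ≤
      ((2 * n + 1 : ℝ≥0∞) ^ s * Fintype.card (MultiIndex n s)) * ‖jetM A r s G‖ₑ ^ 2 := by
    intro b
    calc ∫⁻ z in A.dom b, hsq s (fun z => G.1 ((A.chart b).symm z)) z
        ≤ ∫⁻ z in A.dom b, (2 * n + 1 : ℝ≥0∞) ^ s * ∑ I : MultiIndex n s,
            ‖horDL (List.ofFn I.2) (fun z => G.1 ((A.chart b).symm z)) z‖ₑ ^ 2 :=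
          lintegral_mono fun x => hsq_le_sum_multiIndex s _ x
      _ = (2 * n + 1 : ℝ≥0∞) ^ s * ∑ I : MultiIndex n s, ‖jetM A r s G (b, I)‖ₑ ^ 2 := by
          rw [lintegral_const_mul' _ _ (by finiteness), lintegral_finsetSum']
          · simp only [jetM_apply, Lp.enorm_toLp, eLpNorm_two_sq]
          · intro I _
            exact (memLp_horDL_smoothFn A G b (List.ofFn I.2)).1.enorm.pow_const 2
      _ ≤ (2 * n + 1 : ℝ≥0∞) ^ s * ∑ _I : MultiIndex n s, ‖jetM A r s G‖ₑ ^ 2 := by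
          gcongr with I
          exact enorm_le_iff_norm_le.2 (PiLp.norm_apply_le _ _)
      _ = _ := by
          rw [Finset.sum_const, Finset.card_univ, nsmul_eq_mul, mul_assoc]
  calc _ ≤ ∑ _b : Fin A.card, ((2 * n + 1 : ℝ≥0∞) ^ s * Fintype.card (MultiIndex n s)) *
        ‖jetM A r s G‖ₑ ^ 2 := Finset.sum_le_sum fun b _ => key b
    _ = _ := by
      rw [Finset.sum_const, Finset.card_univ, nsmul_eq_mul, Fintype.card_fin]
      push_cast
      ring

/-- The components of `G ∘ φ_a⁻¹`, multiplied by a cutoff function. -/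
def cutTest (r : ℕ) (a : Fin A.card) : smoothFn n M r →ₗ[ℝ] (Fin r → testFn n) where
  toFun G l := ⟨fun y => A.cutoff a y * G.1 ((A.chart a).symm y) l,
    IsTest.mul_of_contDiffOn (A.chart a).open_target
      ((EuclideanSpace.proj (𝕜 := ℝ) l).contDiff.comp_contDiffOn (contDiffOn_smoothFn A G a))
      (A.isTest_cutoff a) (A.tsupport_cutoff a)⟩
  map_add' G G' := by
    funext l; apply Subtype.ext; funext y
    exact mul_add _ _ _
  map_smul' c G := by
    funext l; apply Subtype.ext; funext y
    exact mul_left_comm _ _ _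

theorem cutTest_apply {r : ℕ} (a : Fin A.card) (G : smoothFn n M r) (l : Fin r) (y : Space n) :
    (cutTest A r a G l).1 y = A.cutoff a y * G.1 ((A.chart a).symm y) l := rfl

variable {H : Type*} [NormedAddCommGroup H] [NormedSpace ℝ H] {s : ℕ} {e : testFn n →ₗ[ℝ] H}

/-- The support of the cutoff may reach beyond D_a, where the norm of the jet in the chart a gives
no information; there the other charts are used, through `exists_lintegral_hsq_chart_le`. -/
theorem norm_cutTest_le (he : IsSobolev s e) (r : ℕ) (a : Fin A.card) : ∃ C : ℝ, 0 ≤ C ∧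
    ∀ G : smoothFn n M r, ‖fun l => e (cutTest A r a G l)‖ ≤ C * ‖jetM A r s G‖ := by
  set K := tsupport (A.cutoff a) with hK
  have hKc : IsCompact K := (A.isTest_cutoff a).2
  have hKU := A.tsupport_cutoff a
  have hU := (A.chart a).open_target
  obtain ⟨C₁, hC₁⟩ := exists_hsq_smul_le (W := EuclideanSpace ℝ (Fin r)) hU hKc hKU s
    (A.isTest_cutoff a).1.contDiffOn
  obtain ⟨C₂, hC₂⟩ := exists_lintegral_hsq_chart_le A (EuclideanSpace ℝ (Fin r)) s a hKc hKU
  obtain ⟨C₃, hC₃⟩ := exists_sum_lintegral_hsq_le A r s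
  have key : ∀ (G : smoothFn n M r) (l : Fin r), ‖e (cutTest A r a G l)‖ₑ ^ 2 ≤
      (‖(EuclideanSpace.proj l : EuclideanSpace ℝ (Fin r) →L[ℝ] ℝ)‖₊ ^ 2 * (C₁ * (C₂ * C₃)) : ℝ≥0) *
        ENNReal.ofReal (‖jetM A r s G‖ ^ 2) := by
    intro G l
    have hG := contDiffOn_smoothFn A G a
    have hcG : ContDiffOn ℝ ∞ (fun y => A.cutoff a y • G.1 ((A.chart a).symm y))
        (A.chart a).target := (A.isTest_cutoff a).1.contDiffOn.smul hG
    calc ‖e (cutTest A r a G l)‖ₑ ^ 2 ≤ hE volume s (cutTest A r a G l : Space n → ℝ) :=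
          he.enorm_sq_le _
      _ = ∫⁻ y in K, hsq s (cutTest A r a G l : Space n → ℝ) y := by
          refine (setLIntegral_eq_of_support_subset fun y hy => ?_).symm
          by_contra hyK
          apply hy
          rw [hsq_congr (g := fun _ => 0) (isClosed_tsupport _).isOpen_compl (fun z hz => ?_) s hyK]
          · exact hsq_zero s y
          · rw [cutTest_apply, image_eq_zero_of_notMem_tsupport hz, zero_mul]
      _ ≤ ∫⁻ y in K, ‖(EuclideanSpace.proj l : EuclideanSpace ℝ (Fin r) →L[ℝ] ℝ)‖ₑ ^ 2 *
            (C₁ * hsq s (fun y => G.1 ((A.chart a).symm y)) y) := by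
          refine setLIntegral_mono' hKc.measurableSet fun y hy => ?_
          refine (hsq_clm_le hU (EuclideanSpace.proj l) hcG s (hKU hy)).trans ?_
          gcongr
          exact hC₁ _ hG y hy
      _ = ‖(EuclideanSpace.proj l : EuclideanSpace ℝ (Fin r) →L[ℝ] ℝ)‖ₑ ^ 2 *
            (C₁ * ∫⁻ y in K, hsq s (fun y => G.1 ((A.chart a).symm y)) y) := by
          rw [lintegral_const_mul' _ _ (by finiteness), lintegral_const_mul' _ _ (by finiteness)]
      _ ≤ ‖(EuclideanSpace.proj l : EuclideanSpace ℝ (Fin r) →L[ℝ] ℝ)‖ₑ ^ 2 *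
            (C₁ * (C₂ * (C₃ * ENNReal.ofReal (‖jetM A r s G‖ ^ 2)))) := by
          gcongr
          refine (hC₂ G.1 G.2).trans ?_
          gcongr
          exact hC₃ G
      _ = _ := by
          push_cast
          rw [enorm_eq_nnnorm]
          ring
  refine ⟨∑ l : Fin r, Real.sqrt (‖(EuclideanSpace.proj l : EuclideanSpace ℝ (Fin r) →L[ℝ] ℝ)‖₊ ^ 2 *
    (C₁ * (C₂ * C₃)) : ℝ≥0), Finset.sum_nonneg fun _ _ => Real.sqrt_nonneg _, fun G => ?_⟩
  refine (pi_norm_le_iff_of_nonneg (mul_nonneg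
    (Finset.sum_nonneg fun _ _ => Real.sqrt_nonneg _) (norm_nonneg _))).2 fun l => ?_
  refine (norm_le_of_enorm_sq_le (key G l)).trans ?_
  gcongr
  exact Finset.single_le_sum (f := fun l => Real.sqrt
    (‖(EuclideanSpace.proj l : EuclideanSpace ℝ (Fin r) →L[ℝ] ℝ)‖₊ ^ 2 *
    (C₁ * (C₂ * C₃)) : ℝ≥0)) (fun _ _ => Real.sqrt_nonneg _) (Finset.mem_univ l)

end SmoothFunctions

end FollandStein
end

noncomputable section
namespace FollandStein

open scoped ENNReal NNReal Topology
open Set Filter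

/-! ### Limits of jets are determined by their order-zero components. -/

section WeakDerivatives

variable {n : ℕ}

theorem exists_norm_le_sum_abs (r : ℕ) : ∃ C : ℝ, 0 ≤ C ∧ ∀ (v : EuclideanSpace ℝ (Fin r)) (B : ℝ),
    0 ≤ B → (∀ l, |v l| ≤ B) → ‖v‖ ≤ C * B := by
  set T := (EuclideanSpace.equiv (Fin r) ℝ).symm
  refine ⟨‖(T : (Fin r → ℝ) →L[ℝ] EuclideanSpace ℝ (Fin r))‖, norm_nonneg _, fun v B hB h => ?_⟩
  have h1 := (T : (Fin r → ℝ) →L[ℝ] EuclideanSpace ℝ (Fin r)).le_opNorm (fun l => v l)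
  refine le_trans h1 (mul_le_mul_of_nonneg_left ?_ (norm_nonneg _))
  exact (pi_norm_le_iff_of_nonneg hB).2 h

/-- The `l`-th component of a test function times a vector-valued `L²` function, integrated. -/
theorem exists_pairing {D : Set (Space n)} (hD : IsCompact (closure D)) {r : ℕ} (l : Fin r)
    {ψ : Space n → ℝ} (hψ : IsTest ψ) :
    ∃ Λ : Lp (EuclideanSpace ℝ (Fin r)) 2 ((volume : Measure (Space n)).restrict D) →L[ℝ] ℝ,
      ∀ v, Λ v = ∫ y in D, ψ y * v y l := by
  have hm : MemLp (fun y => ψ y • EuclideanSpace.single l (1 : ℝ)) 2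
      ((volume : Measure (Space n)).restrict D) :=
    memLp_two_of_continuousOn hD
      (hψ.1.continuous.smul continuous_const).continuousOn
  refine ⟨innerSL ℝ (hm.toLp _), fun v => ?_⟩
  rw [innerSL_apply_apply, L2.inner_def]
  refine integral_congr_ae ?_
  filter_upwards [hm.coeFn_toLp] with y hy
  rw [hy, real_inner_smul_left, EuclideanSpace.inner_single_left]
  simp

variable {M : Type*} [TopologicalSpace M] [ChartedSpace (Space n) M]
  {η : ContactForm n M} (A : AdaptedAtlas η) [IsManifold (𝓡 (2 * n + 1)) ∞ M] {r s : ℕ}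

/-- For jets of smooth functions this is integration by parts. Both sides are continuous in u for
the L² norms, and ψ' does not depend on u, so the identity passes to the closure. -/
theorem exists_weak_deriv (a : Fin A.card) (I : MultiIndex n s) (l : Fin r) {ψ : Space n → ℝ}
    (hψ : IsTest ψ) (hψD : tsupport ψ ⊆ A.dom a) : ∃ ψ' : Space n → ℝ,
      ∀ u ∈ closure (range (jetM A r s)),
        ∫ y in A.dom a, ψ y * u (a, I) y l = ∫ y in A.dom a, ψ' y * u (a, ⟨0, Fin.elim0⟩) y l := by
  obtain ⟨ψ', hψ', hψ'D, hint⟩ := exists_integral_horDL_mul (A.isOpen_dom a) (List.ofFn I.2) hψ hψD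
  refine ⟨ψ', fun u hu => ?_⟩
  obtain ⟨Λ, hΛ⟩ := exists_pairing (A.isCompact_closure_dom a) l hψ
  obtain ⟨Λ', hΛ'⟩ := exists_pairing (A.isCompact_closure_dom a) l hψ'
  rw [← hΛ, ← hΛ']
  have hc : ∀ p, Continuous fun u : Ambient A r s => u p := fun p => PiLp.continuous_apply 2 _ p
  have hcl : IsClosed {u : Ambient A r s | Λ (u (a, I)) = Λ' (u (a, ⟨0, Fin.elim0⟩))} :=
    isClosed_eq (Λ.continuous.comp (hc _)) (Λ'.continuous.comp (hc _))
  refine closure_minimal ?_ hcl hu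
  rintro _ ⟨G, rfl⟩
  rw [mem_ofPred_eq, hΛ, hΛ']
  have hG := (contDiffOn_smoothFn A G a).mono (A.dom_subset a)
  have h1 : ∫ y in A.dom a, ψ y * jetM A r s G (a, I) y l =
      ∫ y, ψ y * horDL (List.ofFn I.2) (fun y => G.1 ((A.chart a).symm y) l) y := by
    refine Eq.trans ?_ (setIntegral_eq_integral_of_forall_compl_eq_zero (s := A.dom a) ?_)
    · refine integral_congr_ae ?_
      filter_upwards [coeFn_jetM A s G a I, A.ae_dom fun y hy =>
        horDL_clm (A.isOpen_dom a)
          (EuclideanSpace.proj l : EuclideanSpace ℝ (Fin r) →L[ℝ] ℝ) hG (List.ofFn I.2) hy] with y h2 h3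
      rw [h2]
      exact congrArg _ h3.symm
    · intro y hy
      rw [image_eq_zero_of_notMem_tsupport fun h => hy (hψD h), zero_mul]
  have h2 : ∫ y in A.dom a, ψ' y * jetM A r s G (a, ⟨0, Fin.elim0⟩) y l =
      ∫ y, ψ' y * G.1 ((A.chart a).symm y) l := by
    refine Eq.trans ?_ (setIntegral_eq_integral_of_forall_compl_eq_zero (s := A.dom a) ?_)
    · refine integral_congr_ae ?_
      filter_upwards [coeFn_jetM A s G a ⟨0, Fin.elim0⟩] with y h2
      rw [h2]
      simp [horDL]
    · intro y hy
      rw [image_eq_zero_of_notMem_tsupport fun h => hy (hψ'D h), zero_mul]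
  rw [h1, h2]
  exact hint _ ((EuclideanSpace.proj (𝕜 := ℝ) l).contDiff.comp_contDiffOn hG)

/-- An element of the closure of the jets is determined by its components of order zero. -/
theorem eq_zero_of_components_zero {u : Ambient A r s} (hu : u ∈ closure (range (jetM A r s)))
    (h0 : ∀ a, (u (a, ⟨0, Fin.elim0⟩) : Space n → EuclideanSpace ℝ (Fin r))
      =ᵐ[(volume : Measure (Space n)).restrict (A.dom a)] 0) : u = 0 := by
  ext1 p
  obtain ⟨a, I⟩ := p
  change u (a, I) = 0
  rw [Lp.eq_zero_iff_ae_eq_zero]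
  have hfin : IsFiniteMeasure ((volume : Measure (Space n)).restrict (A.dom a)) :=
    ⟨by rw [Measure.restrict_apply_univ]
        exact (measure_mono subset_closure).trans_lt (A.isCompact_closure_dom a).measure_lt_top⟩
  have key : ∀ l : Fin r, ∀ᵐ y ∂(volume : Measure (Space n)).restrict (A.dom a),
      u (a, I) y l = 0 := by
    intro l
    rw [ae_restrict_iff' (A.isOpen_dom a).measurableSet]
    -- It suffices to pair the component I with test functions in D_a, and each such pairing equals
    -- one with the vanishing component of order zero.
    refine (A.isOpen_dom a).ae_eq_zero_of_integral_contDiff_smul_eq_zero ?_ ?_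
    · have h1 : Integrable (u (a, I) : Space n → EuclideanSpace ℝ (Fin r))
          ((volume : Measure (Space n)).restrict (A.dom a)) :=
        (Lp.memLp (u (a, I))).integrable (by norm_num)
      have h2 := (EuclideanSpace.proj (𝕜 := ℝ) l :
        EuclideanSpace ℝ (Fin r) →L[ℝ] ℝ).integrable_comp h1
      exact IntegrableOn.locallyIntegrableOn h2
    · intro g hg hgc hgD
      obtain ⟨ψ', hψ'⟩ := exists_weak_deriv (r := r) (s := s) A a I l ⟨hg, hgc⟩ hgD
      have h3 := hψ' u hu
      have h4 : ∫ y in A.dom a, ψ' y * u (a, ⟨0, Fin.elim0⟩) y l = 0 := by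
        rw [← integral_zero (Space n) ℝ]
        refine integral_congr_ae ?_
        filter_upwards [h0 a] with y hy
        rw [hy]
        simp
      rw [h4, setIntegral_eq_integral_of_forall_compl_eq_zero] at h3
      · exact h3
      · intro y hy
        rw [image_eq_zero_of_notMem_tsupport fun h => hy (hgD h), zero_mul]
  filter_upwards [ae_all_iff.2 key] with y hy
  ext l
  exact hy l

end WeakDerivatives

/-! ### Localisation, differentiation and Sobolev embedding on the completion. -/

section Extensions

variable {n : ℕ} {M : Type*} [TopologicalSpace M] [ChartedSpace (Space n) M]
  {η : ContactForm n M} (A : AdaptedAtlas η) [IsManifold (𝓡 (2 * n + 1)) ∞ M] {r s : ℕ}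
  {H : Type*} [NormedAddCommGroup H] [NormedSpace ℝ H] [CompleteSpace H] {e : testFn n →ₗ[ℝ] H}

theorem exists_cutExt (he : IsSobolev s e) (r : ℕ) (a : Fin A.card) :
    ∃ T : Ambient A r s →L[ℝ] (Fin r → H), ∀ G : smoothFn n M r,
      T (jetM A r s G) = fun l => e (cutTest A r a G l) := by
  obtain ⟨C, -, hC⟩ := norm_cutTest_le A he r a
  exact exists_extension_of_range (jetM A r s)
    ((LinearMap.pi fun l => e ∘ₗ LinearMap.proj l) ∘ₗ cutTest A r a) hC

/-- The extension of `G ↦ (χ_a · (G ∘ φ_a⁻¹)_l)_l` to the completion. -/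
def cutExt (he : IsSobolev s e) (r : ℕ) (a : Fin A.card) : Ambient A r s →L[ℝ] (Fin r → H) :=
  (exists_cutExt A he r a).choose

theorem cutExt_jetM (he : IsSobolev s e) (a : Fin A.card) (G : smoothFn n M r) :
    cutExt A he r a (jetM A r s G) = fun l => e (cutTest A r a G l) :=
  (exists_cutExt A he r a).choose_spec G

theorem exists_jetExt (he : IsSobolev s e) (I : MultiIndex n s) :
    ∃ T : H →L[ℝ] Lp ℝ 2 (volume : Measure (Space n)), ∀ f, T (e f) = jet s f I := by
  obtain ⟨C, hC⟩ := he.hE_le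
  have h1 : ∀ f, ‖jet s f I‖ ≤ Real.sqrt C * ‖e f‖ := fun f =>
    (norm_le_pi_norm _ I).trans (norm_le_of_enorm_sq_le ((norm_jet_sq_le s f).trans (hC f)))
  exact ⟨(LinearMap.proj I ∘ₗ jet s).extendOfNorm e, fun f =>
    LinearMap.extendOfNorm_eq he.dense ⟨_, h1⟩ f⟩

theorem exists_derivExt (he : IsSobolev s e) (D : Set (Space n)) (I : MultiIndex n s) (l : Fin r) :
    ∃ T : H →L[ℝ] Lp (EuclideanSpace ℝ (Fin r)) 2 ((volume : Measure (Space n)).restrict D),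
      ∀ f : testFn n, (T (e f) : Space n → EuclideanSpace ℝ (Fin r))
        =ᵐ[(volume : Measure (Space n)).restrict D]
          fun y => horDL (List.ofFn I.2) (f : Space n → ℝ) y • EuclideanSpace.single l (1 : ℝ) := by
  obtain ⟨T, hT⟩ := exists_jetExt he I
  set L : ℝ →L[ℝ] EuclideanSpace ℝ (Fin r) :=
    ContinuousLinearMap.toSpanSingleton ℝ (EuclideanSpace.single l (1 : ℝ))
  refine ⟨(L.compLpL 2 _).comp ((LpToLpRestrictCLM (Space n) ℝ ℝ volume 2 D).comp T), fun f => ?_⟩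
  rw [ContinuousLinearMap.comp_apply, ContinuousLinearMap.comp_apply, hT]
  have h1 := L.coeFn_compLpL (p := 2) (LpToLpRestrictCLM (Space n) ℝ ℝ volume 2 D (jet s f I))
  have h2 := LpToLpRestrictCLM_coeFn ℝ D (jet s f I)
  have h3 : (jet s f I : Space n → ℝ) =ᵐ[(volume : Measure (Space n)).restrict D]
      horDL (List.ofFn I.2) (f : Space n → ℝ) :=
    ae_restrict_of_ae (MemLp.coeFn_toLp (f.2.horDL (List.ofFn I.2)).memLp)
  filter_upwards [h1, h2, h3] with y hy1 hy2 hy3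
  rw [hy1, hy2, hy3]
  rfl

/-- The extension of `f ↦ (X_I f) e_l` to the completion. -/
def derivExt (he : IsSobolev s e) (D : Set (Space n)) (I : MultiIndex n s) (l : Fin r) :
    H →L[ℝ] Lp (EuclideanSpace ℝ (Fin r)) 2 ((volume : Measure (Space n)).restrict D) :=
  (exists_derivExt he D I l).choose

theorem coeFn_derivExt (he : IsSobolev s e) (D : Set (Space n)) (I : MultiIndex n s) (l : Fin r)
    (f : testFn n) : (derivExt he D I l (e f) : Space n → EuclideanSpace ℝ (Fin r))
        =ᵐ[(volume : Measure (Space n)).restrict D]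
          fun y => horDL (List.ofFn I.2) (f : Space n → ℝ) y • EuclideanSpace.single l (1 : ℝ) :=
  (exists_derivExt he D I l).choose_spec f

/-- Every point of M lies over some D_a, where the cutoff is 1 and the Sobolev bound on `Space n`
applies to the localised function. -/
theorem exists_norm_smoothFn_le (hn : 1 ≤ n) (hs : 2 * n + 2 ≤ s) (r : ℕ) : ∃ C : ℝ, 0 ≤ C ∧
    ∀ (G : smoothFn n M r) (x : M), ‖G.1 x‖ ≤ C * ‖jetM A r s G‖ := by
  obtain ⟨H, _, _, _, e, he⟩ := exists_isSobolev n s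
  obtain ⟨C₀, hC₀, h₀⟩ := exists_norm_le_sum_abs r
  obtain ⟨C₁, hC₁, h₁⟩ := abs_le_norm_toSob he hn hs
  choose C₂ hC₂ h₂ using fun a => norm_cutTest_le A he r a
  refine ⟨C₀ * (C₁ * ∑ a, C₂ a), 
    mul_nonneg hC₀ (mul_nonneg hC₁ (Finset.sum_nonneg fun a _ => hC₂ a)), fun G x => ?_⟩
  obtain ⟨a, ha, hx⟩ := A.cover x
  have hsum : C₂ a ≤ ∑ a, C₂ a :=
    Finset.single_le_sum (fun a _ => hC₂ a) (Finset.mem_univ a)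
  rw [mul_assoc]
  have h3 : 0 ≤ C₁ * ∑ a, C₂ a := mul_nonneg hC₁ ((hC₂ a).trans hsum)
  refine h₀ _ _ (mul_nonneg h3 (norm_nonneg _)) fun l => ?_
  have h4 := h₁ (cutTest A r a G l) (A.chart a x)
  rw [cutTest_apply, A.cutoff_eq_one a hx, one_mul, (A.chart a).left_inv ha] at h4
  refine h4.trans ?_
  rw [mul_assoc]
  refine mul_le_mul_of_nonneg_left ?_ hC₁
  refine ((norm_le_pi_norm (fun l => e (cutTest A r a G l)) l).trans (h₂ a G)).trans ?_
  gcongr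

variable [CompactSpace M]

theorem exists_supExt (hn : 1 ≤ n) (hs : 2 * n + 2 ≤ s) (r : ℕ) :
    ∃ S : Ambient A r s →L[ℝ] C(M, EuclideanSpace ℝ (Fin r)), ∀ (G : smoothFn n M r) (x : M),
      S (jetM A r s G) x = G.1 x := by
  obtain ⟨C, hC, h⟩ := exists_norm_smoothFn_le A hn hs r
  obtain ⟨S, hS⟩ := exists_extension_of_range (jetM A r s)
    ({ toFun := fun G => ⟨G.1, G.2.continuous⟩
       map_add' := fun _ _ => rfl
       map_smul' := fun _ _ => rfl } : smoothFn n M r →ₗ[ℝ] C(M, EuclideanSpace ℝ (Fin r)))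
    (C := C) fun G => (ContinuousMap.norm_le _ (mul_nonneg hC (norm_nonneg _))).2 (h G)
  exact ⟨S, fun G x => DFunLike.congr_fun (hS G) x⟩

/-- The continuous function represented by an element of the completion. -/
def supExt (hn : 1 ≤ n) (hs : 2 * n + 2 ≤ s) (r : ℕ) :
    Ambient A r s →L[ℝ] C(M, EuclideanSpace ℝ (Fin r)) :=
  (exists_supExt A hn hs r).choose

theorem supExt_jetM (hn : 1 ≤ n) (hs : 2 * n + 2 ≤ s) (G : smoothFn n M r) (x : M) :
    supExt A hn hs r (jetM A r s G) x = G.1 x :=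
  (exists_supExt A hn hs r).choose_spec G x

/-- Along a sequence of jets tending to u, the order-zero components converge almost everywhere
after passing to a subsequence, and the functions themselves converge uniformly to `supExt` of u.
The two limits agree. -/
theorem coeFn_component_zero (hn : 1 ≤ n) (hs : 2 * n + 2 ≤ s) {u : Ambient A r s}
    (hu : u ∈ closure (range (jetM A r s))) (a : Fin A.card) :
    (u (a, ⟨0, Fin.elim0⟩) : Space n → EuclideanSpace ℝ (Fin r))
      =ᵐ[(volume : Measure (Space n)).restrict (A.dom a)]
        fun y => supExt A hn hs r u ((A.chart a).symm y) := by
  obtain ⟨v, hv, hvu⟩ := mem_closure_iff_seq_limit.1 hu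
  choose G hG using hv
  have h1 : Tendsto (fun k => v k (a, ⟨0, Fin.elim0⟩)) atTop (𝓝 (u (a, ⟨0, Fin.elim0⟩))) :=
    ((PiLp.continuous_apply 2 _ _).tendsto u).comp hvu
  obtain ⟨ns, hns, h2⟩ := (tendstoInMeasure_of_tendsto_Lp h1).exists_seq_tendsto_ae
  have h3 := ae_all_iff.2 fun k => coeFn_jetM A s (G k) a ⟨0, Fin.elim0⟩
  filter_upwards [h2, h3] with y hy2 hy3
  refine tendsto_nhds_unique hy2 ?_
  have h4 : Tendsto (fun k => supExt A hn hs r (v (ns k)) ((A.chart a).symm y)) atTop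
      (𝓝 (supExt A hn hs r u ((A.chart a).symm y))) :=
    (((continuous_eval_const ((A.chart a).symm y)).comp
      (supExt A hn hs r).continuous).tendsto u).comp (hvu.comp hns.tendsto_atTop)
  refine h4.congr fun k => ?_
  rw [← hG (ns k), supExt_jetM, hy3 (ns k)]
  simp [horDL]

theorem eq_of_supExt_eq (hn : 1 ≤ n) (hs : 2 * n + 2 ≤ s) {u u' : Ambient A r s}
    (hu : u ∈ closure (range (jetM A r s))) (hu' : u' ∈ closure (range (jetM A r s)))
    (h : supExt A hn hs r u = supExt A hn hs r u') : u = u' := by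
  have hsub : u - u' ∈ closure (range (jetM A r s)) :=
    (LinearMap.range (jetM A r s)).topologicalClosure.sub_mem hu hu'
  refine sub_eq_zero.1 (eq_zero_of_components_zero A hsub fun a => ?_)
  refine (coeFn_component_zero A hn hs hsub a).trans (Eventually.of_forall fun y => ?_)
  simp [h]

end Extensions

end FollandStein
end

/-! ### The superposition operator on M. -/

noncomputable section
namespace FollandStein

open scoped ENNReal NNReal Topology
open Set Filter

theorem norm_piLp_two_le_sum {ι : Type*} [Fintype ι] {β : ι → Type*}
    [∀ i, NormedAddCommGroup (β i)] (v : PiLp 2 β) : ‖v‖ ≤ ∑ i, ‖v i‖ := by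
  rw [PiLp.norm_eq_of_L2]
  refine Real.sqrt_le_iff.2 ⟨Finset.sum_nonneg fun i _ => norm_nonneg _, ?_⟩
  exact Finset.sum_sq_le_sq_sum_of_nonneg fun i _ => norm_nonneg _

variable {n : ℕ} {M : Type*} [TopologicalSpace M] [ChartedSpace (Space n) M]
  {η : ContactForm n M} (A : AdaptedAtlas η) {r r' s : ℕ}

/-- The `l`-th component of a fibre-preserving map `(x, v) ↦ f (x, v)` in the chart `a`, cut off
outside of a neighbourhood of `D_a`. -/
def localSymbol (f : M × EuclideanSpace ℝ (Fin r) → EuclideanSpace ℝ (Fin r')) (a : Fin A.card)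
    (l : Fin r') (p : Space n × (Fin r → ℝ)) : ℝ :=
  A.cutoff a p.1 * f ((A.chart a).symm p.1, WithLp.toLp 2 p.2) l

variable [IsManifold (𝓡 (2 * n + 1)) ∞ M]
  {f : M × EuclideanSpace ℝ (Fin r) → EuclideanSpace ℝ (Fin r')}

theorem isSymbol_localSymbol (hf : ContMDiff ((𝓡 (2 * n + 1)).prod 𝓘(ℝ, EuclideanSpace ℝ (Fin r)))
      𝓘(ℝ, EuclideanSpace ℝ (Fin r')) ∞ f) (a : Fin A.card) (l : Fin r') :
    IsSymbol (localSymbol A f a l) := by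
  refine ⟨contDiff_iff_contDiffAt.2 fun p => ?_, tsupport (A.cutoff a), (A.isTest_cutoff a).2,
    fun y hy v => ?_⟩
  · by_cases hp : p.1 ∈ (A.chart a).target
    · have hU : IsOpen ((A.chart a).target ×ˢ (univ : Set (Fin r → ℝ))) :=
        (A.chart a).open_target.prod isOpen_univ
      have h1 : ContDiffOn ℝ ∞ (fun p : Space n × (Fin r → ℝ) =>
          f ((A.chart a).symm p.1, WithLp.toLp 2 p.2)) ((A.chart a).target ×ˢ univ) := by
        rw [← contMDiffOn_iff_contDiffOn]
        refine hf.comp_contMDiffOn (ContMDiffOn.prodMk ?_ ?_)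
        · exact (contMDiffOn_chart_symm A a).comp contDiff_fst.contMDiff.contMDiffOn fun p hp => hp.1
        · exact ((PiLp.contDiff_toLp (p := 2)).comp contDiff_snd).contMDiff.contMDiffOn
      refine ContDiffAt.mul ?_ ?_
      · exact (A.isTest_cutoff a).1.contDiffAt.comp p contDiffAt_fst
      · exact (EuclideanSpace.proj (𝕜 := ℝ) l :
          EuclideanSpace ℝ (Fin r') →L[ℝ] ℝ).contDiff.contDiffAt.comp p
          (h1.contDiffAt (hU.mem_nhds ⟨hp, mem_univ _⟩))
    · have hU : IsOpen ((tsupport (A.cutoff a))ᶜ ×ˢ (univ : Set (Fin r → ℝ))) :=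
        (isClosed_tsupport _).isOpen_compl.prod isOpen_univ
      have h0 : localSymbol A f a l =ᶠ[𝓝 p] fun _ => 0 := by
        filter_upwards [hU.mem_nhds ⟨fun h => hp (A.tsupport_cutoff a h), mem_univ _⟩] with q hq
        rw [localSymbol, image_eq_zero_of_notMem_tsupport hq.1, zero_mul]
      exact contDiffAt_const.congr_of_eventuallyEq h0
  · rw [localSymbol, image_eq_zero_of_notMem_tsupport hy, zero_mul]

/-- Composition of a smooth function `G` with a smooth fibre-preserving map. -/
def compSmooth (hf : ContMDiff ((𝓡 (2 * n + 1)).prod 𝓘(ℝ, EuclideanSpace ℝ (Fin r)))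
      𝓘(ℝ, EuclideanSpace ℝ (Fin r')) ∞ f) (G : smoothFn n M r) : smoothFn n M r' :=
  ⟨fun x => f (x, G.1 x), hf.comp (contMDiff_id.prodMk G.2)⟩

variable {H : Type*} [NormedAddCommGroup H] [NormedSpace ℝ H] [CompleteSpace H]
  {e : testFn n →ₗ[ℝ] H}

/-- The operator `u ↦ f(·, u)` on the completion. -/
def superM (he : IsSobolev s e) (hn : 1 ≤ n) (hs : 2 * n + 4 ≤ s)
    (hf : ContMDiff ((𝓡 (2 * n + 1)).prod 𝓘(ℝ, EuclideanSpace ℝ (Fin r)))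
      𝓘(ℝ, EuclideanSpace ℝ (Fin r')) ∞ f) (u : Ambient A r s) : Ambient A r' s :=
  WithLp.toLp 2 fun p => ∑ l, derivExt he (A.dom p.1) p.2 l
    (superposition he hn hs (isSymbol_localSymbol A hf p.1 l) (cutExt A he r p.1 u))

theorem contDiff_superM (he : IsSobolev s e) (hn : 1 ≤ n) (hs : 2 * n + 4 ≤ s)
    (hf : ContMDiff ((𝓡 (2 * n + 1)).prod 𝓘(ℝ, EuclideanSpace ℝ (Fin r)))
      𝓘(ℝ, EuclideanSpace ℝ (Fin r')) ∞ f) : ContDiff ℝ ∞ (superM A he hn hs hf) := by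
  refine contDiff_piLp' 2 fun p => ?_
  change ContDiff ℝ ∞ fun u => ∑ l, derivExt he (A.dom p.1) p.2 l
    (superposition he hn hs (isSymbol_localSymbol A hf p.1 l) (cutExt A he r p.1 u))
  refine ContDiff.sum fun l _ => ?_
  exact (derivExt he (A.dom p.1) p.2 l).contDiff.comp
    ((contDiff_superposition he hn hs (isSymbol_localSymbol A hf p.1 l)).comp
      (cutExt A he r p.1).contDiff)

/-- Cutoffs occur twice, in the symbol and in its argument, but both are 1 on the open set D_a. The
derivatives there are therefore those of f(·, G). -/
theorem superM_jetM (he : IsSobolev s e) (hn : 1 ≤ n) (hs : 2 * n + 4 ≤ s)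
    (hf : ContMDiff ((𝓡 (2 * n + 1)).prod 𝓘(ℝ, EuclideanSpace ℝ (Fin r)))
      𝓘(ℝ, EuclideanSpace ℝ (Fin r')) ∞ f) (G : smoothFn n M r) :
    superM A he hn hs hf (jetM A r s G) = jetM A r' s (compSmooth hf G) := by
  ext1 p
  obtain ⟨a, I⟩ := p
  change ∑ l, derivExt he (A.dom a) I l
    (superposition he hn hs (isSymbol_localSymbol A hf a l) (cutExt A he r a (jetM A r s G))) =
      jetM A r' s (compSmooth hf G) (a, I)
  simp only [cutExt_jetM, superposition_toSob]
  refine Lp.ext ?_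
  have h1 := ae_all_iff.2 fun l => coeFn_derivExt he (A.dom a) I l
    (nemTest (isSymbol_localSymbol A hf a l) (cutTest A r a G))
  have hF := (contDiffOn_smoothFn A (compSmooth hf G) a).mono (A.dom_subset a)
  have h2 : ∀ y ∈ A.dom a, ∀ l, horDL (List.ofFn I.2)
      (nemTest (isSymbol_localSymbol A hf a l) (cutTest A r a G) : Space n → ℝ) y =
        horDL (List.ofFn I.2) (fun y => (compSmooth hf G).1 ((A.chart a).symm y)) y l := by
    intro y hy l
    refine Eq.trans ?_ (horDL_clm (A.isOpen_dom a)
      (EuclideanSpace.proj l : EuclideanSpace ℝ (Fin r') →L[ℝ] ℝ) hF (List.ofFn I.2) hy)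
    refine horDL_congr (A.isOpen_dom a) (fun z hz => ?_) (List.ofFn I.2) hy
    change localSymbol A f a l (z, fun j => (cutTest A r a G j).1 z) = _
    simp only [localSymbol, cutTest_apply, A.cutoff_eq_one a hz, one_mul]
    rfl
  filter_upwards [h1, coeFn_jetM A s (compSmooth hf G) a I, A.ae_dom h2,
    Lp.coeFn_finsetSum Finset.univ fun l => derivExt he (A.dom a) I l
      (e (nemTest (isSymbol_localSymbol A hf a l) (cutTest A r a G)))] with y hy1 hy2 hy3 hy4
  rw [hy4, hy2, Finset.sum_apply]
  simp only [hy1, hy3]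
  ext l
  simp [Finset.sum_apply, Pi.single_apply]

theorem superM_jetM_apply (he : IsSobolev s e) (hn : 1 ≤ n) (hs : 2 * n + 4 ≤ s)
    (hf : ContMDiff ((𝓡 (2 * n + 1)).prod 𝓘(ℝ, EuclideanSpace ℝ (Fin r)))
      𝓘(ℝ, EuclideanSpace ℝ (Fin r')) ∞ f) (G : smoothFn n M r)
    (p : Fin A.card × MultiIndex n s) :
    superM A he hn hs hf (jetM A r s G) p = ∑ l, derivExt he (A.dom p.1) p.2 l
      (e (nemTest (isSymbol_localSymbol A hf p.1 l) (cutTest A r p.1 G))) := by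
  change ∑ l, derivExt he (A.dom p.1) p.2 l (superposition he hn hs
    (isSymbol_localSymbol A hf p.1 l) (cutExt A he r p.1 (jetM A r s G))) = _
  simp only [cutExt_jetM, superposition_toSob]

theorem abs_cutTest_le {R : ℝ} (a : Fin A.card) (G : smoothFn n M r) (hG : ∀ x, ‖G.1 x‖ ≤ R)
    (j : Fin r) (y : Space n) : |(cutTest A r a G j).1 y| ≤ R := by
  rw [cutTest_apply, abs_mul, abs_of_nonneg (A.cutoff_nonneg a y)]
  calc A.cutoff a y * |G.1 ((A.chart a).symm y) j|
      ≤ 1 * ‖G.1 ((A.chart a).symm y)‖ := by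
        gcongr
        · exact A.cutoff_le_one a y
        · exact PiLp.norm_apply_le (G.1 ((A.chart a).symm y)) j
    _ ≤ R := by rw [one_mul]; exact hG _

theorem norm_nemTest_cutTest_sub_le (he : IsSobolev s e) (hn : 1 ≤ n) (hs : 2 * n + 4 ≤ s)
    (hf : ContMDiff ((𝓡 (2 * n + 1)).prod 𝓘(ℝ, EuclideanSpace ℝ (Fin r)))
      𝓘(ℝ, EuclideanSpace ℝ (Fin r')) ∞ f) (R : ℝ) (a : Fin A.card) (l : Fin r') :
    ∃ C : ℝ, 0 ≤ C ∧
    ∀ G G' : smoothFn n M r, (∀ x, ‖G.1 x‖ ≤ R) → (∀ x, ‖G'.1 x‖ ≤ R) →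
      ‖e (nemTest (isSymbol_localSymbol A hf a l) (cutTest A r a G)) -
        e (nemTest (isSymbol_localSymbol A hf a l) (cutTest A r a G'))‖ ≤
        C * ((1 + ‖jetM A r s G‖ + ‖jetM A r s G'‖) ^ s * ‖jetM A r s G - jetM A r s G'‖) := by
  obtain ⟨C₀, hC₀, h₀⟩ := norm_nemTest_sub_le he hn hs (isSymbol_localSymbol A hf a l) R
  -- The condition c ≥ 1 allows 1 + c‖u‖ + c‖u'‖ ≤ c (1 + ‖u‖ + ‖u'‖).
  obtain ⟨c, hc, hext⟩ : ∃ c : ℝ, 1 ≤ c ∧ ∀ v, ‖cutExt A he r a v‖ ≤ c * ‖v‖ :=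
    ⟨max 1 ‖cutExt A he r a‖, le_max_left _ _, fun v =>
      ((cutExt A he r a).le_opNorm v).trans (by gcongr; exact le_max_right _ _)⟩
  have hc0 : 0 ≤ c := zero_le_one.trans hc
  refine ⟨C₀ * c ^ s * c, by positivity, fun G G' hG hG' => ?_⟩
  refine (h₀ _ _ (abs_cutTest_le A a G hG) (abs_cutTest_le A a G' hG')).trans ?_
  rw [← cutExt_jetM A he a G, ← cutExt_jetM A he a G', ← map_sub]
  generalize jetM A r s G = u
  generalize jetM A r s G' = u'
  calc C₀ * (1 + ‖cutExt A he r a u‖ + ‖cutExt A he r a u'‖) ^ s * ‖cutExt A he r a (u - u')‖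
      ≤ C₀ * (c * (1 + ‖u‖ + ‖u'‖)) ^ s * (c * ‖u - u'‖) := by
        gcongr
        · rw [mul_add, mul_add, mul_one]
          exact add_le_add (add_le_add hc (hext _)) (hext _)
        · exact hext _
    _ = C₀ * c ^ s * c * ((1 + ‖u‖ + ‖u'‖) ^ s * ‖u - u'‖) := by rw [mul_pow]; ring

theorem norm_superM_jetM_apply_sub_le (he : IsSobolev s e) (hn : 1 ≤ n) (hs : 2 * n + 4 ≤ s)
    (hf : ContMDiff ((𝓡 (2 * n + 1)).prod 𝓘(ℝ, EuclideanSpace ℝ (Fin r)))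
      𝓘(ℝ, EuclideanSpace ℝ (Fin r')) ∞ f) (R : ℝ) (p : Fin A.card × MultiIndex n s) :
    ∃ C : ℝ, 0 ≤ C ∧
    ∀ G G' : smoothFn n M r, (∀ x, ‖G.1 x‖ ≤ R) → (∀ x, ‖G'.1 x‖ ≤ R) →
      ‖superM A he hn hs hf (jetM A r s G) p - superM A he hn hs hf (jetM A r s G') p‖ ≤
        C * ((1 + ‖jetM A r s G‖ + ‖jetM A r s G'‖) ^ s * ‖jetM A r s G - jetM A r s G'‖) := by
  choose C₀ hC₀ h₀ using norm_nemTest_cutTest_sub_le A he hn hs hf R p.1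
  refine ⟨∑ l, ‖derivExt (r := r') he (A.dom p.1) p.2 l‖ * C₀ l,
    Finset.sum_nonneg fun l _ => mul_nonneg (norm_nonneg _) (hC₀ l), fun G G' hG hG' => ?_⟩
  rw [superM_jetM_apply, superM_jetM_apply, ← Finset.sum_sub_distrib, Finset.sum_mul]
  refine (norm_sum_le _ _).trans (Finset.sum_le_sum fun l _ => ?_)
  rw [← map_sub, mul_assoc]
  exact (ContinuousLinearMap.le_opNorm _ _).trans
    (mul_le_mul_of_nonneg_left (h₀ l G G' hG hG') (norm_nonneg _))

theorem norm_superM_jetM_sub_le (he : IsSobolev s e) (hn : 1 ≤ n) (hs : 2 * n + 4 ≤ s)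
    (hf : ContMDiff ((𝓡 (2 * n + 1)).prod 𝓘(ℝ, EuclideanSpace ℝ (Fin r)))
      𝓘(ℝ, EuclideanSpace ℝ (Fin r')) ∞ f) (R : ℝ) : ∃ C : ℝ, 0 ≤ C ∧
    ∀ G G' : smoothFn n M r, (∀ x, ‖G.1 x‖ ≤ R) → (∀ x, ‖G'.1 x‖ ≤ R) →
      ‖superM A he hn hs hf (jetM A r s G) - superM A he hn hs hf (jetM A r s G')‖ ≤
        C * (1 + ‖jetM A r s G‖ + ‖jetM A r s G'‖) ^ s * ‖jetM A r s G - jetM A r s G'‖ := by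
  choose B hB h using norm_superM_jetM_apply_sub_le A he hn hs hf R
  refine ⟨∑ p, B p, Finset.sum_nonneg fun p _ => hB p, fun G G' hG hG' => ?_⟩
  rw [mul_assoc, Finset.sum_mul]
  exact (norm_piLp_two_le_sum _).trans (Finset.sum_le_sum fun p _ => h p G G' hG hG')

variable [CompactSpace M]

/-- Passage to the limit from smooth functions. The strict inequality for the supremum is an open
condition, so approximating functions satisfy it eventually and the constant for R applies to them.
-/
theorem norm_superM_sub_le (he : IsSobolev s e) (hn : 1 ≤ n) (hs : 2 * n + 4 ≤ s)
    (hf : ContMDiff ((𝓡 (2 * n + 1)).prod 𝓘(ℝ, EuclideanSpace ℝ (Fin r)))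
      𝓘(ℝ, EuclideanSpace ℝ (Fin r')) ∞ f) (hs' : 2 * n + 2 ≤ s) (R : ℝ) : ∃ C : ℝ, 0 ≤ C ∧
    ∀ u ∈ closure (range (jetM A r s)), ∀ u' ∈ closure (range (jetM A r s)),
      ‖supExt A hn hs' r u‖ < R → ‖supExt A hn hs' r u'‖ < R →
      ‖superM A he hn hs hf u - superM A he hn hs hf u'‖ ≤
        C * (1 + ‖u‖ + ‖u'‖) ^ s * ‖u - u'‖ := by
  obtain ⟨C, hC, h⟩ := norm_superM_jetM_sub_le A he hn hs hf R
  refine ⟨C, hC, fun u hu u' hu' hR hR' => ?_⟩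
  obtain ⟨v, hv, hvu⟩ := mem_closure_iff_seq_limit.1 hu
  obtain ⟨v', hv', hvu'⟩ := mem_closure_iff_seq_limit.1 hu'
  choose G hG using hv
  choose G' hG' using hv'
  obtain rfl : (fun k => jetM A r s (G k)) = v := funext hG
  obtain rfl : (fun k => jetM A r s (G' k)) = v' := funext hG'
  have hΨ := (contDiff_superM A he hn hs hf).continuous
  have hsup : ∀ {w : Ambient A r s} {K : ℕ → smoothFn n M r},
      Tendsto (fun k => jetM A r s (K k)) atTop (𝓝 w) → ‖supExt A hn hs' r w‖ < R →
      ∀ᶠ k in atTop, ∀ x, ‖(K k).1 x‖ ≤ R := by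
    intro w K hK hw
    have h1 : Tendsto (fun k => ‖supExt A hn hs' r (jetM A r s (K k))‖) atTop
        (𝓝 ‖supExt A hn hs' r w‖) :=
      ((continuous_norm.comp (supExt A hn hs' r).continuous).tendsto w).comp hK
    filter_upwards [h1.eventually_lt_const hw] with k hk x
    rw [← supExt_jetM A hn hs']
    exact (ContinuousMap.norm_coe_le_norm _ x).trans hk.le
  refine le_of_tendsto_of_tendsto (((hΨ.tendsto u).comp hvu).sub ((hΨ.tendsto u').comp hvu')).norm
    (((((hvu.norm.const_add 1).add hvu'.norm).pow s).const_mul C).mul (hvu.sub hvu').norm) ?_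
  filter_upwards [hsup hvu hR, hsup hvu' hR'] with k h1 h2
  exact h _ _ h1 h2

/-- Both sides are continuous in u and agree on jets of smooth functions. -/
theorem supExt_superM (he : IsSobolev s e) (hn : 1 ≤ n) (hs : 2 * n + 4 ≤ s)
    (hf : ContMDiff ((𝓡 (2 * n + 1)).prod 𝓘(ℝ, EuclideanSpace ℝ (Fin r)))
      𝓘(ℝ, EuclideanSpace ℝ (Fin r')) ∞ f) (hs' : 2 * n + 2 ≤ s) {u : Ambient A r s}
    (hu : u ∈ closure (range (jetM A r s))) (x : M) :
    supExt A hn hs' r' (superM A he hn hs hf u) x = f (x, supExt A hn hs' r u x) := by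
  have h1 : Continuous fun u : Ambient A r s => supExt A hn hs' r' (superM A he hn hs hf u) x :=
    (continuous_eval_const x).comp ((supExt A hn hs' r').continuous.comp
      (contDiff_superM A he hn hs hf).continuous)
  have h2 : Continuous fun u : Ambient A r s => f (x, supExt A hn hs' r u x) :=
    hf.continuous.comp (continuous_const.prodMk
      ((continuous_eval_const x).comp (supExt A hn hs' r).continuous))
  refine closure_minimal (t := {u : Ambient A r s | supExt A hn hs' r' (superM A he hn hs hf u) x =
    f (x, supExt A hn hs' r u x)}) ?_ (isClosed_eq h1 h2) hu
  rintro _ ⟨G, rfl⟩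
  rw [mem_ofPred_eq, superM_jetM, supExt_jetM, supExt_jetM]
  rfl

end FollandStein
end

noncomputable section
namespace FollandStein

open scoped ENNReal NNReal Topology
open Set Filter

/-! ### Smooth local left inverses of a bundle injection. -/

section LocalInverse

variable {n : ℕ} {M : Type*} [TopologicalSpace M] [ChartedSpace (Space n) M]
  {V : Type*} [NormedAddCommGroup V] [NormedSpace ℝ V]
  {E : M → Type*} [TopologicalSpace (TotalSpace V E)] [∀ x, AddCommGroup (E x)]
  [∀ x, Module ℝ (E x)] [∀ x, TopologicalSpace (E x)] [FiberBundle V E] [VectorBundle ℝ V E]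

/-- A smooth map into the continuous endomorphisms of a finite-dimensional space can be recognised
pointwise. -/
theorem contMDiffOn_clm_of_apply [FiniteDimensional ℝ V] {T : M → V →L[ℝ] V} {U : Set M}
    (h : ∀ v, ContMDiffOn (𝓡 (2 * n + 1)) 𝓘(ℝ, V) ∞ (fun x => T x v) U) :
    ContMDiffOn (𝓡 (2 * n + 1)) 𝓘(ℝ, V →L[ℝ] V) ∞ T U := by
  set b := Module.finBasis ℝ V
  set L : Fin (Module.finrank ℝ V) → V →L[ℝ] (V →L[ℝ] V) := fun i =>
    ContinuousLinearMap.smulRightL ℝ V V (LinearMap.toContinuousLinearMap (b.coord i))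
  have hT : T = fun x => ∑ i, L i (T x (b i)) := by
    funext x
    refine ContinuousLinearMap.coe_injective (b.ext fun j => ?_)
    simp [L, Finsupp.single_apply]
  rw [hT]
  exact contMDiffOn_finsetSum fun i _ => (L i).contDiff.contMDiff.comp_contMDiffOn (h (b i))

/-- In a trivialisation let A_x be the matrix of ι and B a left inverse of A_{x₀}. Then T_x = B A_x
is the identity at x₀ and so invertible nearby, and T_x⁻¹ B is a left inverse of A_x depending
smoothly on x. -/
theorem exists_local_leftInverse [FiniteDimensional ℝ V]
    [ContMDiffVectorBundle ∞ V E (𝓡 (2 * n + 1))] (ι : BundleInjection n V E) (x₀ : M) :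
    ∃ (U : Set M) (P : M × EuclideanSpace ℝ (Fin ι.r) → TotalSpace V E), IsOpen U ∧ x₀ ∈ U ∧
      ContMDiffOn ((𝓡 (2 * n + 1)).prod 𝓘(ℝ, EuclideanSpace ℝ (Fin ι.r)))
        ((𝓡 (2 * n + 1)).prod 𝓘(ℝ, V)) ∞ P (U ×ˢ univ) ∧
      ∀ x ∈ U, ∀ v : E x, P (x, ι.toFun x v) = ⟨x, v⟩ := by
  have hcomp : CompleteSpace V := FiniteDimensional.complete ℝ V
  set t := trivializationAt V E x₀ with ht
  have hx₀ : x₀ ∈ t.baseSet := mem_baseSet_trivializationAt V E x₀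
  set A : M → V →L[ℝ] EuclideanSpace ℝ (Fin ι.r) := fun x =>
    LinearMap.toContinuousLinearMap (ι.toFun x ∘ₗ t.symmₗ ℝ x) with hA
  have hA_apply : ∀ x ∈ t.baseSet, ∀ v, A x v = ι.toFun x (t.symm x v) := fun x hx v => by
    simp [hA, hx]
  have hinj : Function.Injective (A x₀) := by
    intro v w hvw
    rw [hA_apply x₀ hx₀, hA_apply x₀ hx₀] at hvw
    have h1 := ι.injective x₀ hvw
    have h2 := t.apply_mk_symm hx₀ v
    have h3 := t.apply_mk_symm hx₀ w
    rw [h1, h3] at h2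
    exact (Prod.ext_iff.1 h2).2.symm
  obtain ⟨B', hB'⟩ := (A x₀ : V →ₗ[ℝ] EuclideanSpace ℝ (Fin ι.r)).exists_leftInverse_of_injective
    (LinearMap.ker_eq_bot.2 hinj)
  set B : EuclideanSpace ℝ (Fin ι.r) →L[ℝ] V := LinearMap.toContinuousLinearMap B' with hB
  set T : M → V →L[ℝ] V := fun x => B.comp (A x) with hT
  have hAs : ∀ v, ContMDiffOn (𝓡 (2 * n + 1)) 𝓘(ℝ, EuclideanSpace ℝ (Fin ι.r)) ∞
      (fun x => A x v) t.baseSet := by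
    intro v
    have h1 : ContMDiffOn (𝓡 (2 * n + 1)) ((𝓡 (2 * n + 1)).prod 𝓘(ℝ, V)) ∞
        (fun x => t.toOpenPartialHomeomorph.symm (x, v)) t.baseSet :=
      (t.contMDiffOn_symm (n := ∞) (IB := 𝓡 (2 * n + 1))).comp
        (contMDiff_id.prodMk contMDiff_const).contMDiffOn fun x hx => by
          rw [t.target_eq]; exact ⟨hx, mem_univ _⟩
    refine (ι.smooth.comp_contMDiffOn h1).congr fun x hx => ?_
    rw [hA_apply x hx]
    change _ = ι.toFun (t.toOpenPartialHomeomorph.symm (x, v)).proj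
      (t.toOpenPartialHomeomorph.symm (x, v)).snd
    rw [← t.mk_symm hx]
  have hTs : ContMDiffOn (𝓡 (2 * n + 1)) 𝓘(ℝ, V →L[ℝ] V) ∞ T t.baseSet :=
    contMDiffOn_clm_of_apply fun v => B.contDiff.contMDiff.comp_contMDiffOn (hAs v)
  have hU : IsOpen (t.baseSet ∩ T ⁻¹' {S | IsUnit S}) :=
    hTs.continuousOn.isOpen_inter_preimage t.open_baseSet Units.isOpen
  refine ⟨t.baseSet ∩ T ⁻¹' {S | IsUnit S},
    fun p => t.toOpenPartialHomeomorph.symm (p.1, Ring.inverse (T p.1) (B p.2)), hU, ⟨hx₀, ?_⟩,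
    ?_, ?_⟩
  · have h1 : T x₀ = 1 := by
      ext v
      exact DFunLike.congr_fun hB' v
    rw [mem_preimage, h1]
    exact isUnit_one
  · refine (t.contMDiffOn_symm (n := ∞) (IB := 𝓡 (2 * n + 1))).comp
      (contMDiffOn_fst.prodMk ?_) fun p hp => by
        rw [t.target_eq]; exact ⟨hp.1.1, mem_univ _⟩
    have h1 : ContMDiffOn (𝓡 (2 * n + 1)) 𝓘(ℝ, V →L[ℝ] V) ∞ (fun x => Ring.inverse (T x))
        (t.baseSet ∩ T ⁻¹' {S | IsUnit S}) := by
      intro x hx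
      obtain ⟨S, hS⟩ := hx.2
      have h2 : ContMDiffAt 𝓘(ℝ, V →L[ℝ] V) 𝓘(ℝ, V →L[ℝ] V) ∞ Ring.inverse (T x) := by
        rw [← hS]
        exact (contDiffAt_ringInverse ℝ S).contMDiffAt
      exact h2.comp_contMDiffWithinAt x ((hTs x hx.1).mono inter_subset_left)
    have h3 := h1.comp (t := t.baseSet ∩ T ⁻¹' {S | IsUnit S})
      (contMDiffOn_fst (I := 𝓡 (2 * n + 1)) (J := 𝓘(ℝ, EuclideanSpace ℝ (Fin ι.r)))
        (s := (t.baseSet ∩ T ⁻¹' {S | IsUnit S}) ×ˢ (univ : Set (EuclideanSpace ℝ (Fin ι.r)))))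
      fun p hp => hp.1
    exact h3.clm_apply (B.contDiff.contMDiff.comp_contMDiffOn contMDiffOn_snd)
  · rintro x ⟨hx, hxu⟩ v
    have h1 : t.symm x (t ⟨x, v⟩).2 = v := t.symm_apply_apply_mk hx v
    have h2 : B (ι.toFun x v) = T x (t ⟨x, v⟩).2 := by
      change _ = B (A x _)
      rw [hA_apply x hx, h1]
    have h3 : Ring.inverse (T x) (T x (t ⟨x, v⟩).2) = (t ⟨x, v⟩).2 :=
      DFunLike.congr_fun (Ring.inverse_mul_cancel (T x) hxu) _
    change t.toOpenPartialHomeomorph.symm (x, Ring.inverse (T x) (B (ι.toFun x v))) = _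
    rw [h2, h3, ← t.mk_symm hx, h1]

end LocalInverse

/-! ### Comparison of fibre norms and extension of fibre maps. -/

section Bundles

variable {n : ℕ} {M : Type*} [TopologicalSpace M] [ChartedSpace (Space n) M]
  {V : Type*} [NormedAddCommGroup V] [NormedSpace ℝ V] [FiniteDimensional ℝ V]
  {E : M → Type*} [TopologicalSpace (TotalSpace V E)] [∀ x, AddCommGroup (E x)]
  [∀ x, Module ℝ (E x)] [∀ x, TopologicalSpace (E x)] [FiberBundle V E] [VectorBundle ℝ V E]
  [ContMDiffVectorBundle ∞ V E (𝓡 (2 * n + 1))]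

/-- A section is continuous when its image in the trivial bundle is. -/
theorem continuous_section (ι : BundleInjection n V E) {σ : ∀ x, E x}
    (h : Continuous fun x => ι.toFun x (σ x)) :
    Continuous fun x => (⟨x, σ x⟩ : TotalSpace V E) := by
  refine continuous_iff_continuousAt.2 fun x₀ => ?_
  obtain ⟨U, P, hU, hx₀, hP, hPι⟩ := exists_local_leftInverse ι x₀
  have h1 : ContinuousAt (fun x => P (x, ι.toFun x (σ x))) x₀ :=
    (hP.continuousOn.continuousAt ((hU.prod isOpen_univ).mem_nhds ⟨hx₀, mem_univ _⟩)).comp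
      (f := fun x => (x, ι.toFun x (σ x))) (continuousAt_id.prodMk h.continuousAt)
  refine h1.congr ?_
  filter_upwards [hU.mem_nhds hx₀] with x hx
  exact hPι x hx (σ x)

/-- Locally a continuous norm has a positive minimum on the compact set of unit vectors in the image
of ι; homogeneity and compactness of M do the rest. -/
theorem exists_norm_le_fibreNorm [CompactSpace M] [T2Space M] (ι : BundleInjection n V E)
    (N : FibreNorm V E) : ∃ C : ℝ, 0 ≤ C ∧ ∀ x (v : E x), ‖ι.toFun x v‖ ≤ C * N.toFun x v := by
  suffices h : ∀ K : Set M, IsCompact K →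
      ∃ C : ℝ, 0 ≤ C ∧ ∀ x ∈ K, ∀ v : E x, ‖ι.toFun x v‖ ≤ C * N.toFun x v by
    obtain ⟨C, hC, hC'⟩ := h univ isCompact_univ
    exact ⟨C, hC, fun x => hC' x (mem_univ x)⟩
  intro K hK
  refine hK.induction_on (p := fun K => ∃ C : ℝ, 0 ≤ C ∧ ∀ x ∈ K, ∀ v : E x,
    ‖ι.toFun x v‖ ≤ C * N.toFun x v) ⟨0, le_rfl, by simp⟩ ?_ ?_ ?_
  · rintro S T hST ⟨C, hC, h⟩
    exact ⟨C, hC, fun x hx => h x (hST hx)⟩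
  · rintro S T ⟨C, hC, h⟩ ⟨C', hC', h'⟩
    refine ⟨C + C', by positivity, fun x hx v => ?_⟩
    have h0 : 0 ≤ N.toFun x v := apply_nonneg _ _
    rw [add_mul]
    rcases hx with hx | hx
    · exact (h x hx v).trans (le_add_of_nonneg_right (mul_nonneg hC' h0))
    · exact (h' x hx v).trans (le_add_of_nonneg_left (mul_nonneg hC h0))
  · intro x₀ _
    have : LocallyCompactSpace M := ChartedSpace.locallyCompactSpace (Space n) M
    obtain ⟨U, P, hU, hx₀, hP, hPι⟩ := exists_local_leftInverse ι x₀
    obtain ⟨L, hL, hxL, hLU⟩ := exists_compact_subset hU hx₀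
    set φ : TotalSpace V E → EuclideanSpace ℝ (Fin ι.r) := fun p => ι.toFun p.proj p.snd
    have hcomp : IsCompact (L ×ˢ Metric.sphere (0 : EuclideanSpace ℝ (Fin ι.r)) 1) :=
      hL.prod (isCompact_sphere _ _)
    have hsub : L ×ˢ Metric.sphere (0 : EuclideanSpace ℝ (Fin ι.r)) 1 ⊆ U ×ˢ univ :=
      prod_mono hLU (subset_univ _)
    have hPc := hP.continuousOn.mono hsub
    -- S is compact and contains every unit vector ι(v) over L. At its points ι(P p) is a unit
    -- vector, so P p is not zero and the norm is positive there.
    set S := (L ×ˢ Metric.sphere (0 : EuclideanSpace ℝ (Fin ι.r)) 1) ∩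
      (fun p => (φ (P p), p.2)) ⁻¹' {q | q.1 = q.2} with hS
    have hScl : IsClosed S :=
      ((ι.smooth.continuous.comp_continuousOn hPc).prodMk continuousOn_snd).preimage_isClosed_of_isClosed
        hcomp.isClosed (isClosed_eq continuous_fst continuous_snd)
    have hSc : IsCompact S := hcomp.of_isClosed_subset hScl inter_subset_left
    have hg : ContinuousOn (fun p => N.toFun (P p).proj (P p).snd) S :=
      N.continuous.comp_continuousOn (hPc.mono inter_subset_left)
    have hpos : ∀ p ∈ S, 0 < N.toFun (P p).proj (P p).snd := by
      rintro p ⟨hp, hpS⟩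
      refine lt_of_le_of_ne (apply_nonneg _ _) fun h0 => ?_
      have h1 := N.definite _ _ h0.symm
      have h2 : φ (P p) = p.2 := hpS
      have h3 : ‖p.2‖ = 1 := by simpa using hp.2
      rw [← h2] at h3
      simp [φ, h1] at h3
    obtain ⟨m, hm, hmS⟩ : ∃ m : ℝ, 0 < m ∧ ∀ p ∈ S, m ≤ N.toFun (P p).proj (P p).snd := by
      rcases S.eq_empty_or_nonempty with he | hne
      · exact ⟨1, one_pos, by simp [he]⟩
      · obtain ⟨p, hp, hmin⟩ := hSc.exists_isMinOn hne hg
        exact ⟨_, hpos p hp, fun q hq => hmin hq⟩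
    refine ⟨L, mem_nhdsWithin_of_mem_nhds (mem_interior_iff_mem_nhds.1 hxL), m⁻¹,
      inv_nonneg.2 hm.le, fun x hx v => ?_⟩
    rcases eq_or_ne (ι.toFun x v) 0 with h0 | h0
    · rw [h0, norm_zero]
      exact mul_nonneg (inv_nonneg.2 hm.le) (apply_nonneg _ _)
    have hn0 : 0 < ‖ι.toFun x v‖ := norm_pos_iff.2 h0
    set w : E x := ‖ι.toFun x v‖⁻¹ • v with hw
    have hPw : P (x, ι.toFun x w) = ⟨x, w⟩ := hPι x (hLU hx) w
    have hmem : (x, ι.toFun x w) ∈ S := by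
      refine ⟨⟨hx, ?_⟩, ?_⟩
      · rw [mem_sphere_zero_iff_norm, hw, map_smul, norm_smul, norm_inv, norm_norm,
          inv_mul_cancel₀ hn0.ne']
      · change φ (P (x, ι.toFun x w)) = ι.toFun x w
        rw [hPw]
    have h1 := hmS _ hmem
    rw [hPw] at h1
    change m ≤ N.toFun x w at h1
    rw [hw, map_smul_eq_mul, norm_inv, norm_norm] at h1
    rw [inv_mul_eq_div, le_div_iff₀ hm]
    rwa [inv_mul_eq_div, le_div_iff₀ hn0, mul_comm] at h1

variable [IsManifold (𝓡 (2 * n + 1)) ∞ M] [CompactSpace M] [T2Space M]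
  {V' : Type*} [NormedAddCommGroup V'] [NormedSpace ℝ V']
  {E' : M → Type*} [TopologicalSpace (TotalSpace V' E')] [∀ x, AddCommGroup (E' x)]
  [∀ x, Module ℝ (E' x)] [∀ x, TopologicalSpace (E' x)] [FiberBundle V' E'] [VectorBundle ℝ V' E']

/-- A smooth fibre-preserving map extends to the ambient trivial bundles. -/
theorem exists_extension_fibre_map (ι : BundleInjection n V E) (ι' : BundleInjection n V' E')
    {F : ∀ x : M, E x → E' x}
    (hF : ContMDiff ((𝓡 (2 * n + 1)).prod 𝓘(ℝ, V)) ((𝓡 (2 * n + 1)).prod 𝓘(ℝ, V')) ∞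
      (fun p : TotalSpace V E => (⟨p.proj, F p.proj p.snd⟩ : TotalSpace V' E'))) :
    ∃ f : M × EuclideanSpace ℝ (Fin ι.r) → EuclideanSpace ℝ (Fin ι'.r),
      ContMDiff ((𝓡 (2 * n + 1)).prod 𝓘(ℝ, EuclideanSpace ℝ (Fin ι.r)))
        𝓘(ℝ, EuclideanSpace ℝ (Fin ι'.r)) ∞ f ∧
      ∀ x (v : E x), f (x, ι.toFun x v) = ι'.toFun x (F x v) := by
  suffices h : ∃ f : C^∞⟮(𝓡 (2 * n + 1)).prod 𝓘(ℝ, EuclideanSpace ℝ (Fin ι.r)),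
      M × EuclideanSpace ℝ (Fin ι.r); 𝓘(ℝ, EuclideanSpace ℝ (Fin ι'.r)),
      EuclideanSpace ℝ (Fin ι'.r)⟯, ∀ p, f p ∈ {w | ∀ v : E p.1, ι.toFun p.1 v = p.2 →
        w = ι'.toFun p.1 (F p.1 v)} by
    obtain ⟨f, hf⟩ := h
    exact ⟨f, f.contMDiff, fun x v => hf (x, ι.toFun x v) v rfl⟩
  -- The value of f is prescribed on the image of ι and free elsewhere, which is a convex condition
  -- at each point. Local solutions ι' ∘ F ∘ P come from the left inverse P and are glued by a
  -- partition of unity.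
  refine exists_contMDiffMap_forall_mem_convex_of_local _ ?_ ?_
  · intro p w hw w' hw' a b _ _ hab v hv
    rw [hw v hv, hw' v hv, ← add_smul, hab, one_smul]
  · rintro ⟨x₀, v₀⟩
    obtain ⟨U, P, hU, hx₀, hP, hPι⟩ := exists_local_leftInverse ι x₀
    refine ⟨U ×ˢ univ, (hU.prod isOpen_univ).mem_nhds ⟨hx₀, mem_univ _⟩,
      fun p => ι'.toFun (P p).proj (F (P p).proj (P p).snd),
      ι'.smooth.comp_contMDiffOn (hF.comp_contMDiffOn hP), ?_⟩
    rintro ⟨x, w⟩ hx (v : E x) (rfl : ι.toFun x v = w)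
    change ι'.toFun (P (x, ι.toFun x v)).proj _ = _
    rw [hPι x hx.1 v]

end Bundles

end FollandStein
end

noncomputable section
namespace FollandStein

open scoped ENNReal NNReal Topology
open Set Filter

/-! ### The bounding polynomial C (1 + a + b)^s. -/

section Polynomial

theorem coeff_pow_nonneg {τ : Type*} {p : MvPolynomial τ ℝ} (hp : ∀ m, 0 ≤ p.coeff m)
    (k : ℕ) (m : τ →₀ ℕ) : 0 ≤ (p ^ k).coeff m := by
  classical
  induction k generalizing m with
  | zero => rw [pow_zero, MvPolynomial.coeff_one]; split_ifs <;> norm_num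
  | succ k ih =>
    rw [pow_succ, MvPolynomial.coeff_mul]
    exact Finset.sum_nonneg fun q _ => mul_nonneg (ih _) (hp _)

theorem exists_polynomial {C : ℝ} (hC : 0 ≤ C) (s : ℕ) : ∃ Q : MvPolynomial (Fin 2) ℝ,
    (∀ m, 0 ≤ Q.coeff m) ∧ Q.totalDegree ≤ s ∧
      ∀ a b : ℝ, MvPolynomial.eval ![a, b] Q = C * (1 + a + b) ^ s := by
  classical
  set p : MvPolynomial (Fin 2) ℝ := 1 + MvPolynomial.X 0 + MvPolynomial.X 1 with hp
  have hp0 : ∀ m, 0 ≤ p.coeff m := by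
    intro m
    rw [hp, MvPolynomial.coeff_add, MvPolynomial.coeff_add, MvPolynomial.coeff_one,
      MvPolynomial.coeff_X, MvPolynomial.coeff_X]
    split_ifs <;> norm_num
  have hpd : p.totalDegree ≤ 1 := by
    refine (MvPolynomial.totalDegree_add _ _).trans (max_le
      ((MvPolynomial.totalDegree_add _ _).trans (max_le ?_ ?_)) ?_)
    · simp
    · simp
    · simp
  refine ⟨MvPolynomial.C C * p ^ s, fun m => ?_, ?_, fun a b => ?_⟩
  · rw [MvPolynomial.coeff_C_mul]
    exact mul_nonneg hC (coeff_pow_nonneg hp0 s m)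
  · refine (MvPolynomial.totalDegree_mul _ _).trans ?_
    rw [MvPolynomial.totalDegree_C, zero_add]
    refine (MvPolynomial.totalDegree_pow _ _).trans ?_
    nlinarith
  · simp [hp]

end Polynomial

/-! ### Elements of Γ^s(E) as continuous sections. -/

section Jets

variable {n : ℕ} {M : Type*} [TopologicalSpace M] [ChartedSpace (Space n) M]
  {η : ContactForm n M} (A : AdaptedAtlas η)
  {V : Type*} [NormedAddCommGroup V] [NormedSpace ℝ V]
  {E : M → Type*} [TopologicalSpace (TotalSpace V E)] [∀ x, AddCommGroup (E x)]
  [∀ x, Module ℝ (E x)] [∀ x, TopologicalSpace (E x)] [FiberBundle V E] [VectorBundle ℝ V E]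
  (ι : BundleInjection n V E) {s : ℕ} [IsManifold (𝓡 (2 * n + 1)) ∞ M]

theorem mem_smoothJets_iff {u : Ambient A ι.r s} : u ∈ smoothJets A ι s ↔
    ∃ σ : ∀ x, E x, ContMDiff (𝓡 (2 * n + 1)) ((𝓡 (2 * n + 1)).prod 𝓘(ℝ, V)) ∞
      (fun x => (⟨x, σ x⟩ : TotalSpace V E)) ∧
      ∃ G : smoothFn n M ι.r, (∀ x, G.1 x = ι.toFun x (σ x)) ∧ jetM A ι.r s G = u := by
  have key : ∀ (σ : ∀ x, E x) (G : smoothFn n M ι.r), (∀ x, G.1 x = ι.toFun x (σ x)) →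
      ∀ a, localRep A ι σ a = fun y => G.1 ((A.chart a).symm y) := fun σ G h a =>
    funext fun y => (h _).symm
  constructor
  · rintro ⟨σ, hσ, h⟩
    refine ⟨σ, hσ, ⟨fun x => ι.toFun x (σ x), ι.smooth.comp hσ⟩, fun x => rfl, ?_⟩
    ext1 p
    refine Lp.ext ((coeFn_jetM A s _ p.1 p.2).trans ?_)
    refine EventuallyEq.trans ?_ (h p.1 p.2).symm
    rw [horDeriv_eq_horDL]
    rfl
  · rintro ⟨σ, hσ, G, hG, rfl⟩
    refine ⟨σ, hσ, fun a I => ?_⟩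
    rw [key σ G hG, horDeriv_eq_horDL]
    exact coeFn_jetM A s G a I

variable [ContMDiffVectorBundle ∞ V E (𝓡 (2 * n + 1))]

/-- Jets of smooth sections already form a subspace, so the span adds nothing. Closed conditions on
Γ^s(E) therefore need to be checked only on jets of smooth sections. -/
theorem coe_FSSpace : (FSSpace A ι s : Set (Ambient A ι.r s)) = closure (smoothJets A ι s) := by
  rw [FSSpace, Submodule.topologicalClosure_coe]
  congr 1
  refine subset_antisymm (fun u hu => ?_) Submodule.subset_span
  refine Submodule.span_induction (p := fun u _ => u ∈ smoothJets A ι s) (fun u hu => hu) ?_ ?_ ?_ hu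
  · refine (mem_smoothJets_iff A ι).2 ⟨fun _ => 0, ?_, 0, fun x => (map_zero _).symm, map_zero _⟩
    exact contMDiff_zeroSection ℝ E
  · intro u v _ _ hu hv
    obtain ⟨σ, hσ, G, hG, rfl⟩ := (mem_smoothJets_iff A ι).1 hu
    obtain ⟨τ, hτ, G', hG', rfl⟩ := (mem_smoothJets_iff A ι).1 hv
    refine (mem_smoothJets_iff A ι).2 ⟨fun x => σ x + τ x, hσ.add_section hτ, G + G',
      fun x => ?_, map_add _ _ _⟩
    rw [map_add, ← hG, ← hG']
    rfl
  · intro c u _ hu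
    obtain ⟨σ, hσ, G, hG, rfl⟩ := (mem_smoothJets_iff A ι).1 hu
    refine (mem_smoothJets_iff A ι).2 ⟨fun x => c • σ x, hσ.const_smul_section, c • G,
      fun x => ?_, map_smul _ _ _⟩
    rw [map_smul, ← hG]
    rfl

theorem FSSpace_subset : (FSSpace A ι s : Set (Ambient A ι.r s)) ⊆
    closure (range (jetM A ι.r s)) := by
  rw [coe_FSSpace]
  refine closure_mono fun u hu => ?_
  obtain ⟨-, -, G, -, hG⟩ := (mem_smoothJets_iff A ι).1 hu
  exact ⟨G, hG⟩

variable [CompactSpace M]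

/-- The image of a fibre is a finite-dimensional, hence closed, subspace, and evaluation at x is
continuous in u. -/
theorem supExt_mem_range (hn : 1 ≤ n) (hs : 2 * n + 2 ≤ s) (u : FSSpace A ι s) (x : M) :
    ∃ v : E x, ι.toFun x v = supExt A hn hs ι.r u.1 x := by
  have hcl : IsClosed {u : Ambient A ι.r s | supExt A hn hs ι.r u x ∈
      (LinearMap.range (ι.toFun x) : Set (EuclideanSpace ℝ (Fin ι.r)))} :=
    (Submodule.closed_of_finiteDimensional _).preimage
      ((continuous_eval_const x).comp (supExt A hn hs ι.r).continuous)
  have hu : u.1 ∈ closure (smoothJets A ι s) := by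
    rw [← coe_FSSpace]; exact u.2
  refine closure_minimal (fun v hv => ?_) hcl hu
  obtain ⟨σ, -, G, hG, rfl⟩ := (mem_smoothJets_iff A ι).1 hv
  rw [mem_ofPred_eq, supExt_jetM, hG]
  exact ⟨_, rfl⟩

/-- Continuous functions that agree almost everywhere on the open set D_a agree on it, and the D_a
cover M. Conversely, ι has continuous local left inverses, so a continuous ι ∘ σ forces a continuous
σ. -/
theorem isSectionOf_iff [FiniteDimensional ℝ V] (hn : 1 ≤ n) (hs : 2 * n + 2 ≤ s)
    (u : FSSpace A ι s) (σ : ∀ x, E x) :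
    IsSectionOf A ι s u σ ↔ ∀ x, ι.toFun x (σ x) = supExt A hn hs ι.r u.1 x := by
  have hae := coeFn_component_zero A hn hs (FSSpace_subset A ι u.2)
  constructor
  · rintro ⟨hσ, h⟩ x
    obtain ⟨a, hx, hxa⟩ := A.cover x
    have hsymm : ContinuousOn (A.chart a).symm (A.dom a) :=
      (A.chart a).continuousOn_symm.mono (A.dom_subset a)
    have h1 : ContinuousOn (localRep A ι σ a) (A.dom a) :=
      (ι.smooth.continuous.comp hσ).comp_continuousOn hsymm
    have h2 : ContinuousOn (fun y => supExt A hn hs ι.r u.1 ((A.chart a).symm y)) (A.dom a) :=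
      (supExt A hn hs ι.r u.1).continuous.comp_continuousOn hsymm
    have h3 := Measure.eqOn_open_of_ae_eq ((h a).symm.trans (hae a)) (A.isOpen_dom a) h1 h2 hxa
    simp only [localRep] at h3
    rwa [(A.chart a).left_inv hx] at h3
  · intro h
    refine ⟨continuous_section ι ?_, fun a => (hae a).trans (Eventually.of_forall fun y => ?_)⟩
    · simp only [h]
      exact (supExt A hn hs ι.r u.1).continuous
    · exact (h _).symm

theorem existsUnique_isSectionOf [FiniteDimensional ℝ V] (hn : 1 ≤ n) (hs : 2 * n + 2 ≤ s)
    (u : FSSpace A ι s) : ∃! σ, IsSectionOf A ι s u σ := by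
  choose σ hσ using supExt_mem_range A ι hn hs u
  refine ⟨σ, (isSectionOf_iff A ι hn hs u σ).2 hσ, fun τ hτ => funext fun x => ι.injective x ?_⟩
  rw [hσ, (isSectionOf_iff A ι hn hs u τ).1 hτ]

theorem eq_of_isSectionOf [FiniteDimensional ℝ V] (hn : 1 ≤ n) (hs : 2 * n + 2 ≤ s)
    {u u' : FSSpace A ι s} {σ : ∀ x, E x} (h : IsSectionOf A ι s u σ)
    (h' : IsSectionOf A ι s u' σ) : u = u' := by
  refine Subtype.ext (eq_of_supExt_eq A hn hs (FSSpace_subset A ι u.2) (FSSpace_subset A ι u'.2)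
    (ContinuousMap.ext fun x => ?_))
  rw [← (isSectionOf_iff A ι hn hs u σ).1 h, (isSectionOf_iff A ι hn hs u' σ).1 h']

end Jets

/-! ### The operator between Folland-Stein spaces of sections and its bound. -/

section Superposition

/-- The restricted map is Ψ followed by the orthogonal projection onto S, which is bounded and
linear. -/
theorem contDiff_codRestrict {X K : Type*} [NormedAddCommGroup X] [NormedSpace ℝ X]
    [NormedAddCommGroup K] [InnerProductSpace ℝ K] [CompleteSpace K] {S : Submodule ℝ K}
    {Ψ : X → K} (hΨ : ContDiff ℝ ∞ Ψ) (h : ∀ x, Ψ x ∈ S) (hS : IsClosed (S : Set K)) :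
    ContDiff ℝ ∞ fun x => (⟨Ψ x, h x⟩ : S) := by
  have : CompleteSpace S := hS.completeSpace_coe
  have h1 : (fun x => (⟨Ψ x, h x⟩ : S)) = S.orthogonalProjectionOnto ∘ Ψ := funext fun x =>
    (S.orthogonalProjectionOnto_mem_subspace_eq_self ⟨Ψ x, h x⟩).symm
  rw [h1]
  exact S.orthogonalProjectionOnto.contDiff.comp hΨ

variable {n : ℕ} {M : Type*} [TopologicalSpace M] [ChartedSpace (Space n) M]
  {η : ContactForm n M} (A : AdaptedAtlas η)
  {V : Type*} [NormedAddCommGroup V] [NormedSpace ℝ V]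
  {E : M → Type*} [TopologicalSpace (TotalSpace V E)] [∀ x, AddCommGroup (E x)]
  [∀ x, Module ℝ (E x)] [∀ x, TopologicalSpace (E x)] [FiberBundle V E] [VectorBundle ℝ V E]
  [ContMDiffVectorBundle ∞ V E (𝓡 (2 * n + 1))]
  {V' : Type*} [NormedAddCommGroup V'] [NormedSpace ℝ V']
  {E' : M → Type*} [TopologicalSpace (TotalSpace V' E')] [∀ x, AddCommGroup (E' x)]
  [∀ x, Module ℝ (E' x)] [∀ x, TopologicalSpace (E' x)] [FiberBundle V' E'] [VectorBundle ℝ V' E']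
  [ContMDiffVectorBundle ∞ V' E' (𝓡 (2 * n + 1))]
  (ι : BundleInjection n V E) (ι' : BundleInjection n V' E') {s : ℕ}
  [IsManifold (𝓡 (2 * n + 1)) ∞ M]
  {H : Type*} [NormedAddCommGroup H] [NormedSpace ℝ H] [CompleteSpace H] {e : testFn n →ₗ[ℝ] H}

/-- The continuous operator takes the jet of a smooth section σ to the jet of the smooth section F ∘
σ, hence closure to closure. -/
theorem superM_mem_FSSpace (he : IsSobolev s e) (hn : 1 ≤ n) (hs : 2 * n + 4 ≤ s)
    {F : ∀ x : M, E x → E' x}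
    (hF : ContMDiff ((𝓡 (2 * n + 1)).prod 𝓘(ℝ, V)) ((𝓡 (2 * n + 1)).prod 𝓘(ℝ, V')) ∞
      (fun p : TotalSpace V E => (⟨p.proj, F p.proj p.snd⟩ : TotalSpace V' E')))
    {f : M × EuclideanSpace ℝ (Fin ι.r) → EuclideanSpace ℝ (Fin ι'.r)}
    (hf : ContMDiff ((𝓡 (2 * n + 1)).prod 𝓘(ℝ, EuclideanSpace ℝ (Fin ι.r)))
      𝓘(ℝ, EuclideanSpace ℝ (Fin ι'.r)) ∞ f)
    (hfF : ∀ x (v : E x), f (x, ι.toFun x v) = ι'.toFun x (F x v))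
    {u : Ambient A ι.r s} (hu : u ∈ FSSpace A ι s) :
    superM A he hn hs hf u ∈ FSSpace A ι' s := by
  rw [← SetLike.mem_coe, coe_FSSpace] at hu ⊢
  refine map_mem_closure (contDiff_superM A he hn hs hf).continuous hu fun v hv => ?_
  obtain ⟨σ, hσ, G, hG, rfl⟩ := (mem_smoothJets_iff A ι).1 hv
  rw [superM_jetM]
  refine (mem_smoothJets_iff A ι').2 ⟨fun x => F x (σ x), hF.comp hσ, compSmooth hf G,
    fun x => ?_, rfl⟩
  rw [← hfF, ← hG]
  rfl

variable [CompactSpace M] [T2Space M] [FiniteDimensional ℝ V]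

theorem norm_supExt_le_of_fibreNorm_lt (hn : 1 ≤ n) (hs : 2 * n + 2 ≤ s) {N : FibreNorm V E}
    {B c : ℝ} (hB : 0 ≤ B) (hBN : ∀ x (v : E x), ‖ι.toFun x v‖ ≤ B * N.toFun x v) (hc : 0 ≤ c)
    {u u' : FSSpace A ι s} {σ σ' : ∀ x, E x} (hσ : IsSectionOf A ι s u σ)
    (hσ' : IsSectionOf A ι s u' σ') (h : ∀ x, N.toFun x (σ' x - σ x) < c) :
    ‖supExt A hn hs ι.r u'.1‖ ≤ ‖supExt A hn hs ι.r u.1‖ + B * c := by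
  rw [isSectionOf_iff A ι hn hs] at hσ hσ'
  refine (ContinuousMap.norm_le _ (add_nonneg (norm_nonneg _) (mul_nonneg hB hc))).2 fun x => ?_
  have h1 : supExt A hn hs ι.r u'.1 x = supExt A hn hs ι.r u.1 x + ι.toFun x (σ' x - σ x) := by
    rw [map_sub, hσ, hσ', add_sub_cancel]
  rw [h1]
  refine (norm_add_le _ _).trans (add_le_add (ContinuousMap.norm_coe_le_norm _ x) ?_)
  exact (hBN x _).trans (mul_le_mul_of_nonneg_left (h x).le hB)

theorem exists_polynomial_bound (he : IsSobolev s e) (hn : 1 ≤ n) (hs : 2 * n + 4 ≤ s) {r' : ℕ}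
    {f : M × EuclideanSpace ℝ (Fin ι.r) → EuclideanSpace ℝ (Fin r')}
    (hf : ContMDiff ((𝓡 (2 * n + 1)).prod 𝓘(ℝ, EuclideanSpace ℝ (Fin ι.r)))
      𝓘(ℝ, EuclideanSpace ℝ (Fin r')) ∞ f)
    (N : FibreNorm V E) (u : FSSpace A ι s) (σ : ∀ x, E x) (hσ : IsSectionOf A ι s u σ)
    (c : ℝ) (hc : 0 < c) :
    ∃ Q : MvPolynomial (Fin 2) ℝ, (∀ m, 0 ≤ Q.coeff m) ∧ Q.totalDegree ≤ s ∧
      ∀ (u' : FSSpace A ι s) (σ' : ∀ x, E x), IsSectionOf A ι s u' σ' →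
        (∀ x, N.toFun x (σ' x - σ x) < c) →
        ‖superM A he hn hs hf u.1 - superM A he hn hs hf u'.1‖ ≤
          ‖u - u'‖ * MvPolynomial.eval ![‖u‖, ‖u'‖] Q := by
  have hs' : 2 * n + 2 ≤ s := by omega
  obtain ⟨B, hB, hBN⟩ := exists_norm_le_fibreNorm ι N
  -- All admissible σ' have supremum at most that of σ plus B c, so one constant serves for all of
  -- them; the summand 1 makes the inequalities strict.
  obtain ⟨C, hC, hCΨ⟩ := norm_superM_sub_le A he hn hs hf hs'
    (‖supExt A hn hs' ι.r u.1‖ + B * c + 1)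
  obtain ⟨Q, hQ0, hQs, hQ⟩ := exists_polynomial hC s
  refine ⟨Q, hQ0, hQs, fun u' σ' hσ' hN => ?_⟩
  have hBc : 0 ≤ B * c := mul_nonneg hB hc.le
  have hsup := norm_supExt_le_of_fibreNorm_lt A ι hn hs' hB hBN hc.le hσ hσ' hN
  have h1 : ‖supExt A hn hs' ι.r u.1‖ < ‖supExt A hn hs' ι.r u.1‖ + B * c + 1 := by
    rw [add_assoc]
    exact lt_add_of_pos_right _ (add_pos_of_nonneg_of_pos hBc one_pos)
  have h2 := hCΨ u.1 (FSSpace_subset A ι u.2) u'.1 (FSSpace_subset A ι u'.2) h1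
    (hsup.trans_lt (lt_add_one _))
  exact h2.trans_eq ((mul_comm _ _).trans (congrArg (‖u - u'‖ * ·) (hQ ‖u‖ ‖u'‖).symm))

end Superposition

end FollandStein
end

/-! ### The theorem. -/

theorem mainTheorem9 (n : ℕ) (hn : 1 ≤ n)
    {M : Type*} [TopologicalSpace M] [ChartedSpace (FollandStein.Space n) M]
    [IsManifold (𝓡 (2 * n + 1)) ∞ M] [CompactSpace M] [T2Space M]
    (η : FollandStein.ContactForm n M) (A : FollandStein.AdaptedAtlas η)
    {V₁ : Type*} [NormedAddCommGroup V₁] [NormedSpace ℝ V₁] [FiniteDimensional ℝ V₁]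
    {E₁ : M → Type*} [TopologicalSpace (Bundle.TotalSpace V₁ E₁)] [∀ x, AddCommGroup (E₁ x)]
    [∀ x, Module ℝ (E₁ x)] [∀ x, TopologicalSpace (E₁ x)] [FiberBundle V₁ E₁]
    [VectorBundle ℝ V₁ E₁] [ContMDiffVectorBundle ∞ V₁ E₁ (𝓡 (2 * n + 1))]
    {V₂ : Type*} [NormedAddCommGroup V₂] [NormedSpace ℝ V₂] [FiniteDimensional ℝ V₂]
    {E₂ : M → Type*} [TopologicalSpace (Bundle.TotalSpace V₂ E₂)] [∀ x, AddCommGroup (E₂ x)]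
    [∀ x, Module ℝ (E₂ x)] [∀ x, TopologicalSpace (E₂ x)] [FiberBundle V₂ E₂]
    [VectorBundle ℝ V₂ E₂] [ContMDiffVectorBundle ∞ V₂ E₂ (𝓡 (2 * n + 1))]
    (ι₁ : FollandStein.BundleInjection n V₁ E₁) (ι₂ : FollandStein.BundleInjection n V₂ E₂)
    (F : ∀ x : M, E₁ x → E₂ x)
    (hF : ContMDiff ((𝓡 (2 * n + 1)).prod 𝓘(ℝ, V₁)) ((𝓡 (2 * n + 1)).prod 𝓘(ℝ, V₂)) ∞
      (fun p : Bundle.TotalSpace V₁ E₁ =>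
        (⟨p.proj, F p.proj p.snd⟩ : Bundle.TotalSpace V₂ E₂)))
    (s : ℕ) (hs : 2 * n + 4 ≤ s) :
    -- elements of `Γ^s(E₁)` and `Γ^s(E₂)` are the same thing as certain continuous sections
    ((∀ u, ∃! σ, FollandStein.IsSectionOf A ι₁ s u σ) ∧
      (∀ u u' σ, FollandStein.IsSectionOf A ι₁ s u σ →
        FollandStein.IsSectionOf A ι₁ s u' σ → u = u')) ∧
    ((∀ w, ∃! τ, FollandStein.IsSectionOf A ι₂ s w τ) ∧
      (∀ w w' τ, FollandStein.IsSectionOf A ι₂ s w τ →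
        FollandStein.IsSectionOf A ι₂ s w' τ → w = w')) ∧
    -- `Φ` is left composition with `F`
    ∃ Φ : FollandStein.FSSpace A ι₁ s → FollandStein.FSSpace A ι₂ s,
      (∀ u σ, FollandStein.IsSectionOf A ι₁ s u σ →
        FollandStein.IsSectionOf A ι₂ s (Φ u) (fun x => F x (σ x))) ∧
      ContDiff ℝ ∞ Φ ∧
      ∀ (N : FollandStein.FibreNorm V₁ E₁) (u : FollandStein.FSSpace A ι₁ s) (σ : ∀ x, E₁ x),
        FollandStein.IsSectionOf A ι₁ s u σ →
        ∀ c : ℝ, 0 < c →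
          ∃ Q : MvPolynomial (Fin 2) ℝ, (∀ m, 0 ≤ Q.coeff m) ∧ Q.totalDegree ≤ s ∧
            ∀ (u' : FollandStein.FSSpace A ι₁ s) (σ' : ∀ x, E₁ x),
              FollandStein.IsSectionOf A ι₁ s u' σ' →
              (∀ x, N.toFun x (σ' x - σ x) < c) →
              ‖Φ u - Φ u'‖ ≤ ‖u - u'‖ * MvPolynomial.eval ![‖u‖, ‖u'‖] Q := by
  have hs' : 2 * n + 2 ≤ s := by omega
  refine ⟨⟨FollandStein.existsUnique_isSectionOf A ι₁ hn hs',
      fun u u' σ => FollandStein.eq_of_isSectionOf A ι₁ hn hs'⟩,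
    ⟨FollandStein.existsUnique_isSectionOf A ι₂ hn hs',
      fun w w' τ => FollandStein.eq_of_isSectionOf A ι₂ hn hs'⟩, ?_⟩
  obtain ⟨H, _, _, _, e, he⟩ := FollandStein.exists_isSobolev n s
  obtain ⟨f, hf, hfF⟩ := FollandStein.exists_extension_fibre_map ι₁ ι₂ hF
  have hmem : ∀ u ∈ FollandStein.FSSpace A ι₁ s,
      FollandStein.superM A he hn hs hf u ∈ FollandStein.FSSpace A ι₂ s :=
    fun u hu => FollandStein.superM_mem_FSSpace A ι₁ ι₂ he hn hs hF hf hfF hu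
  refine ⟨fun u => ⟨FollandStein.superM A he hn hs hf u.1, hmem u.1 u.2⟩, ?_, ?_, ?_⟩
  · intro u σ hσ
    rw [FollandStein.isSectionOf_iff A ι₁ hn hs'] at hσ
    rw [FollandStein.isSectionOf_iff A ι₂ hn hs']
    intro x
    rw [FollandStein.supExt_superM A he hn hs hf hs' (FollandStein.FSSpace_subset A ι₁ u.2),
      ← hσ x, hfF]
  · exact FollandStein.contDiff_codRestrict 
      ((FollandStein.contDiff_superM A he hn hs hf).comp
        (FollandStein.FSSpace A ι₁ s).subtypeL.contDiff)
      (fun u => hmem u.1 u.2) (Submodule.isClosed_topologicalClosure _)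
  · intro N u σ hσ c hc
    exact FollandStein.exists_polynomial_bound A ι₁ he hn hs hf N u σ hσ c hc
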